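/- Let $d\ge 1$ be an integer and $0<s<\frac d2$. For $\varphi\in C_c^\infty(\mathbb R^d)$ (real-valued) let $\hat\varphi(\xi)=(2\pi)^{-d/2}\int_{\mathbb R^d}\varphi(x)e^{-ix\cdot\xi}\,dx$, let $(-\Delta)^s\varphi$ be the function with Fourier transform $|\xi|^{2s}\hat\varphi(\xi)$, and put $\|\varphi\|_{\mathring H^s}=\big(\int_{\mathbb R^d}|\xi|^{2s}|\hat\varphi(\xi)|^2d\xi\big)^{1/2}$. Let $\mathscr L^1_{2s}(\mathbb R^d)$ be the set of $u\in L^1_{loc}(\mathbb R^d)$ with $\int_{\mathbb R^d}\frac{|u(x)|}{(1+|x|)^{d+2s}}dx<\infty$. For $u\in\mathscr L^1_{2s}(\mathbb R^d)$ and $T\in L^1_{loc}(\mathbb R^d)$ we say that $(-\Delta)^su=T$ in $\mathscr D'(\mathbb R^d)$ if $\int u\,(-\Delta)^s\varphi\,dx=\int T\varphi\,dx$ for all $\varphi\in C_c^\infty(\mathbb R^d)$. Let $A_{2s}=\frac{\Gamma((d-2s)/2)}{\pi^{d/2}2^{2s}\Gamma(s)}$. Let $0\le T\in \mathring H^{-s}(\mathbb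 R^d)\cap L^1_{loc}(\mathbb R^d)$, that is, $T\in L^1_{loc}(\mathbb R^d)$, $T\ge 0$ almost everywhere, and there is a constant $C$ with $|\int T\varphi\,dx|\le C\|\varphi\|_{\mathring H^s}$ for all $\varphi\in C_c^\infty(\mathbb R^d)$. Let $l\in\mathbb R$ and let $u:\mathbb R^d\to\mathbb R$ be a function. (1) The following are equivalent: (a) $u\in\mathscr L^1_{2s}(\mathbb R^d)$, $(-\Delta)^su=T$ in $\mathscr D'(\mathbb R^d)$, and $$\liminf_{R\to\infty}\frac1{R^d}\int_{R<|x-y|<2R}|u(y)-l|\,dy=0\quad\text{for a.e. }x\in\mathbb R^d;$$ (b) for a.e. $x\in\mathbb R^d$ the following integral converges absolutely and $$u(x)=A_{2s}\int_{\mathbb R^d}\frac{T(y)}{|x-y|^{d-2s}}\,dy+l.$$ (2) If the condition on the $\liminf$ in (a) is weakened to $$\liminf_{R\to\infty}\frac1{R^d}\int_{R<|x-y|<2R}|u(y)-l|\,dy<\infty\quad\text{for a.e. }x\in\mathbb R^d,$$ then (a) is equivalent to the existence of a constant $c\in\mathbb R$ such that (b) holds with $c$ in place of $l$. -/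

import Mathlib

open MeasureTheory Filter
open scoped ContDiff FourierTransform ENNReal

noncomputable section

/-- The fractional Laplacian of a real smooth, rapidly decaying function on `ℝ^d`, defined by the
Fourier multiplier `|ξ|^{2s}`. Mathlib's Fourier transform has the kernel `exp (-2π i ⟪x, ξ⟫)`, so
in its frequency variable the multiplier is `(2π|ξ|)^{2s}`. As the multiplier is real and even, the
inverse transform is real and taking the real part loses nothing. -/
def fracLaplacian {d : ℕ} (s : ℝ) (φ : EuclideanSpace ℝ (Fin d) → ℝ)
    (x : EuclideanSpace ℝ (Fin d)) : ℝ :=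
  (𝓕⁻ (fun ξ : EuclideanSpace ℝ (Fin d) =>
    (((2 * Real.pi * ‖ξ‖) ^ (2 * s) : ℝ) : ℂ) * 𝓕 (fun y => (φ y : ℂ)) ξ) x).re

/-- The homogeneous Sobolev norm `(∫ |ξ|^{2s} |φ̂(ξ)|² dξ)^{1/2}` of a test function, with `φ̂` the
unitary Fourier transform in the angular frequency; here it is written in Mathlib's frequency
variable. -/
def homSobolevNorm {d : ℕ} (s : ℝ) (φ : EuclideanSpace ℝ (Fin d) → ℝ) : ℝ :=
  Real.sqrt (∫ ξ : EuclideanSpace ℝ (Fin d),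
    (2 * Real.pi * ‖ξ‖) ^ (2 * s) * ‖𝓕 (fun y => (φ y : ℂ)) ξ‖ ^ 2)

/-- `T ∈ H̊^{-s}(ℝ^d) ∩ L¹_loc(ℝ^d)`: `T` is locally integrable, and the functional `φ ↦ ∫ T φ` on
`C_c^∞(ℝ^d)` is bounded for the norm of `H̊^s(ℝ^d)`. -/
def MemDualHomSobolevL1Loc {d : ℕ} (s : ℝ) (T : EuclideanSpace ℝ (Fin d) → ℝ) : Prop :=
  LocallyIntegrable T volume ∧
    ∃ C : ℝ, ∀ φ : EuclideanSpace ℝ (Fin d) → ℝ, ContDiff ℝ ∞ φ → HasCompactSupport φ →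
      |∫ x, T x * φ x| ≤ C * homSobolevNorm s φ

/-- The weighted space of all `u ∈ L¹_loc(ℝ^d)` with `∫ |u(x)| / (1 + |x|)^{d + 2s} dx < ∞`. -/
def MemWeightedL1 {d : ℕ} (s : ℝ) (u : EuclideanSpace ℝ (Fin d) → ℝ) : Prop :=
  LocallyIntegrable u volume ∧
    Integrable (fun x => |u x| / (1 + ‖x‖) ^ ((d : ℝ) + 2 * s)) volume

/-- `(-Δ)^s u = T` in `𝒟'(ℝ^d)`, for `u` in the weighted space above and locally integrable `T`. -/
def SolvesFracPoisson {d : ℕ} (s : ℝ) (u T : EuclideanSpace ℝ (Fin d) → ℝ) : Prop :=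
  ∀ φ : EuclideanSpace ℝ (Fin d) → ℝ, ContDiff ℝ ∞ φ → HasCompactSupport φ →
    ∫ x, u x * fracLaplacian s φ x = ∫ x, T x * φ x

/-- `liminf_{R → ∞} R^{-d} ∫_{R < |x - y| < 2R} |u(y) - l| dy`, as an element of `[0, ∞]`. -/
def ringLiminf {d : ℕ} (u : EuclideanSpace ℝ (Fin d) → ℝ) (l : ℝ)
    (x : EuclideanSpace ℝ (Fin d)) : ℝ≥0∞ :=
  liminf (fun R : ℝ => (ENNReal.ofReal (R ^ d))⁻¹ *
    ∫⁻ y in {y | R < ‖x - y‖ ∧ ‖x - y‖ < 2 * R}, ENNReal.ofReal |u y - l|) atTop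

/-- The constant `A_α = Γ((d - α)/2) / (π^{d/2} 2^α Γ(α/2))` of the Riesz kernel on `ℝ^d`. -/
def rieszConst (d : ℕ) (α : ℝ) : ℝ :=
  Real.Gamma (((d : ℝ) - α) / 2) /
    (Real.pi ^ ((d : ℝ) / 2) * (2 : ℝ) ^ α * Real.Gamma (α / 2))

/-- For almost every `x`, the Riesz potential of `T` of order `2s` converges absolutely at `x` and
`u(x) = A_{2s} ∫ T(y) / |x - y|^{d - 2s} dy + l`. -/
def IsRieszPotentialAdd {d : ℕ} (s : ℝ) (T u : EuclideanSpace ℝ (Fin d) → ℝ) (l : ℝ) : Prop :=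
  ∀ᵐ x, Integrable (fun y => T y / ‖x - y‖ ^ ((d : ℝ) - 2 * s)) volume ∧
    u x = rieszConst d (2 * s) * (∫ y, T y / ‖x - y‖ ^ ((d : ℝ) - 2 * s)) + l

end

/-!
Write `P` for the Riesz potential `A_{2s} ∫ T(y) |x - y|^{-(d - 2s)} dy`.

Testing `T` against dilates of a fixed bump shows that a nonnegative element of the dual space has
mass `O(r^{(d - 2s)/2})` in the ball of radius `r` (`exists_mass_ball_le`), so a dyadic sum gives
`∫ T(y) (1 + |y|)^{-(d - 2s)} dy < ∞` (`integrable_mul_one_add_norm_rpow`). This is all that is used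
of the assumptions on `T`. It implies that `P` converges almost everywhere, lies in the weighted
space, and has ring means tending to `0` (`tendsto_ringMean_rieszPot`). As `(-Δ)^s φ` decays like
`|x|^{-d - 2s}` (`exists_decay_fracLaplacian`) and the Riesz potential inverts `(-Δ)^s` on test
functions (`rieszConst_mul_integral_fracLaplacian`), Fubini's theorem gives `(-Δ)^s P = T`; constants
are annihilated because `(-Δ)^s φ` has integral `0`. So every `P + c` is a solution, and its ring
means have the lower limit `|c - l|` times a positive constant.

Conversely, let `u` be a solution and `w = u - P`, so that `∫ w (-Δ)^s φ = 0` for all test functions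
`φ`. The Calderón formula `c f = ∫_0^∞ t^{2s - 1} (-Δ)^s (avg_t avg_t f) dt` (`exists_calderon`), in
which `avg_t` is the convolution with a compactly supported radial density of width `t`, writes a
test function as a superposition of fractional Laplacians of test functions. When `f` is an `n`-th
directional derivative with `n > 2s`, the integrand gains a factor `t^{-n}` for large `t`, and the
integral converges absolutely after pairing with `w`. Hence `w` is orthogonal to all directional
derivatives of order `n` (`integral_mul_iterate_dirDeriv_eq_zero`), and no theory of tempered
distributions is needed. The mollifications of `w` are therefore polynomial of degree `< n` on lines.
Take a mollifier `g` with integral `0` and average `w * g` over the points `R v`, with `v`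
distributed by a bump near the middle of the ring: the result is a polynomial in `R`, and since `g`
has integral `0` it is `O(1/R)` times the ring mean of `w - l`. A finite lower limit of the ring
means then forces the polynomial to vanish, in particular at `R = 0`, where its value is `(w * g)(0)`.
So `w` is orthogonal to all test functions with integral `0`, that is, constant
(`ae_eq_const_of_ringMean`).

Decay of `(-Δ)^s φ`, the Calderón formula and Riesz inversion all come from one identity for radial
multipliers, `integral_rpow_mul_fourierInv`: integrating `h(t|ξ|)` against `t^{p - 1} dt` gives a
constant times `|ξ|^{-p}`.
-/

/-! ### Test functions and the Fourier transform -/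

/-- Smooth compactly supported real functions on `ℝ^d`. -/
structure IsTest {d : ℕ} (φ : EuclideanSpace ℝ (Fin d) → ℝ) : Prop where
  contDiff : ContDiff ℝ ∞ φ
  hasCompactSupport : HasCompactSupport φ

/-- The Fourier transform (in Mathlib's normalization) of a real function. -/
noncomputable def ft {d : ℕ} (φ : EuclideanSpace ℝ (Fin d) → ℝ) : EuclideanSpace ℝ (Fin d) → ℂ :=
  𝓕 (fun y => (φ y : ℂ))

/-- The Fourier multiplier of `(-Δ)^s` in Mathlib's frequency variable. -/
noncomputable def fracSymbol {d : ℕ} (s : ℝ) (ξ : EuclideanSpace ℝ (Fin d)) : ℝ :=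
  (2 * Real.pi * ‖ξ‖) ^ (2 * s)

/-- Convolution of real functions on `ℝ^d`. -/
noncomputable def conv {d : ℕ} (f g : EuclideanSpace ℝ (Fin d) → ℝ)
    (x : EuclideanSpace ℝ (Fin d)) : ℝ :=
  ∫ y, f y * g (x - y)

/-- The `L¹`-normalized dilation `t^{-d} k(x / t)`. -/
noncomputable def dil {d : ℕ} (t : ℝ) (k : EuclideanSpace ℝ (Fin d) → ℝ)
    (x : EuclideanSpace ℝ (Fin d)) : ℝ :=
  (t ^ d)⁻¹ * k (t⁻¹ • x)

/-- The derivative of `f` in the direction `v`. -/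
noncomputable def dirDeriv {d : ℕ} (v : EuclideanSpace ℝ (Fin d))
    (f : EuclideanSpace ℝ (Fin d) → ℝ) (x : EuclideanSpace ℝ (Fin d)) : ℝ :=
  fderiv ℝ f x v

section TestFunctions

variable {d : ℕ} {φ ψ f g k : EuclideanSpace ℝ (Fin d) → ℝ} {s t : ℝ}

namespace IsTest

lemma continuous (h : IsTest φ) : Continuous φ := h.contDiff.continuous

lemma integrable (h : IsTest φ) : Integrable φ :=
  h.continuous.integrable_of_hasCompactSupport h.hasCompactSupport

lemma add (h : IsTest φ) (h' : IsTest ψ) : IsTest (fun x => φ x + ψ x) :=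
  ⟨h.contDiff.add h'.contDiff, h.hasCompactSupport.add h'.hasCompactSupport⟩

lemma const_mul (h : IsTest φ) (c : ℝ) : IsTest (fun x => c * φ x) :=
  ⟨contDiff_const.mul h.contDiff, h.hasCompactSupport.mul_left⟩

lemma sub (h : IsTest φ) (h' : IsTest ψ) : IsTest (fun x => φ x - ψ x) :=
  ⟨h.contDiff.sub h'.contDiff, by
    simpa [sub_eq_add_neg, neg_mul] using (h.add (h'.const_mul (-1))).hasCompactSupport⟩

lemma comp_smul (h : IsTest φ) {c : ℝ} (hc : c ≠ 0) : IsTest (fun x => φ (c • x)) :=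
  ⟨h.contDiff.comp (contDiff_id.const_smul c),
    h.hasCompactSupport.comp_homeomorph (Homeomorph.smulOfNeZero c hc)⟩

lemma dil (h : IsTest φ) (ht : 0 < t) : IsTest (dil t φ) :=
  (h.comp_smul (inv_ne_zero ht.ne')).const_mul _

lemma comp_sub (h : IsTest φ) (v : EuclideanSpace ℝ (Fin d)) : IsTest (fun x => φ (x - v)) :=
  ⟨h.contDiff.comp (contDiff_id.sub contDiff_const),
    h.hasCompactSupport.comp_homeomorph (Homeomorph.subRight v)⟩

lemma comp_neg (h : IsTest φ) : IsTest (fun x => φ (-x)) := by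
  simpa using h.comp_smul (c := -1) (by norm_num)

lemma dirDeriv (h : IsTest φ) (v : EuclideanSpace ℝ (Fin d)) : IsTest (dirDeriv v φ) := by
  refine ⟨?_, ?_⟩
  · exact (h.contDiff.fderiv_right (m := ∞) (by simp)).clm_apply contDiff_const
  · refine (h.hasCompactSupport.fderiv ℝ).comp_left (g := fun L : _ →L[ℝ] ℝ => L v) ?_
    simp

lemma iterate_dirDeriv (h : IsTest φ) (v : EuclideanSpace ℝ (Fin d)) (n : ℕ) :
    IsTest ((_root_.dirDeriv v)^[n] φ) := by
  induction n with
  | zero => exact h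
  | succ n ih => rw [Function.iterate_succ_apply']; exact ih.dirDeriv v

lemma conv (h : IsTest φ) (h' : IsTest ψ) : IsTest (conv φ ψ) := by
  have e : _root_.conv φ ψ = MeasureTheory.convolution φ ψ (ContinuousLinearMap.mul ℝ ℝ) volume := rfl
  rw [e]
  exact ⟨h'.hasCompactSupport.contDiff_convolution_right _ h.integrable.locallyIntegrable h'.contDiff,
    h.hasCompactSupport.convolution _ h'.hasCompactSupport⟩

lemma exists_bound (h : IsTest φ) : ∃ C, 0 < C ∧ ∀ x, |φ x| ≤ C := by
  obtain ⟨C, hC⟩ := h.continuous.bounded_above_of_compact_support h.hasCompactSupport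
  exact ⟨max C 1, by positivity, fun x => (hC x).trans (le_max_left _ _)⟩

lemma exists_support (h : IsTest φ) : ∃ r, 1 ≤ r ∧ ∀ x, r ≤ ‖x‖ → φ x = 0 := by
  obtain ⟨r, hr⟩ := h.hasCompactSupport.isCompact.isBounded.subset_ball 0
  refine ⟨max r 1, le_max_right _ _, fun x hx => ?_⟩
  by_contra hne
  have := hr (subset_tsupport _ (by simpa using hne))
  rw [mem_ball_zero_iff] at this
  linarith [le_max_left r 1]

lemma ofReal_continuous (h : IsTest φ) : Continuous (fun x => (φ x : ℂ)) :=
  Complex.continuous_ofReal.comp h.continuous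

lemma ofReal_integrable (h : IsTest φ) : Integrable (fun x => (φ x : ℂ)) := h.integrable.ofReal

lemma ofReal_hasCompactSupport (h : IsTest φ) : HasCompactSupport (fun x => (φ x : ℂ)) :=
  h.hasCompactSupport.comp_left (g := ((↑) : ℝ → ℂ)) (by simp)

lemma ofReal_contDiff (h : IsTest φ) : ContDiff ℝ ∞ (fun x => (φ x : ℂ)) :=
  Complex.ofRealCLM.contDiff.comp h.contDiff

/-- The Fourier transform of a test function is rapidly decreasing. -/
lemma ft_decay (h : IsTest φ) (n : ℕ) :
    ∃ C, 0 ≤ C ∧ ∀ ξ, (1 + ‖ξ‖) ^ n * ‖ft φ ξ‖ ≤ C := by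
  let S := 𝓕 (h.ofReal_hasCompactSupport.toSchwartzMap h.ofReal_contDiff)
  have hS : ∀ ξ, S ξ = ft φ ξ := fun ξ => rfl
  refine ⟨2 ^ n * (Finset.Iic (n, 0)).sup (fun m => SchwartzMap.seminorm ℝ m.1 m.2) S,
    by positivity, fun ξ => ?_⟩
  have := SchwartzMap.one_add_le_sup_seminorm_apply (𝕜 := ℝ) (m := (n, 0)) (k := n) (n := 0)
    le_rfl le_rfl S ξ
  rwa [norm_iteratedFDeriv_zero, hS] at this

lemma ft_continuous (h : IsTest φ) : Continuous (ft φ) :=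
  (𝓕 (h.ofReal_hasCompactSupport.toSchwartzMap h.ofReal_contDiff)).continuous

lemma integrable_rpow_mul_ft (h : IsTest φ) {r : ℝ} (hr : 0 ≤ r) :
    Integrable (fun ξ => ((‖ξ‖ ^ r : ℝ) : ℂ) * ft φ ξ) := by
  obtain ⟨n, hn⟩ := exists_nat_ge r
  obtain ⟨C, hC, hb⟩ := h.ft_decay (n + (d + 1))
  have hi : Integrable (fun ξ : EuclideanSpace ℝ (Fin d) => C * (1 + ‖ξ‖) ^ (-((d : ℝ) + 1))) :=
    (integrable_one_add_norm (by simp)).const_mul C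
  refine hi.mono' ?_ (ae_of_all _ fun ξ => ?_)
  · exact ((Complex.continuous_ofReal.comp
      (continuous_norm.rpow_const fun _ => Or.inr hr)).mul h.ft_continuous).aestronglyMeasurable
  · have h1 : ‖ξ‖ ^ r ≤ (1 + ‖ξ‖) ^ n := by
      calc ‖ξ‖ ^ r ≤ (1 + ‖ξ‖) ^ r := by gcongr; linarith
        _ ≤ (1 + ‖ξ‖) ^ (n : ℝ) := Real.rpow_le_rpow_of_exponent_le (by simp) hn
        _ = _ := Real.rpow_natCast _ _
    have h2 := hb ξ
    rw [norm_mul, Complex.norm_real, Real.norm_of_nonneg (by positivity), Real.rpow_neg (by positivity),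
      ← div_eq_mul_inv, le_div_iff₀ (by positivity)]
    have : (1 + ‖ξ‖) ^ ((d : ℝ) + 1) = (1 + ‖ξ‖) ^ (d + 1) := by
      rw [← Real.rpow_natCast]; push_cast; rfl
    rw [this]
    calc ‖ξ‖ ^ r * ‖ft φ ξ‖ * (1 + ‖ξ‖) ^ (d + 1) ≤ (1 + ‖ξ‖) ^ n * ‖ft φ ξ‖ * (1 + ‖ξ‖) ^ (d + 1) := by
          gcongr
      _ = (1 + ‖ξ‖) ^ (n + (d + 1)) * ‖ft φ ξ‖ := by ring
      _ ≤ C := h2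

lemma integrable_ft (h : IsTest φ) : Integrable (ft φ) := by
  simpa using h.integrable_rpow_mul_ft le_rfl

lemma fourierInv_ft (h : IsTest φ) (x : EuclideanSpace ℝ (Fin d)) : 𝓕⁻ (ft φ) x = φ x :=
  congrFun (h.ofReal_continuous.fourierInv_fourier_eq h.ofReal_integrable h.integrable_ft) x

end IsTest

lemma dim_pos_of_lt_half (hs : 0 < s) (hsd : s < (d : ℝ) / 2) : 0 < d :=
  Nat.cast_pos.1 (show (0 : ℝ) < d by linarith)

lemma fracSymbol_eq (s : ℝ) (ξ : EuclideanSpace ℝ (Fin d)) :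
    fracSymbol s ξ = (2 * Real.pi) ^ (2 * s) * ‖ξ‖ ^ (2 * s) := by
  unfold fracSymbol
  rw [Real.mul_rpow (by positivity) (by positivity)]

lemma continuous_fracSymbol (hs : 0 < s) : Continuous (fracSymbol (d := d) s) :=
  (continuous_const.mul continuous_norm).rpow_const fun _ => Or.inr (by positivity)

lemma fracSymbol_smul (ht : 0 ≤ t) (ξ : EuclideanSpace ℝ (Fin d)) :
    fracSymbol s (t • ξ) = t ^ (2 * s) * fracSymbol s ξ := by
  rw [fracSymbol_eq, fracSymbol_eq, norm_smul, Real.norm_of_nonneg ht,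
    Real.mul_rpow ht (norm_nonneg _)]
  ring

lemma integrable_fracSymbol_mul_ft (h : IsTest φ) (hs : 0 < s) :
    Integrable (fun ξ => (fracSymbol s ξ : ℂ) * ft φ ξ) := by
  have := (h.integrable_rpow_mul_ft (r := 2 * s) (by positivity)).const_mul
    (((2 * Real.pi) ^ (2 * s) : ℝ) : ℂ)
  refine this.congr (ae_of_all _ fun ξ => ?_)
  simp only [fracSymbol_eq]
  push_cast
  ring

lemma fracLaplacian_eq (s : ℝ) (φ : EuclideanSpace ℝ (Fin d) → ℝ) (x : EuclideanSpace ℝ (Fin d)) :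
    fracLaplacian s φ x = (𝓕⁻ (fun ξ => (fracSymbol s ξ : ℂ) * ft φ ξ) x).re := rfl

lemma continuous_fourierInv {F : EuclideanSpace ℝ (Fin d) → ℂ} (hF : Integrable F) :
    Continuous (𝓕⁻ F) := by
  rw [Real.fourierInv_eq_fourier_comp_neg]
  exact VectorFourier.fourierIntegral_continuous Real.continuous_fourierChar
    (by exact continuous_inner) hF.comp_neg

lemma continuous_fracLaplacian (h : IsTest φ) (hs : 0 < s) : Continuous (fracLaplacian s φ) :=
  Complex.continuous_re.comp (continuous_fourierInv (integrable_fracSymbol_mul_ft h hs))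

lemma conj_ft (φ : EuclideanSpace ℝ (Fin d) → ℝ) (ξ : EuclideanSpace ℝ (Fin d)) :
    starRingEnd ℂ (ft φ ξ) = ft φ (-ξ) := by
  unfold ft
  rw [Real.fourier_eq, Real.fourier_eq, ← integral_conj]
  congr 1; ext v
  simp only [Circle.smul_def, smul_eq_mul, map_mul, Complex.conj_ofReal, inner_neg_right, neg_neg]
  rw [← Circle.coe_inv_eq_conj, ← AddChar.map_neg_eq_inv, neg_neg]

lemma ft_conv (hf : Integrable f) (hg : Integrable g) (ξ : EuclideanSpace ℝ (Fin d)) :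
    ft (conv f g) ξ = ft f ξ * ft g ξ := by
  have e : (fun y => ((conv f g y : ℝ) : ℂ)) = MeasureTheory.convolution (fun y => (f y : ℂ))
      (fun y => (g y : ℂ)) (ContinuousLinearMap.mul ℂ ℂ) volume := by
    ext x
    simp only [conv, MeasureTheory.convolution, ContinuousLinearMap.mul_apply',
      ← integral_complex_ofReal]
    simp
  unfold ft
  rw [e]
  exact Real.fourier_mul_convolution_eq (R := ℂ) (hf.ofReal (𝕜 := ℂ)) (hg.ofReal (𝕜 := ℂ)) ξ

lemma fourier_smul_comp {F : EuclideanSpace ℝ (Fin d) → ℂ} (ht : 0 < t)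
    (ξ : EuclideanSpace ℝ (Fin d)) :
    𝓕 (fun x => F (t⁻¹ • x)) ξ = (t ^ d : ℝ) * 𝓕 F (t • ξ) := by
  rw [Real.fourier_eq, Real.fourier_eq]
  have := Measure.integral_comp_inv_smul (μ := (volume : Measure (EuclideanSpace ℝ (Fin d))))
    (fun v => Real.fourierChar (-inner ℝ v (t • ξ)) • F v) t
  simp only [inner_smul_right, inner_smul_left] at this ⊢
  rw [finrank_euclideanSpace_fin, abs_of_nonneg (by positivity)] at this
  rw [← Complex.real_smul, ← this]
  congr 1
  ext v
  congr 3
  simp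
  field_simp

lemma ft_dil (ht : 0 < t) (ξ : EuclideanSpace ℝ (Fin d)) : ft (dil t k) ξ = ft k (t • ξ) := by
  unfold ft dil
  have e : (fun y : EuclideanSpace ℝ (Fin d) => (((t ^ d)⁻¹ * k (t⁻¹ • y) : ℝ) : ℂ))
      = (((t ^ d)⁻¹ : ℝ) : ℂ) • fun y => ((k (t⁻¹ • y) : ℝ) : ℂ) := by
    ext y; simp
  rw [e]
  have h1 := VectorFourier.fourierIntegral_const_smul Real.fourierChar volume
    (innerₗ (EuclideanSpace ℝ (Fin d))) (fun y => ((k (t⁻¹ • y) : ℝ) : ℂ)) (((t ^ d)⁻¹ : ℝ) : ℂ)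
  have h2 := congrFun h1 ξ
  refine h2.trans ?_
  have h3 := fourier_smul_comp (F := fun y => ((k y : ℝ) : ℂ)) ht ξ
  rw [Pi.smul_apply]
  change (((t ^ d)⁻¹ : ℝ) : ℂ) • 𝓕 (fun y => ((k (t⁻¹ • y) : ℝ) : ℂ)) ξ = _
  rw [h3, smul_eq_mul, ← mul_assoc, ← Complex.ofReal_mul, inv_mul_cancel₀ (by positivity)]
  simp

lemma ft_dirDeriv (h : IsTest φ) (v ξ : EuclideanSpace ℝ (Fin d)) :
    ft (dirDeriv v φ) ξ = (2 * Real.pi * Complex.I * (inner ℝ v ξ : ℝ)) * ft φ ξ := by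
  have hderiv : ∀ x, fderiv ℝ (fun x => (φ x : ℂ)) x v = (dirDeriv v φ x : ℂ) := fun x => by
    have h1 := (h.contDiff.differentiable (by simp) x).hasFDerivAt
    have h2 := (Complex.ofRealCLM.hasFDerivAt (x := φ x)).comp x h1
    have h3 : fderiv ℝ (fun x => (φ x : ℂ)) x = _ := h2.fderiv
    rw [h3]; rfl
  have hi : Integrable (fderiv ℝ (fun x => (φ x : ℂ))) :=
    (h.ofReal_contDiff.continuous_fderiv (by simp)).integrable_of_hasCompactSupport
      (h.ofReal_hasCompactSupport.fderiv ℝ)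
  have h1 := Real.fourier_fderiv h.ofReal_integrable (h.ofReal_contDiff.differentiable (by simp)) hi
  have h2 := Real.fourier_continuousLinearMap_apply hi (a := v) (v := ξ)
  rw [h1] at h2
  simp only [hderiv] at h2
  unfold ft
  rw [← h2, VectorFourier.fourierSMulRight_apply]
  have h3 : (-innerSL ℝ : EuclideanSpace ℝ (Fin d) →L[ℝ] _) ξ v = -inner ℝ v ξ := by
    rw [real_inner_comm]; rfl
  rw [h3]
  simp only [Complex.real_smul, smul_eq_mul]
  push_cast
  ring

/-- A convolution in terms of the Fourier transform of one factor. -/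
lemma fourierInv_mul_ft {h : EuclideanSpace ℝ (Fin d) → ℂ} (hh : Integrable h) (hf : Integrable f)
    (x : EuclideanSpace ℝ (Fin d)) :
    𝓕⁻ (fun ξ => h ξ * ft f ξ) x = ∫ y, (f y : ℂ) * 𝓕⁻ h (x - y) := by
  have hint : Integrable (Function.uncurry fun ξ y : EuclideanSpace ℝ (Fin d) =>
      Real.fourierChar (inner ℝ ξ (x - y)) • (h ξ * (f y : ℂ))) (volume.prod volume) := by
    refine (hh.mul_prod (hf.ofReal (𝕜 := ℂ))).mono ?_ (ae_of_all _ fun p => ?_)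
    · have hc : Continuous fun p : EuclideanSpace ℝ (Fin d) × EuclideanSpace ℝ (Fin d) =>
          Real.fourierChar (inner ℝ p.1 (x - p.2)) :=
        Real.continuous_fourierChar.comp (by fun_prop)
      exact hc.aestronglyMeasurable.smul (hh.mul_prod hf.ofReal).aestronglyMeasurable
    · simp only [Function.uncurry, Circle.norm_smul]
      exact le_rfl
  calc 𝓕⁻ (fun ξ => h ξ * ft f ξ) x
      = ∫ ξ, ∫ y, Real.fourierChar (inner ℝ ξ (x - y)) • (h ξ * (f y : ℂ)) := by
        rw [Real.fourierInv_eq]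
        congr 1; ext ξ
        simp only [ft, Real.fourier_eq, Circle.smul_def, smul_eq_mul, ← integral_const_mul]
        congr 1; ext y
        rw [sub_eq_add_neg, inner_add_right, inner_neg_right, AddChar.map_add_eq_mul,
          real_inner_comm ξ y]
        push_cast
        ring
    _ = ∫ y, ∫ ξ, Real.fourierChar (inner ℝ ξ (x - y)) • (h ξ * (f y : ℂ)) :=
        integral_integral_swap hint
    _ = _ := by
        congr 1; ext y
        simp only [Real.fourierInv_eq, Circle.smul_def, smul_eq_mul, ← integral_const_mul]
        congr 1; ext ξ
        ring

lemma fourierInv_comp_smul {F : EuclideanSpace ℝ (Fin d) → ℂ} (ht : 0 < t)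
    (x : EuclideanSpace ℝ (Fin d)) :
    𝓕⁻ (fun ξ => F (t • ξ)) x = ((t ^ d)⁻¹ : ℝ) * 𝓕⁻ F (t⁻¹ • x) := by
  have := fourier_smul_comp (F := F) (inv_pos.2 ht) (-x)
  rw [Real.fourierInv_eq_fourier_neg, Real.fourierInv_eq_fourier_neg]
  simpa using this

lemma conv_comm (f g : EuclideanSpace ℝ (Fin d) → ℝ) : conv f g = conv g f := by
  ext x
  unfold conv
  rw [← integral_sub_left_eq_self _ volume x]
  congr 1; ext y
  simp [mul_comm]

lemma re_integral_mul_fourierInv {F : EuclideanSpace ℝ (Fin d) → ℂ} (hF : Integrable F)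
    (hf : Integrable f) (x : EuclideanSpace ℝ (Fin d)) :
    (∫ y, (f y : ℂ) * 𝓕⁻ F (x - y)).re = ∫ y, f y * (𝓕⁻ F (x - y)).re := by
  have hi : Integrable fun y => (f y : ℂ) * 𝓕⁻ F (x - y) := by
    refine hf.ofReal.mul_bdd (c := ∫ ξ, ‖F ξ‖) ?_ (ae_of_all _ fun y => ?_)
    · exact ((continuous_fourierInv hF).comp
        (continuous_const.sub continuous_id)).aestronglyMeasurable
    · rw [Real.fourierInv_eq_fourier_neg]
      exact VectorFourier.norm_fourierIntegral_le_integral_norm _ _ _ _ _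
  have := integral_re hi
  simp only [RCLike.re_eq_complex_re] at this
  rw [← this]
  congr 1; ext y
  rw [Complex.re_ofReal_mul]

/-- The fractional Laplacian commutes with convolutions. -/
lemma fracLaplacian_conv (hs : 0 < s) (hf : Integrable f) (hφ : IsTest φ) :
    fracLaplacian s (conv f φ) = conv f (fracLaplacian s φ) := by
  ext x
  have e : (fun ξ => (fracSymbol s ξ : ℂ) * ft (conv f φ) ξ)
      = fun ξ => ((fracSymbol s ξ : ℂ) * ft φ ξ) * ft f ξ := by
    ext ξ; rw [ft_conv hf hφ.integrable]; ring
  rw [fracLaplacian_eq, e, fourierInv_mul_ft (integrable_fracSymbol_mul_ft hφ hs) hf]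
  exact re_integral_mul_fourierInv (integrable_fracSymbol_mul_ft hφ hs) hf x

end TestFunctions

/-! ### Mellin averages of radial multipliers -/

section Mellin

variable {d : ℕ}

lemma integral_rpow_mul_comp_mul {H : ℝ → ℝ} {p r : ℝ} (hr : 0 < r) :
    ∫ t in Set.Ioi (0 : ℝ), t ^ (p - 1) * H (t * r)
      = r ^ (-p) * ∫ u in Set.Ioi (0 : ℝ), u ^ (p - 1) * H u := by
  have h1 := integral_comp_mul_left_Ioi (fun u => u ^ (p - 1) * H u) 0 hr
  rw [mul_zero, smul_eq_mul] at h1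
  have h2 : ∫ t in Set.Ioi (0 : ℝ), (r * t) ^ (p - 1) * H (r * t)
      = r ^ (p - 1) * ∫ t in Set.Ioi (0 : ℝ), t ^ (p - 1) * H (t * r) := by
    rw [← integral_const_mul]
    refine setIntegral_congr_fun measurableSet_Ioi fun t ht => ?_
    rw [Real.mul_rpow hr.le (le_of_lt ht), mul_comm r t]; ring
  rw [h2] at h1
  have h3 : r ^ (-p) = (r ^ (p - 1))⁻¹ * r⁻¹ := by
    rw [← Real.rpow_neg hr.le, ← Real.rpow_neg_one r, ← Real.rpow_add hr]; congr 1; ring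
  rw [h3, mul_assoc, ← h1, ← mul_assoc, inv_mul_cancel₀ (by positivity), one_mul]

lemma integrableOn_rpow_mul_comp_mul {H : ℝ → ℝ} {p r : ℝ} (hr : 0 < r)
    (hH : IntegrableOn (fun u => u ^ (p - 1) * H u) (Set.Ioi 0)) :
    IntegrableOn (fun t => t ^ (p - 1) * H (t * r)) (Set.Ioi 0) := by
  have h1 := (integrableOn_Ioi_comp_mul_left_iff (fun u => u ^ (p - 1) * H u) 0 hr).2
    (by simpa using hH)
  have h2 := h1.const_mul ((r ^ (p - 1))⁻¹)
  refine IntegrableOn.congr_fun h2 (fun t ht => ?_) measurableSet_Ioi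
  rw [Real.mul_rpow hr.le (le_of_lt ht), mul_comm r t]
  field_simp

lemma ae_norm_pos (hd : 0 < d) : ∀ᵐ ξ : EuclideanSpace ℝ (Fin d), 0 < ‖ξ‖ := by
  have : Nonempty (Fin d) := ⟨⟨0, hd⟩⟩
  filter_upwards [Measure.ae_ne volume (0 : EuclideanSpace ℝ (Fin d))] with ξ hξ
  exact norm_pos_iff.2 hξ

/-- Fubini's theorem applies to the integral over scales of a dilated radial multiplier. -/
lemma integrable_mellin_symbol {h : ℝ → ℝ} (hc : Continuous h) {p : ℝ}
    (hi : IntegrableOn (fun u => u ^ (p - 1) * h u) (Set.Ioi 0)) (hd : 0 < d)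
    {F : EuclideanSpace ℝ (Fin d) → ℂ} (hF : Integrable F)
    (hF' : Integrable (fun ξ => ((‖ξ‖ ^ (-p) : ℝ) : ℂ) * F ξ)) (x : EuclideanSpace ℝ (Fin d)) :
    Integrable (Function.uncurry fun (t : ℝ) (ξ : EuclideanSpace ℝ (Fin d)) =>
      ((t ^ (p - 1) : ℝ) : ℂ) * (Real.fourierChar (inner ℝ ξ x) • (((h (t * ‖ξ‖) : ℝ) : ℂ) * F ξ)))
      ((volume.restrict (Set.Ioi 0)).prod volume) := by
  have hmeas : AEStronglyMeasurable (Function.uncurry fun (t : ℝ) (ξ : EuclideanSpace ℝ (Fin d)) =>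
      ((t ^ (p - 1) : ℝ) : ℂ) * (Real.fourierChar (inner ℝ ξ x) • (((h (t * ‖ξ‖) : ℝ) : ℂ) * F ξ)))
      ((volume.restrict (Set.Ioi 0)).prod volume) := by
    refine AEStronglyMeasurable.mul ?_ (AEStronglyMeasurable.smul ?_ (AEStronglyMeasurable.mul ?_ ?_))
    · exact (Complex.measurable_ofReal.comp (measurable_fst.pow_const _)).aestronglyMeasurable
    · have hc : Continuous fun p : ℝ × EuclideanSpace ℝ (Fin d) =>
          ((Real.fourierChar (inner ℝ p.2 x) : Circle) : ℂ) :=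
        continuous_subtype_val.comp (Real.continuous_fourierChar.comp (by fun_prop))
      exact hc.aestronglyMeasurable
    · have hc : Continuous fun p : ℝ × EuclideanSpace ℝ (Fin d) => ((h (p.1 * ‖p.2‖) : ℝ) : ℂ) := by
        fun_prop
      exact hc.aestronglyMeasurable
    · exact hF.aestronglyMeasurable.comp_snd
  have hn : ∀ (t : ℝ) (ξ : EuclideanSpace ℝ (Fin d)), 0 < t →
      ‖((t ^ (p - 1) : ℝ) : ℂ) * (Real.fourierChar (inner ℝ ξ x) • (((h (t * ‖ξ‖) : ℝ) : ℂ) * F ξ))‖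
        = (t ^ (p - 1) * |h (t * ‖ξ‖)|) * ‖F ξ‖ := fun t ξ ht => by
    rw [norm_mul, Circle.norm_smul, norm_mul, Complex.norm_real, Complex.norm_real,
      Real.norm_of_nonneg (by positivity), Real.norm_eq_abs]
    ring
  have hia : IntegrableOn (fun u => u ^ (p - 1) * |h u|) (Set.Ioi 0) := by
    refine IntegrableOn.congr_fun hi.norm (fun u hu => ?_) measurableSet_Ioi
    have : (0 : ℝ) < u := hu
    rw [norm_mul, Real.norm_of_nonneg (by positivity), Real.norm_eq_abs]
  rw [integrable_prod_iff' hmeas]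
  constructor
  · filter_upwards [ae_norm_pos hd] with ξ hξ
    have h1 : Integrable (fun t : ℝ => ((t ^ (p - 1) * h (t * ‖ξ‖) : ℝ) : ℂ))
        (volume.restrict (Set.Ioi 0)) := (integrableOn_rpow_mul_comp_mul hξ hi).ofReal
    have h2 := h1.mul_const (((Real.fourierChar (inner ℝ ξ x) : Circle) : ℂ) * F ξ)
    refine h2.congr (ae_of_all _ fun t => ?_)
    simp only [Function.uncurry, Circle.smul_def, smul_eq_mul]
    push_cast
    ring
  · have h1 := hF'.norm.const_mul (∫ u in Set.Ioi (0 : ℝ), u ^ (p - 1) * |h u|)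
    refine h1.congr ?_
    filter_upwards [ae_norm_pos hd] with ξ hξ
    have h2 : ∫ t in Set.Ioi (0 : ℝ), ‖Function.uncurry (fun (t : ℝ) (ξ : EuclideanSpace ℝ (Fin d)) =>
        ((t ^ (p - 1) : ℝ) : ℂ) *
          (Real.fourierChar (inner ℝ ξ x) • (((h (t * ‖ξ‖) : ℝ) : ℂ) * F ξ))) (t, ξ)‖
        = ∫ t in Set.Ioi (0 : ℝ), (t ^ (p - 1) * |h (t * ‖ξ‖)|) * ‖F ξ‖ :=
      setIntegral_congr_fun measurableSet_Ioi fun t ht => hn t ξ ht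
    rw [h2, integral_mul_const, integral_rpow_mul_comp_mul (H := fun u => |h u|) hξ, norm_mul,
      Complex.norm_real, Real.norm_of_nonneg (by positivity)]
    ring

/-- Averaging a dilated radial multiplier over all scales, with weight `t^{p-1}`, yields a multiple
of the multiplier `|ξ|^{-p}`. -/
lemma integral_rpow_mul_fourierInv {h : ℝ → ℝ} (hc : Continuous h) {p : ℝ}
    (hi : IntegrableOn (fun u => u ^ (p - 1) * h u) (Set.Ioi 0)) (hd : 0 < d)
    {F : EuclideanSpace ℝ (Fin d) → ℂ} (hF : Integrable F)
    (hF' : Integrable (fun ξ => ((‖ξ‖ ^ (-p) : ℝ) : ℂ) * F ξ)) (x : EuclideanSpace ℝ (Fin d)) :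
    ∫ t in Set.Ioi (0 : ℝ), ((t ^ (p - 1) : ℝ) : ℂ) * 𝓕⁻ (fun ξ => ((h (t * ‖ξ‖) : ℝ) : ℂ) * F ξ) x
      = ((∫ u in Set.Ioi (0 : ℝ), u ^ (p - 1) * h u : ℝ) : ℂ) *
        𝓕⁻ (fun ξ => ((‖ξ‖ ^ (-p) : ℝ) : ℂ) * F ξ) x := by
  have hint := integrable_mellin_symbol hc hi hd hF hF' x
  simp only [Real.fourierInv_eq, ← integral_const_mul]
  rw [integral_integral_swap hint]
  refine integral_congr_ae ?_
  filter_upwards [ae_norm_pos hd] with ξ hξ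
  have h1 : ∀ t : ℝ, ((t ^ (p - 1) : ℝ) : ℂ) *
      (Real.fourierChar (inner ℝ ξ x) • (((h (t * ‖ξ‖) : ℝ) : ℂ) * F ξ))
      = ((t ^ (p - 1) * h (t * ‖ξ‖) : ℝ) : ℂ) *
        (((Real.fourierChar (inner ℝ ξ x) : Circle) : ℂ) * F ξ) := fun t => by
    simp only [Circle.smul_def, smul_eq_mul]
    push_cast
    ring
  simp only [h1]
  rw [integral_mul_const, integral_complex_ofReal, integral_rpow_mul_comp_mul hξ]
  simp only [Circle.smul_def, smul_eq_mul]
  push_cast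
  ring

lemma integral_rpow_mul_re_fourierInv {h : ℝ → ℝ} (hc : Continuous h) {p : ℝ}
    (hi : IntegrableOn (fun u => u ^ (p - 1) * h u) (Set.Ioi 0)) (hd : 0 < d)
    {F : EuclideanSpace ℝ (Fin d) → ℂ} (hF : Integrable F)
    (hF' : Integrable (fun ξ => ((‖ξ‖ ^ (-p) : ℝ) : ℂ) * F ξ)) (x : EuclideanSpace ℝ (Fin d)) :
    ∫ t in Set.Ioi (0 : ℝ), t ^ (p - 1) * (𝓕⁻ (fun ξ => ((h (t * ‖ξ‖) : ℝ) : ℂ) * F ξ) x).re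
      = (∫ u in Set.Ioi (0 : ℝ), u ^ (p - 1) * h u) *
        (𝓕⁻ (fun ξ => ((‖ξ‖ ^ (-p) : ℝ) : ℂ) * F ξ) x).re := by
  have h1 := (integrable_mellin_symbol hc hi hd hF hF' x).integral_prod_left
  have h2 : IntegrableOn (fun t : ℝ => ((t ^ (p - 1) : ℝ) : ℂ) *
      𝓕⁻ (fun ξ => ((h (t * ‖ξ‖) : ℝ) : ℂ) * F ξ) x) (Set.Ioi 0) := by
    refine h1.congr (ae_of_all _ fun t => ?_)
    simp only [Function.uncurry, Real.fourierInv_eq, integral_const_mul]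
  have h3 := integral_re h2
  simp only [RCLike.re_eq_complex_re, Complex.re_ofReal_mul] at h3
  rw [h3, integral_rpow_mul_fourierInv hc hi hd hF hF' x, Complex.re_ofReal_mul]

end Mellin

/-! ### A radial mollifier and its Fourier transform -/

section RadialBump

variable {d : ℕ}

/-- A smooth radial probability density on `ℝ^d` supported in the unit ball. A `ContDiffBump` need
not be radial, hence the explicit formula. -/
noncomputable def radialBump (d : ℕ) (x : EuclideanSpace ℝ (Fin d)) : ℝ :=
  (∫ y : EuclideanSpace ℝ (Fin d), Real.smoothTransition (1 - ‖y‖ ^ 2))⁻¹ *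
    Real.smoothTransition (1 - ‖x‖ ^ 2)

lemma isTest_smoothTransition :
    IsTest (fun x : EuclideanSpace ℝ (Fin d) => Real.smoothTransition (1 - ‖x‖ ^ 2)) := by
  refine ⟨Real.smoothTransition.contDiff.comp (contDiff_const.sub (contDiff_norm_sq ℝ)), ?_⟩
  refine HasCompactSupport.intro (isCompact_closedBall (0 : EuclideanSpace ℝ (Fin d)) 1) fun x hx => ?_
  rw [mem_closedBall_zero_iff, not_le] at hx
  exact Real.smoothTransition.zero_of_nonpos (by nlinarith)

lemma isTest_radialBump : IsTest (radialBump d) := isTest_smoothTransition.const_mul _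

lemma integral_smoothTransition_pos :
    0 < ∫ y : EuclideanSpace ℝ (Fin d), Real.smoothTransition (1 - ‖y‖ ^ 2) := by
  refine (isTest_smoothTransition (d := d)).continuous.integral_pos_of_hasCompactSupport_nonneg_nonzero
    isTest_smoothTransition.hasCompactSupport (fun x => Real.smoothTransition.nonneg _) (x := 0) ?_
  simp

lemma radialBump_nonneg (x : EuclideanSpace ℝ (Fin d)) : 0 ≤ radialBump d x :=
  mul_nonneg (inv_nonneg.2 integral_smoothTransition_pos.le) (Real.smoothTransition.nonneg _)

lemma integral_radialBump : ∫ x, radialBump d x = 1 := by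
  unfold radialBump
  rw [integral_const_mul, inv_mul_cancel₀ integral_smoothTransition_pos.ne']

lemma radialBump_eq_zero {x : EuclideanSpace ℝ (Fin d)} (hx : 1 ≤ ‖x‖) : radialBump d x = 0 := by
  unfold radialBump
  rw [Real.smoothTransition.zero_of_nonpos (by nlinarith), mul_zero]

lemma radialBump_congr {x y : EuclideanSpace ℝ (Fin d)} (h : ‖x‖ = ‖y‖) :
    radialBump d x = radialBump d y := by
  unfold radialBump; rw [h]

/-- The Fourier transform of the radial density is radial, by invariance under reflections. -/
lemma ft_radialBump_congr {ξ η : EuclideanSpace ℝ (Fin d)} (h : ‖ξ‖ = ‖η‖) :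
    ft (radialBump d) ξ = ft (radialBump d) η := by
  have h1 := Real.fourier_comp_linearIsometry ((Submodule.span ℝ {ξ - η})ᗮ.reflection)
    (fun y => (radialBump d y : ℂ)) ξ
  rw [Submodule.reflection_sub h] at h1
  have h2 : (fun y => (radialBump d y : ℂ)) ∘ ((Submodule.span ℝ {ξ - η})ᗮ.reflection)
      = fun y => (radialBump d y : ℂ) := by
    ext1 y
    rw [Function.comp_apply, radialBump_congr (LinearIsometryEquiv.norm_map _ y)]
  rw [h2] at h1
  exact h1

lemma ft_radialBump_im (ξ : EuclideanSpace ℝ (Fin d)) : (ft (radialBump d) ξ).im = 0 := by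
  have h1 : ft (radialBump d) ξ = ft (radialBump d) (-ξ) := ft_radialBump_congr (norm_neg ξ).symm
  have h2 := conj_ft (radialBump d) ξ
  rw [← h1] at h2
  exact Complex.conj_eq_iff_im.1 h2

/-- The Fourier transform of `radialBump` is `g(|ξ|)` for a real profile `g` that is `1 + O(r)` at
`0`, is bounded by `1` and decays rapidly. -/
lemma exists_radialBump_profile (hd : 0 < d) : ∃ g : ℝ → ℝ, Continuous g ∧
    (∀ ξ, ft (radialBump d) ξ = (g ‖ξ‖ : ℂ)) ∧ (∀ r, |g r| ≤ 1) ∧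
    (∀ r, |1 - g r| ≤ 2 * Real.pi * |r|) ∧
    ∀ n : ℕ, ∃ C, 0 ≤ C ∧ ∀ r, 0 ≤ r → (1 + r) ^ n * |g r| ≤ C := by
  let e : EuclideanSpace ℝ (Fin d) := EuclideanSpace.single ⟨0, hd⟩ 1
  have he : ‖e‖ = 1 := by simp [e]
  have hre : ∀ ξ, ft (radialBump d) ξ = ((ft (radialBump d) ξ).re : ℂ) := fun ξ =>
    Complex.ext (by simp) (by simp [ft_radialBump_im])
  have habs : ∀ ξ, |(ft (radialBump d) ξ).re| = ‖ft (radialBump d) ξ‖ := fun ξ => by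
    conv_rhs => rw [hre]
    rw [Complex.norm_real, Real.norm_eq_abs]
  have hone : ∀ ξ, ‖1 - ft (radialBump d) ξ‖ ≤ 2 * Real.pi * ‖ξ‖ := fun ξ => by
    have e1 : 1 - ft (radialBump d) ξ = ∫ v : EuclideanSpace ℝ (Fin d),
        ((radialBump d v : ℂ) - Real.fourierChar (-inner ℝ v ξ) • (radialBump d v : ℂ)) := by
      rw [integral_sub isTest_radialBump.ofReal_integrable
        ((Real.fourierIntegral_convergent_iff ξ).2 isTest_radialBump.ofReal_integrable),
        integral_complex_ofReal, integral_radialBump]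
      simp [ft, Real.fourier_eq]
    rw [e1]
    have hb : ∀ v : EuclideanSpace ℝ (Fin d),
        ‖(radialBump d v : ℂ) - Real.fourierChar (-inner ℝ v ξ) • (radialBump d v : ℂ)‖
          ≤ (2 * Real.pi * ‖ξ‖) * radialBump d v := fun v => by
      by_cases hv : 1 ≤ ‖v‖
      · simp [radialBump_eq_zero hv]
      · have e2 : (radialBump d v : ℂ) - Real.fourierChar (-inner ℝ v ξ) • (radialBump d v : ℂ)
            = -((Complex.exp (Complex.I * ((2 * Real.pi * -inner ℝ v ξ : ℝ) : ℂ)) - 1) *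
              (radialBump d v : ℂ)) := by
          rw [Circle.smul_def, Real.fourierChar_apply, smul_eq_mul, mul_comm Complex.I]
          ring
        rw [e2, norm_neg, norm_mul, Complex.norm_real, Real.norm_of_nonneg (radialBump_nonneg v)]
        refine mul_le_mul_of_nonneg_right ?_ (radialBump_nonneg v)
        refine (Real.norm_exp_I_mul_ofReal_sub_one_le).trans ?_
        rw [norm_mul, norm_neg, Real.norm_of_nonneg (by positivity)]
        refine mul_le_mul_of_nonneg_left ?_ (by positivity)
        refine (norm_inner_le_norm (𝕜 := ℝ) v ξ).trans ?_
        nlinarith [norm_nonneg ξ]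
    calc _ ≤ ∫ v, (2 * Real.pi * ‖ξ‖) * radialBump d v :=
          norm_integral_le_of_norm_le (isTest_radialBump.integrable.const_mul _) (ae_of_all _ hb)
      _ = _ := by rw [integral_const_mul, integral_radialBump, mul_one]
  refine ⟨fun r => (ft (radialBump d) (r • e)).re, ?_, ?_, ?_, ?_, ?_⟩
  · exact Complex.continuous_re.comp (isTest_radialBump.ft_continuous.comp
      (continuous_id.smul continuous_const))
  · intro ξ
    rw [hre ξ, ft_radialBump_congr (η := ‖ξ‖ • e)]
    rw [norm_smul, he, mul_one, norm_norm]
  · intro r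
    simp only
    rw [habs]
    refine (VectorFourier.norm_fourierIntegral_le_integral_norm _ _ _ _ _).trans ?_
    simp only [Complex.norm_real, Real.norm_of_nonneg (radialBump_nonneg _), integral_radialBump]
    exact le_rfl
  · intro r
    have h1 := hone (r • e)
    rw [norm_smul, he, mul_one, hre] at h1
    rw [← Real.norm_eq_abs, ← Complex.norm_real]
    push_cast
    exact h1
  · intro n
    obtain ⟨C, hC, hb⟩ := (isTest_radialBump (d := d)).ft_decay n
    refine ⟨C, hC, fun r hr => ?_⟩
    have := hb (r • e)
    rw [norm_smul, he, mul_one, Real.norm_of_nonneg hr] at this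
    simp only
    rwa [habs]

end RadialBump

/-! ### Integrals over scales -/

section ScaleIntegrals

lemma setIntegral_Ioi_pos {f : ℝ → ℝ} (hf : ContinuousOn f (Set.Ioi 0))
    (hi : IntegrableOn f (Set.Ioi 0)) (h0 : ∀ u, 0 < u → 0 ≤ f u) {u₀ : ℝ} (hu₀ : 0 < u₀)
    (hne : f u₀ ≠ 0) : 0 < ∫ u in Set.Ioi (0 : ℝ), f u := by
  rw [setIntegral_pos_iff_support_of_nonneg_ae
    ((ae_restrict_iff' measurableSet_Ioi).2 (ae_of_all _ h0)) hi]
  have ho : IsOpen (Set.Ioi 0 ∩ f ⁻¹' {0}ᶜ) :=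
    hf.isOpen_inter_preimage isOpen_Ioi isOpen_compl_singleton
  have := ho.measure_pos volume ⟨u₀, hu₀, hne⟩
  rwa [Set.inter_comm] at this

lemma integrableOn_Ioi_of_bounds {f : ℝ → ℝ} (hf : ContinuousOn f (Set.Ioi 0)) {a b A B : ℝ}
    (ha : -1 < a) (hb : b < -1) (h0 : ∀ u, 0 < u → u ≤ 1 → |f u| ≤ A * u ^ a)
    (h1 : ∀ u, 1 < u → |f u| ≤ B * u ^ b) : IntegrableOn f (Set.Ioi 0) := by
  have hm : ∀ s ⊆ Set.Ioi (0 : ℝ), MeasurableSet s → AEStronglyMeasurable f (volume.restrict s) :=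
    fun s hs hsm => (hf.mono hs).aestronglyMeasurable hsm
  rw [← Set.Ioc_union_Ioi_eq_Ioi zero_le_one]
  refine IntegrableOn.union ?_ ?_
  · have hi : IntegrableOn (fun u : ℝ => A * u ^ a) (Set.Ioc 0 1) :=
      ((intervalIntegrable_iff_integrableOn_Ioc_of_le zero_le_one).1
        (intervalIntegral.intervalIntegrable_rpow' ha)).const_mul A
    exact hi.mono' (hm _ Set.Ioc_subset_Ioi_self measurableSet_Ioc)
      ((ae_restrict_iff' measurableSet_Ioc).2 (ae_of_all _ fun u hu => h0 u hu.1 hu.2))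
  · have hi : IntegrableOn (fun u : ℝ => B * u ^ b) (Set.Ioi 1) :=
      (integrableOn_Ioi_rpow_of_lt hb one_pos).const_mul B
    exact hi.mono' (hm _ (Set.Ioi_subset_Ioi zero_le_one) measurableSet_Ioi)
      ((ae_restrict_iff' measurableSet_Ioi).2 (ae_of_all _ fun u hu => h1 u hu))

lemma continuousOn_rpow_mul {h : ℝ → ℝ} (hc : Continuous h) (p : ℝ) :
    ContinuousOn (fun u : ℝ => u ^ p * h u) (Set.Ioi 0) :=
  (continuousOn_id.rpow_const fun _ hx => Or.inl (ne_of_gt hx)).mul hc.continuousOn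

end ScaleIntegrals

/-! ### Averages at a given scale and the decay of the fractional Laplacian -/

section Averages

variable {d : ℕ} {φ : EuclideanSpace ℝ (Fin d) → ℝ} {s t : ℝ}

lemma integral_dil (ht : 0 < t) (k : EuclideanSpace ℝ (Fin d) → ℝ) :
    ∫ x, dil t k x = ∫ x, k x := by
  unfold dil
  rw [integral_const_mul, Measure.integral_comp_inv_smul, finrank_euclideanSpace_fin,
    abs_of_nonneg (by positivity), smul_eq_mul, inv_mul_cancel_left₀ (by positivity)]

lemma dil_radialBump_nonneg (ht : 0 < t) (x : EuclideanSpace ℝ (Fin d)) :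
    0 ≤ dil t (radialBump d) x := mul_nonneg (by positivity) (radialBump_nonneg _)

lemma dil_radialBump_eq_zero (ht : 0 < t) {x : EuclideanSpace ℝ (Fin d)} (hx : t ≤ ‖x‖) :
    dil t (radialBump d) x = 0 := by
  unfold dil
  rw [radialBump_eq_zero, mul_zero]
  rw [norm_smul, norm_inv, Real.norm_of_nonneg ht.le, inv_mul_eq_div, le_div_iff₀ ht, one_mul]
  exact hx

/-- The average of `φ` at scale `t` against the radial density `radialBump`. -/
noncomputable def avg (t : ℝ) (φ : EuclideanSpace ℝ (Fin d) → ℝ) :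
    EuclideanSpace ℝ (Fin d) → ℝ :=
  conv (dil t (radialBump d)) φ

lemma IsTest.avg (h : IsTest φ) (ht : 0 < t) : IsTest (avg t φ) :=
  (isTest_radialBump.dil ht).conv h

lemma abs_avg_le {C : ℝ} (ht : 0 < t) {x : EuclideanSpace ℝ (Fin d)}
    (hb : ∀ y, ‖y‖ < t → |φ (x - y)| ≤ C) : |avg t φ x| ≤ C := by
  unfold avg conv
  have hb' : ∀ y, ‖dil t (radialBump d) y * φ (x - y)‖ ≤ dil t (radialBump d) y * C := fun y => by
    by_cases hy : t ≤ ‖y‖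
    · simp [dil_radialBump_eq_zero ht hy]
    · rw [norm_mul, Real.norm_of_nonneg (dil_radialBump_nonneg ht y)]
      exact mul_le_mul_of_nonneg_left (hb y (not_le.1 hy)) (dil_radialBump_nonneg ht y)
  have := norm_integral_le_of_norm_le ((isTest_radialBump.dil ht).integrable.mul_const C)
    (ae_of_all _ hb')
  rwa [integral_mul_const, integral_dil ht, integral_radialBump, one_mul] at this

lemma ft_avg {g : ℝ → ℝ} (hg : ∀ ξ, ft (radialBump d) ξ = (g ‖ξ‖ : ℂ)) (h : IsTest φ) (ht : 0 < t)
    (ξ : EuclideanSpace ℝ (Fin d)) : ft (avg t φ) ξ = (g (t * ‖ξ‖) : ℂ) * ft φ ξ := by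
  unfold avg
  rw [ft_conv (isTest_radialBump.dil ht).integrable h.integrable, ft_dil ht, hg, norm_smul,
    Real.norm_of_nonneg ht.le]

lemma ft_sub (h : IsTest φ) {ψ : EuclideanSpace ℝ (Fin d) → ℝ} (h' : IsTest ψ)
    (ξ : EuclideanSpace ℝ (Fin d)) : ft (fun x => φ x - ψ x) ξ = ft φ ξ - ft ψ ξ := by
  unfold ft
  simp only [Real.fourier_eq]
  rw [← integral_sub ((Real.fourierIntegral_convergent_iff ξ).2 h.ofReal_integrable)
    ((Real.fourierIntegral_convergent_iff ξ).2 h'.ofReal_integrable)]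
  congr 1; ext v
  rw [← smul_sub]; push_cast; rfl

/-- The operator `φ ↦ φ - avg t φ`. -/
noncomputable def oscill (t : ℝ) (φ : EuclideanSpace ℝ (Fin d) → ℝ)
    (x : EuclideanSpace ℝ (Fin d)) : ℝ :=
  φ x - avg t φ x

lemma IsTest.iterate_oscill (h : IsTest φ) (ht : 0 < t) (n : ℕ) : IsTest ((oscill t)^[n] φ) := by
  induction n with
  | zero => exact h
  | succ n ih => rw [Function.iterate_succ_apply']; exact ih.sub (ih.avg ht)

lemma ft_iterate_oscill {g : ℝ → ℝ} (hg : ∀ ξ, ft (radialBump d) ξ = (g ‖ξ‖ : ℂ)) (h : IsTest φ)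
    (ht : 0 < t) (n : ℕ) (ξ : EuclideanSpace ℝ (Fin d)) :
    ft ((oscill t)^[n] φ) ξ = (((1 - g (t * ‖ξ‖)) ^ n : ℝ) : ℂ) * ft φ ξ := by
  induction n with
  | zero => simp
  | succ n ih =>
    rw [Function.iterate_succ_apply']
    have h1 := h.iterate_oscill ht n
    refine (ft_sub h1 (h1.avg ht) ξ).trans ?_
    rw [ft_avg hg h1 ht, ih]
    push_cast
    ring

lemma avg_sub {ψ : EuclideanSpace ℝ (Fin d) → ℝ} (h : IsTest φ) (h' : IsTest ψ) (ht : 0 < t)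
    (x : EuclideanSpace ℝ (Fin d)) : avg t (fun y => φ y - ψ y) x = avg t φ x - avg t ψ x := by
  have hi : ∀ {χ : EuclideanSpace ℝ (Fin d) → ℝ}, IsTest χ →
      Integrable fun y => dil t (radialBump d) y * χ (x - y) := fun hχ =>
    ((isTest_radialBump.dil ht).continuous.mul (hχ.continuous.comp
      (continuous_const.sub continuous_id))).integrable_of_hasCompactSupport
      (isTest_radialBump.dil ht).hasCompactSupport.mul_right
  unfold avg conv
  rw [← integral_sub (hi h) (hi h')]
  congr 1; ext y; ring

/-- The iterated oscillation differs from `φ` by a combination of iterated averages of `φ`, each of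
which is `O(t^{-d})` as `φ` is integrable. -/
lemma exists_bound_iterate_oscill (h : IsTest φ) (n : ℕ) : ∃ C, 0 ≤ C ∧ ∀ t, 0 < t → ∀ x,
    |(oscill t)^[n] φ x - φ x| ≤ C * (t ^ d)⁻¹ := by
  obtain ⟨B, hB, hkB⟩ := (isTest_radialBump (d := d)).exists_bound
  have h1 : ∀ t, 0 < t → ∀ x, |avg t φ x| ≤ (B * ∫ y, |φ y|) * (t ^ d)⁻¹ := fun t ht x => by
    unfold avg
    rw [conv_comm]
    unfold conv
    have hb : ∀ y, ‖φ y * dil t (radialBump d) (x - y)‖ ≤ |φ y| * ((t ^ d)⁻¹ * B) := fun y => by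
      rw [norm_mul]
      refine mul_le_mul_of_nonneg_left ?_ (abs_nonneg _)
      unfold dil
      rw [norm_mul, Real.norm_of_nonneg (by positivity)]
      exact mul_le_mul_of_nonneg_left (hkB _) (by positivity)
    have := norm_integral_le_of_norm_le (h.integrable.abs.mul_const _) (ae_of_all _ hb)
    rw [integral_mul_const] at this
    refine this.trans (le_of_eq ?_)
    ring
  have hI : 0 ≤ B * ∫ y, |φ y| := mul_nonneg hB.le (integral_nonneg fun _ => abs_nonneg _)
  induction n with
  | zero => exact ⟨0, le_rfl, fun t _ x => by simp⟩
  | succ n ih =>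
    obtain ⟨C, hC, ih⟩ := ih
    refine ⟨C + B * (∫ y, |φ y|) + C, by positivity, fun t ht x => ?_⟩
    have h2 := h.iterate_oscill ht n
    have h3 : |avg t (fun y => (oscill t)^[n] φ y - φ y) x| ≤ C * (t ^ d)⁻¹ :=
      abs_avg_le ht fun y _ => ih t ht _
    rw [avg_sub h2 h ht] at h3
    rw [Function.iterate_succ_apply']
    change |(oscill t)^[n] φ x - avg t ((oscill t)^[n] φ) x - φ x| ≤ _
    have h4 := ih t ht x
    have h5 := h1 t ht x
    rw [abs_le] at *
    constructor <;> nlinarith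

lemma iterate_oscill_eq_zero {ρ : ℝ} (hρ : ∀ x, ρ ≤ ‖x‖ → φ x = 0) (ht : 0 < t) (n : ℕ)
    {x : EuclideanSpace ℝ (Fin d)} (hx : ρ + n * t ≤ ‖x‖) : (oscill t)^[n] φ x = 0 := by
  induction n generalizing x with
  | zero => exact hρ x (by simpa using hx)
  | succ n ih =>
    push_cast at hx
    rw [Function.iterate_succ_apply', oscill, ih (by nlinarith), zero_sub, neg_eq_zero,
      ← abs_nonpos_iff]
    refine abs_avg_le ht fun y hy => ?_
    rw [ih, abs_zero]
    have := norm_sub_norm_le x y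
    linarith

/-- `(-Δ)^s φ` is a superposition over all scales of iterated oscillations of `φ`: these have the
multiplier `(1 - g(t|ξ|))^N`, of order `t^N` at `t = 0`, so that the integral over scales converges
once `N > 2s`. -/
lemma exists_fracLaplacian_eq_integral_oscill (hd : 0 < d) (hs : 0 < s) :
    ∃ (N : ℕ) (c : ℝ), ∀ φ : EuclideanSpace ℝ (Fin d) → ℝ, IsTest φ → ∀ x,
      fracLaplacian s φ x
        = c * ∫ t in Set.Ioi (0 : ℝ), t ^ (-(2 * s) - 1) * (oscill t)^[N] φ x := by
  obtain ⟨g, hgc, hg, hg1, hgl, hgd⟩ := exists_radialBump_profile hd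
  obtain ⟨N, hN⟩ := exists_nat_gt (2 * s)
  have hc : Continuous fun u => (1 - g u) ^ N := by fun_prop
  have hcont := continuousOn_rpow_mul hc (-(2 * s) - 1)
  have hi : IntegrableOn (fun u : ℝ => u ^ (-(2 * s) - 1) * (1 - g u) ^ N) (Set.Ioi 0) := by
    refine integrableOn_Ioi_of_bounds hcont (a := N - 2 * s - 1) (b := -(2 * s) - 1)
      (A := (2 * Real.pi) ^ N) (B := 2 ^ N) (by linarith) (by linarith) (fun u hu _ => ?_)
      (fun u hu => ?_)
    · rw [abs_mul, abs_pow, abs_of_nonneg (by positivity)]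
      calc u ^ (-(2 * s) - 1) * |1 - g u| ^ N ≤ u ^ (-(2 * s) - 1) * (2 * Real.pi * |u|) ^ N := by
            gcongr; exact hgl u
        _ = (2 * Real.pi) ^ N * (u ^ (-(2 * s) - 1) * u ^ (N : ℝ)) := by
            rw [abs_of_pos hu, mul_pow, Real.rpow_natCast]; ring
        _ = _ := by rw [← Real.rpow_add hu]; congr 2; ring
    · have hu0 : 0 < u := by linarith
      rw [abs_mul, abs_pow, abs_of_nonneg (by positivity), mul_comm]
      gcongr
      have := abs_le.1 (hg1 u)
      rw [abs_le]; constructor <;> linarith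
  have hpos : 0 < ∫ u in Set.Ioi (0 : ℝ), u ^ (-(2 * s) - 1) * (1 - g u) ^ N := by
    obtain ⟨C, hC, hCd⟩ := hgd 1
    refine setIntegral_Ioi_pos hcont hi (fun u hu => ?_) (u₀ := C + 1) (by positivity) ?_
    · have := (abs_le.1 (hg1 u)).2
      have : 0 ≤ 1 - g u := by linarith
      positivity
    · have h1 := hCd (C + 1) (by positivity)
      have h2 := le_abs_self (g (C + 1))
      have h3 : g (C + 1) < 1 := by nlinarith [abs_nonneg (g (C + 1))]
      have h4 : 0 < 1 - g (C + 1) := by linarith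
      positivity
  refine ⟨N, (2 * Real.pi) ^ (2 * s) * (∫ u in Set.Ioi (0 : ℝ), u ^ (-(2 * s) - 1) *
    (1 - g u) ^ N)⁻¹, fun φ hφ x => ?_⟩
  have hF' := hφ.integrable_rpow_mul_ft (r := 2 * s) (by positivity)
  have hm := integral_rpow_mul_re_fourierInv hc (p := -(2 * s)) hi hd hφ.integrable_ft
    (by simpa using hF') x
  have e1 : ∀ t ∈ Set.Ioi (0 : ℝ), t ^ (-(2 * s) - 1) *
      (𝓕⁻ (fun ξ => (((1 - g (t * ‖ξ‖)) ^ N : ℝ) : ℂ) * ft φ ξ) x).re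
      = t ^ (-(2 * s) - 1) * (oscill t)^[N] φ x := fun t ht => by
    rw [← funext (ft_iterate_oscill hg hφ ht N), (hφ.iterate_oscill ht N).fourierInv_ft,
      Complex.ofReal_re]
  rw [setIntegral_congr_fun measurableSet_Ioi e1, neg_neg] at hm
  have e2 : (fun ξ => (fracSymbol s ξ : ℂ) * ft φ ξ)
      = fun ξ => (((2 * Real.pi) ^ (2 * s) : ℝ) : ℂ) * (((‖ξ‖ ^ (2 * s) : ℝ) : ℂ) * ft φ ξ) := by
    ext ξ; rw [fracSymbol_eq]; push_cast; ring
  have e3 : 𝓕⁻ (fun ξ => (fracSymbol s ξ : ℂ) * ft φ ξ) x = (((2 * Real.pi) ^ (2 * s) : ℝ) : ℂ) *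
      𝓕⁻ (fun ξ => ((‖ξ‖ ^ (2 * s) : ℝ) : ℂ) * ft φ ξ) x := by
    rw [e2]
    simp only [Real.fourierInv_eq, ← integral_const_mul, Circle.smul_def, smul_eq_mul]
    congr 1; ext ξ; ring
  rw [fracLaplacian_eq, e3, Complex.re_ofReal_mul, hm, mul_assoc,
    inv_mul_cancel_left₀ hpos.ne']

/-- The fractional Laplacian of a test function decays like `|x|^{-d-2s}`. Far from the support of
`φ`, the oscillations of `φ` at `x` vanish at all scales below a multiple of `|x|`, and are
`O(t^{-d})` at the remaining ones. -/
lemma exists_decay_fracLaplacian (hd : 0 < d) (hs : 0 < s) (hφ : IsTest φ) :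
    ∃ C, 0 ≤ C ∧ ∀ x, |fracLaplacian s φ x| ≤ C * (1 + ‖x‖) ^ (-((d : ℝ) + 2 * s)) := by
  obtain ⟨N, c, hrep⟩ := exists_fracLaplacian_eq_integral_oscill (d := d) hd hs
  obtain ⟨B, hB, hbound⟩ := exists_bound_iterate_oscill hφ N
  obtain ⟨ρ, hρ1, hρ⟩ := hφ.exists_support
  set M := ∫ ξ, ‖(fracSymbol s ξ : ℂ) * ft φ ξ‖ with hM
  have hM0 : 0 ≤ M := integral_nonneg fun _ => norm_nonneg _
  set q : ℝ := (d : ℝ) + 2 * s with hq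
  have hq0 : 0 < q := by positivity
  have hNp : (0 : ℝ) < N + 1 := by positivity
  refine ⟨M * (1 + 2 * ρ) ^ q + |c| * (B * ((4 * (N + 1)) ^ q / q)), by positivity, fun x => ?_⟩
  rw [add_mul]
  by_cases hx : ‖x‖ < 2 * ρ
  -- near the support of `φ` the bound by the `L¹` norm of the Fourier transform suffices
  · have h1 : |fracLaplacian s φ x| ≤ M := by
      rw [fracLaplacian_eq]
      refine (Complex.abs_re_le_norm _).trans ?_
      rw [Real.fourierInv_eq_fourier_neg]
      exact VectorFourier.norm_fourierIntegral_le_integral_norm _ _ _ _ _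
    have h2 : 1 ≤ (1 + 2 * ρ) ^ q * (1 + ‖x‖) ^ (-q) := by
      rw [Real.rpow_neg (by positivity), ← div_eq_mul_inv, one_le_div (by positivity)]
      gcongr
    have h3 : 0 ≤ |c| * (B * ((4 * (N + 1)) ^ q / q)) * (1 + ‖x‖) ^ (-q) := by positivity
    nlinarith
  · rw [not_lt] at hx
    have hxp : 0 < ‖x‖ := by linarith
    have hφx : φ x = 0 := hρ x (by linarith)
    set a : ℝ := ‖x‖ / (2 * (N + 1)) with ha
    have ha0 : 0 < a := by positivity
    have hvan : ∀ t, 0 < t → t ≤ a → (oscill t)^[N] φ x = 0 := fun t ht hta => by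
      refine iterate_oscill_eq_zero hρ ht N ?_
      have : t * (2 * (N + 1)) ≤ ‖x‖ := by rwa [ha, le_div_iff₀ (by positivity)] at hta
      nlinarith
    have hint : IntegrableOn (fun t : ℝ => B * t ^ (-q - 1)) (Set.Ioi a) :=
      (integrableOn_Ioi_rpow_of_lt (by linarith) ha0).const_mul B
    have hI : |∫ t in Set.Ioi (0 : ℝ), t ^ (-(2 * s) - 1) * (oscill t)^[N] φ x|
        ≤ B * (a ^ (-q) / q) := by
      have h1 : ∫ t in Set.Ioi (0 : ℝ), t ^ (-(2 * s) - 1) * (oscill t)^[N] φ x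
          = ∫ t in Set.Ioi a, t ^ (-(2 * s) - 1) * (oscill t)^[N] φ x := by
        refine setIntegral_eq_of_subset_of_forall_sdiff_eq_zero measurableSet_Ioi
          (Set.Ioi_subset_Ioi ha0.le) fun t ht => ?_
        rw [hvan t ht.1 (not_lt.1 ht.2), mul_zero]
      rw [h1]
      have h2 : ∀ᵐ t ∂(volume.restrict (Set.Ioi a)),
          ‖t ^ (-(2 * s) - 1) * (oscill t)^[N] φ x‖ ≤ B * t ^ (-q - 1) := by
        refine (ae_restrict_iff' measurableSet_Ioi).2 (ae_of_all _ fun t ht => ?_)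
        have ht0 : 0 < t := ha0.trans ht
        have h3 := hbound t ht0 x
        rw [hφx, sub_zero] at h3
        rw [norm_mul, Real.norm_of_nonneg (by positivity)]
        calc t ^ (-(2 * s) - 1) * ‖(oscill t)^[N] φ x‖
            ≤ t ^ (-(2 * s) - 1) * (B * (t ^ d)⁻¹) := by gcongr; exact h3
          _ = B * (t ^ (-(2 * s) - 1) * t ^ (-(d : ℝ))) := by
            rw [Real.rpow_neg ht0.le, Real.rpow_natCast]; ring
          _ = _ := by rw [← Real.rpow_add ht0]; congr 2; rw [hq]; ring
      refine (norm_integral_le_of_norm_le hint h2).trans (le_of_eq ?_)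
      rw [integral_const_mul, integral_Ioi_rpow_of_lt (by linarith) ha0]
      congr 1
      rw [show -q - 1 + 1 = -q by ring]
      field_simp
    have hfin : a ^ (-q) ≤ (4 * (N + 1)) ^ q * (1 + ‖x‖) ^ (-q) := by
      have h1 : (1 + ‖x‖) / (4 * (N + 1)) ≤ a := by
        rw [ha, div_le_div_iff₀ (by positivity) (by positivity)]
        nlinarith
      calc a ^ (-q) ≤ ((1 + ‖x‖) / (4 * (N + 1))) ^ (-q) :=
            Real.rpow_le_rpow_of_nonpos (by positivity) h1 (by linarith)
        _ = _ := by
            rw [Real.div_rpow (by positivity) (by positivity), Real.rpow_neg (x := 4 * ((N : ℝ) + 1))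
              (by positivity), div_inv_eq_mul, mul_comm]
    rw [hrep φ hφ x, abs_mul]
    have h5 : |c| * |∫ t in Set.Ioi (0 : ℝ), t ^ (-(2 * s) - 1) * (oscill t)^[N] φ x|
        ≤ |c| * (B * ((4 * (N + 1)) ^ q / q)) * (1 + ‖x‖) ^ (-q) := by
      calc _ ≤ |c| * (B * (a ^ (-q) / q)) := by gcongr
        _ ≤ |c| * (B * (((4 * (N + 1)) ^ q * (1 + ‖x‖) ^ (-q)) / q)) := by gcongr
        _ = _ := by ring
    have h6 : 0 ≤ M * (1 + 2 * ρ) ^ q * (1 + ‖x‖) ^ (-q) := by positivity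
    linarith

end Averages

/-! ### Integrals of the Riesz kernel -/

section KernelIntegrals

variable {d : ℕ} {a : ℝ}

/-- The Riesz kernel is integrable on balls centred at its pole, where its integral scales as
`r^{d-a}`. -/
lemma exists_integral_norm_rpow_ball (hd : 0 < d) (had : a < d) :
    ∃ C, 0 ≤ C ∧ ∀ r, 0 < r →
      IntegrableOn (fun y : EuclideanSpace ℝ (Fin d) => ‖y‖ ^ (-a)) (Metric.ball 0 r) ∧
      ∫ y in Metric.ball (0 : EuclideanSpace ℝ (Fin d)) r, ‖y‖ ^ (-a) = C * r ^ ((d : ℝ) - a) := by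
  have : Nonempty (Fin d) := ⟨⟨0, hd⟩⟩
  refine ⟨∫ y in Metric.ball (0 : EuclideanSpace ℝ (Fin d)) 1, ‖y‖ ^ (-a),
    integral_nonneg fun y => by positivity, fun r hr => ⟨?_, ?_⟩⟩
  · rw [integrableOn_fun_norm_addHaar volume (f := fun t => t ^ (-a)), finrank_euclideanSpace_fin]
    have h1 : IntegrableOn (fun t : ℝ => t ^ ((d : ℝ) - 1 - a)) (Set.Ioo 0 r) :=
      (intervalIntegral.integrableOn_Ioo_rpow_iff hr).2 (by linarith)
    refine h1.congr_fun (fun t ht => ?_) measurableSet_Ioo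
    have ht0 : 0 < t := ht.1
    simp only [smul_eq_mul]
    rw [← Real.rpow_natCast, ← Real.rpow_add ht0, Nat.cast_sub (Nat.succ_le_iff.2 hd)]
    congr 1
    push_cast
    ring
  · have h1 := Measure.setIntegral_comp_smul_of_pos volume
      (fun y : EuclideanSpace ℝ (Fin d) => ‖y‖ ^ (-a)) (Metric.ball 0 1) hr
    rw [smul_unitBall_of_pos hr, finrank_euclideanSpace_fin, smul_eq_mul] at h1
    have h2 : ∀ y : EuclideanSpace ℝ (Fin d), ‖r • y‖ ^ (-a) = r ^ (-a) * ‖y‖ ^ (-a) := fun y => by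
      rw [norm_smul, Real.norm_of_nonneg hr.le, Real.mul_rpow hr.le (norm_nonneg _)]
    simp only [h2, integral_const_mul] at h1
    rw [sub_eq_add_neg, Real.rpow_add hr, Real.rpow_natCast]
    field_simp at h1
    linarith

lemma exists_lintegral_ball_le (hd : 0 < d) (had : a < d) :
    ∃ C, 0 ≤ C ∧ ∀ (z : EuclideanSpace ℝ (Fin d)) (r : ℝ), 0 < r →
      ∫⁻ y in Metric.ball z r, ENNReal.ofReal (‖y - z‖ ^ (-a))
        ≤ ENNReal.ofReal (C * r ^ ((d : ℝ) - a)) := by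
  obtain ⟨C, hC, h⟩ := exists_integral_norm_rpow_ball hd had
  refine ⟨C, hC, fun z r hr => ?_⟩
  obtain ⟨h1, h2⟩ := h r hr
  rw [← h2, ofReal_integral_eq_lintegral_ofReal h1 (ae_of_all _ fun y => by positivity),
    ← lintegral_indicator measurableSet_ball, ← lintegral_indicator measurableSet_ball,
    ← lintegral_sub_right_eq_self (Set.indicator (Metric.ball 0 r) _) z]
  refine le_of_eq (lintegral_congr fun y => ?_)
  simp [Set.indicator, dist_eq_norm]

/-- A bound for the Riesz kernel integrated against a weight that decays faster than `|y|^{-d}`. -/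
lemma exists_lintegral_weight_le (hd : 0 < d) (ha : 0 < a) (had : a < d) {b : ℝ} (hb : (d : ℝ) < b) :
    ∃ C, 0 ≤ C ∧ ∀ z : EuclideanSpace ℝ (Fin d),
      ∫⁻ y, ENNReal.ofReal (‖y - z‖ ^ (-a) * (1 + ‖y‖) ^ (-b))
        ≤ ENNReal.ofReal (C * (1 + ‖z‖) ^ (-a)) := by
  obtain ⟨C, hC, h⟩ := exists_lintegral_ball_le (d := d) hd had
  have hd0 : (0 : ℝ) < d := by exact_mod_cast hd
  have hI : Integrable fun y : EuclideanSpace ℝ (Fin d) => (1 + ‖y‖) ^ (-b) :=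
    integrable_one_add_norm (by simpa using hb)
  set I := ∫ y : EuclideanSpace ℝ (Fin d), (1 + ‖y‖) ^ (-b) with hIdef
  have hI0 : 0 ≤ I := integral_nonneg fun y => by positivity
  refine ⟨2 ^ b * C + 2 ^ a * I, by positivity, fun z => ?_⟩
  have hz : 0 < 1 + ‖z‖ := by positivity
  set r := (1 + ‖z‖) / 2 with hr
  have hr0 : 0 < r := by positivity
  -- in the ball of radius `r` about the pole the weight is at most `r^{-b}`, outside it the kernel is
  -- at most `r^{-a}`
  rw [← lintegral_add_compl _ (measurableSet_ball (x := z) (ε := r)), add_mul,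
    ENNReal.ofReal_add (by positivity) (by positivity)]
  gcongr
  · calc ∫⁻ y in Metric.ball z r, ENNReal.ofReal (‖y - z‖ ^ (-a) * (1 + ‖y‖) ^ (-b))
        ≤ ∫⁻ y in Metric.ball z r, ENNReal.ofReal (r ^ (-b)) * ENNReal.ofReal (‖y - z‖ ^ (-a)) := by
          refine setLIntegral_mono' measurableSet_ball fun y hy => ?_
          rw [← ENNReal.ofReal_mul (by positivity), mul_comm (r ^ (-b))]
          refine ENNReal.ofReal_le_ofReal (mul_le_mul_of_nonneg_left ?_ (by positivity))
          refine Real.rpow_le_rpow_of_nonpos hr0 ?_ (by linarith)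
          rw [mem_ball_iff_norm] at hy
          have := norm_sub_norm_le z y
          rw [norm_sub_rev] at this
          linarith
      _ ≤ ENNReal.ofReal (r ^ (-b)) * ENNReal.ofReal (C * r ^ ((d : ℝ) - a)) := by
          rw [lintegral_const_mul' _ _ ENNReal.ofReal_ne_top]
          gcongr
          exact h z r hr0
      _ ≤ _ := by
          rw [← ENNReal.ofReal_mul (by positivity)]
          refine ENNReal.ofReal_le_ofReal ?_
          have e1 : r ^ (-b) * (C * r ^ ((d : ℝ) - a)) = C * r ^ ((d : ℝ) - a - b) := by
            rw [sub_eq_add_neg _ b, Real.rpow_add hr0]; ring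
          have e2 : r ^ ((d : ℝ) - a - b) = (1 + ‖z‖) ^ ((d : ℝ) - a - b) * 2 ^ (b + a - d) := by
            rw [hr, Real.div_rpow hz.le (by norm_num), div_eq_mul_inv, ← Real.rpow_neg (by norm_num)]
            congr 2; ring
          have e3 : (1 + ‖z‖) ^ ((d : ℝ) - a - b) ≤ (1 + ‖z‖) ^ (-a) :=
            Real.rpow_le_rpow_of_exponent_le (by simp) (by linarith)
          have e4 : (2 : ℝ) ^ (b + a - d) ≤ 2 ^ b :=
            Real.rpow_le_rpow_of_exponent_le (by norm_num) (by linarith)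
          rw [e1, e2]
          calc C * ((1 + ‖z‖) ^ ((d : ℝ) - a - b) * 2 ^ (b + a - d))
              ≤ C * ((1 + ‖z‖) ^ (-a) * 2 ^ b) := by gcongr
            _ = _ := by ring
  · calc ∫⁻ y in (Metric.ball z r)ᶜ, ENNReal.ofReal (‖y - z‖ ^ (-a) * (1 + ‖y‖) ^ (-b))
        ≤ ∫⁻ y in (Metric.ball z r)ᶜ, ENNReal.ofReal (r ^ (-a)) * ENNReal.ofReal ((1 + ‖y‖) ^ (-b)) := by
          refine setLIntegral_mono' measurableSet_ball.compl fun y hy => ?_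
          rw [← ENNReal.ofReal_mul (by positivity)]
          refine ENNReal.ofReal_le_ofReal (mul_le_mul_of_nonneg_right ?_ (by positivity))
          refine Real.rpow_le_rpow_of_nonpos hr0 ?_ (by linarith)
          rw [Set.mem_compl_iff, mem_ball_iff_norm, not_lt] at hy
          exact hy
      _ ≤ ENNReal.ofReal (r ^ (-a)) * ENNReal.ofReal I := by
          rw [lintegral_const_mul' _ _ ENNReal.ofReal_ne_top, hIdef,
            ofReal_integral_eq_lintegral_ofReal hI (ae_of_all _ fun y => by positivity)]
          gcongr
          exact Measure.restrict_le_self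
      _ ≤ _ := by
          rw [← ENNReal.ofReal_mul (by positivity)]
          refine ENNReal.ofReal_le_ofReal (le_of_eq ?_)
          rw [hr, Real.div_rpow hz.le (by norm_num), div_eq_mul_inv, ← Real.rpow_neg (by norm_num),
            neg_neg]
          ring

/-- A bound for the mean of the Riesz kernel with pole `z` over a ball of radius `2R`. -/
lemma exists_lintegral_mean_le (hd : 0 < d) (ha : 0 < a) (had : a < d) :
    ∃ C, 0 ≤ C ∧ ∀ (x z : EuclideanSpace ℝ (Fin d)) (R : ℝ), 0 < R →
      ∫⁻ y in Metric.ball x (2 * R), ENNReal.ofReal (‖y - z‖ ^ (-a))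
        ≤ ENNReal.ofReal (R ^ d) * ENNReal.ofReal (C * (max R ‖z - x‖) ^ (-a)) := by
  obtain ⟨C, hC, h⟩ := exists_lintegral_ball_le (d := d) hd had
  have : Nonempty (Fin d) := ⟨⟨0, hd⟩⟩
  set V := (volume (Metric.ball (0 : EuclideanSpace ℝ (Fin d)) 1)).toReal with hV
  have hV0 : 0 ≤ V := ENNReal.toReal_nonneg
  refine ⟨C * 6 ^ ((d : ℝ) - a) * 4 ^ a + 2 ^ a * (2 ^ d * V), by positivity, fun x z R hR => ?_⟩
  have hm : 0 < max R ‖z - x‖ := lt_max_of_lt_left hR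
  rw [← ENNReal.ofReal_mul (by positivity)]
  -- either the pole is close to the ball, or the kernel is almost constant on it
  by_cases hx : ‖z - x‖ < 4 * R
  · have h1 : Metric.ball x (2 * R) ⊆ Metric.ball z (6 * R) := by
      refine Metric.ball_subset_ball' ?_
      rw [dist_comm, dist_eq_norm]; linarith
    refine (lintegral_mono_set h1).trans ((h z (6 * R) (by positivity)).trans
      (ENNReal.ofReal_le_ofReal ?_))
    rw [Real.mul_rpow (by norm_num) hR.le, sub_eq_add_neg _ a, Real.rpow_add hR, Real.rpow_natCast]
    have h2 : R ^ (-a) ≤ 4 ^ a * (max R ‖z - x‖) ^ (-a) := by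
      have h3 : max R ‖z - x‖ ≤ 4 * R := max_le (by linarith) hx.le
      have h4 := Real.rpow_le_rpow_of_nonpos hm h3 (by linarith : -a ≤ 0)
      rw [Real.mul_rpow (by norm_num) hR.le, Real.rpow_neg (by norm_num)] at h4
      rwa [← inv_mul_le_iff₀ (by positivity)]
    calc C * (6 ^ ((d : ℝ) + -a) * (R ^ d * R ^ (-a)))
        ≤ C * (6 ^ ((d : ℝ) + -a) * (R ^ d * (4 ^ a * (max R ‖z - x‖) ^ (-a)))) := by gcongr
      _ = R ^ d * ((C * 6 ^ ((d : ℝ) + -a) * 4 ^ a) * (max R ‖z - x‖) ^ (-a)) := by ring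
      _ ≤ _ := by
          gcongr
          have : 0 ≤ 2 ^ a * (2 ^ d * V) := by positivity
          linarith
  · rw [not_lt] at hx
    have hmax : max R ‖z - x‖ = ‖z - x‖ := max_eq_right (by linarith)
    have hzx : 0 < ‖z - x‖ := by linarith
    have h1 : ∫⁻ y in Metric.ball x (2 * R), ENNReal.ofReal (‖y - z‖ ^ (-a))
        ≤ ∫⁻ y in Metric.ball x (2 * R), ENNReal.ofReal ((‖z - x‖ / 2) ^ (-a)) := by
      refine setLIntegral_mono' measurableSet_ball fun y hy => ENNReal.ofReal_le_ofReal ?_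
      refine Real.rpow_le_rpow_of_nonpos (by positivity) ?_ (by linarith)
      rw [mem_ball_iff_norm] at hy
      have : ‖z - x‖ ≤ ‖y - x‖ + ‖y - z‖ := by
        have := norm_sub_le (y - x) (y - z)
        rwa [show y - x - (y - z) = z - x by abel] at this
      linarith
    refine h1.trans ?_
    rw [setLIntegral_const, Measure.addHaar_ball _ _ (by positivity), finrank_euclideanSpace_fin,
      ← ENNReal.ofReal_toReal (a := volume (Metric.ball (0 : EuclideanSpace ℝ (Fin d)) 1))
        measure_ball_lt_top.ne, ← hV, ← ENNReal.ofReal_mul (by positivity),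
      ← ENNReal.ofReal_mul (by positivity), hmax]
    refine ENNReal.ofReal_le_ofReal ?_
    rw [Real.div_rpow hzx.le (by norm_num), div_eq_mul_inv, ← Real.rpow_neg (by norm_num), neg_neg,
      mul_pow]
    have : 0 ≤ C * 6 ^ ((d : ℝ) - a) * 4 ^ a * ‖z - x‖ ^ (-a) := by positivity
    have : 0 ≤ R ^ d * (C * 6 ^ ((d : ℝ) - a) * 4 ^ a * ‖z - x‖ ^ (-a)) := by positivity
    nlinarith

end KernelIntegrals

/-! ### Inversion of the fractional Laplacian by the Riesz kernel -/

section RieszInversion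

variable {d : ℕ} {s : ℝ} {φ : EuclideanSpace ℝ (Fin d) → ℝ}

/-- Gaussian kernels of all widths integrate to a Riesz kernel. -/
lemma integrableOn_and_integral_gaussian_scales {a r : ℝ} (ha : 0 < a) (hr : 0 < r) :
    IntegrableOn (fun t : ℝ => t ^ (-a - 1) * Real.exp (-Real.pi * (t⁻¹ * r) ^ 2)) (Set.Ioi 0) ∧
    ∫ t in Set.Ioi (0 : ℝ), t ^ (-a - 1) * Real.exp (-Real.pi * (t⁻¹ * r) ^ 2)
      = (Real.pi ^ (-(a / 2)) * (1 / 2) * Real.Gamma (a / 2)) * r ^ (-a) := by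
  have hb : 0 < Real.pi * r ^ 2 := by positivity
  have hi := integrableOn_rpow_mul_exp_neg_mul_rpow (s := a - 1) (p := 2) (b := Real.pi * r ^ 2)
    (by linarith) two_pos hb
  have hI := integral_rpow_mul_exp_neg_mul_rpow (q := a - 1) (p := 2) (b := Real.pi * r ^ 2)
    two_pos (by linarith) hb
  have e : ∀ t ∈ Set.Ioi (0 : ℝ), (|(-1 : ℝ)| * t ^ ((-1 : ℝ) - 1)) •
      (fun x : ℝ => x ^ (a - 1) * Real.exp (-(Real.pi * r ^ 2) * x ^ (2 : ℝ))) (t ^ (-1 : ℝ))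
      = t ^ (-a - 1) * Real.exp (-Real.pi * (t⁻¹ * r) ^ 2) := fun t ht => by
    have ht0 : 0 < t := ht
    simp only [smul_eq_mul, abs_neg, abs_one, one_mul]
    rw [← Real.rpow_mul ht0.le, ← mul_assoc, ← Real.rpow_add ht0, Real.rpow_two, Real.rpow_neg_one]
    congr 2
    · ring
    · ring
  constructor
  · have := (integrableOn_Ioi_comp_rpow_iff _ (show (-1 : ℝ) ≠ 0 by norm_num)).2 hi
    exact IntegrableOn.congr_fun this e measurableSet_Ioi
  · rw [← setIntegral_congr_fun measurableSet_Ioi e,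
      integral_comp_rpow_Ioi (fun x : ℝ => x ^ (a - 1) * Real.exp (-(Real.pi * r ^ 2) * x ^ (2 : ℝ)))
        (show (-1 : ℝ) ≠ 0 by norm_num), hI,
      Real.mul_rpow (by positivity) (by positivity), ← Real.rpow_natCast r 2, ← Real.rpow_mul hr.le]
    rw [show -(a - 1 + 1) / 2 = -(a / 2) by ring, show (a - 1 + 1) / 2 = a / 2 by ring,
      show ((2 : ℕ) : ℝ) * -(a / 2) = -a by push_cast; ring]
    ring

/-- The Gaussian that is its own Fourier transform. -/
noncomputable def gauss {d : ℕ} (x : EuclideanSpace ℝ (Fin d)) : ℝ :=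
  Real.exp (-Real.pi * ‖x‖ ^ 2)

lemma integrable_gauss : Integrable (gauss (d := d)) := by
  have := (GaussianFourier.integrable_cexp_neg_mul_sq_norm_add (b := (Real.pi : ℂ))
    (by simpa using Real.pi_pos) 0 (0 : EuclideanSpace ℝ (Fin d))).re
  refine this.congr (ae_of_all _ fun x => ?_)
  simp only [zero_mul, add_zero, gauss]
  rw [show -(Real.pi : ℂ) * (‖x‖ : ℂ) ^ 2 = ((-Real.pi * ‖x‖ ^ 2 : ℝ) : ℂ) by push_cast; ring,
    ← Complex.ofReal_exp]
  exact Complex.ofReal_re _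

lemma ft_gauss (ξ : EuclideanSpace ℝ (Fin d)) : ft gauss ξ = (Real.exp (-Real.pi * ‖ξ‖ ^ 2) : ℂ) := by
  have h := fourier_gaussian_innerProductSpace (b := (Real.pi : ℂ)) (by simpa using Real.pi_pos) ξ
  have e : (fun y : EuclideanSpace ℝ (Fin d) => ((gauss y : ℝ) : ℂ))
      = fun v => Complex.exp (-Real.pi * ‖v‖ ^ 2) := by
    ext v; simp only [gauss]; push_cast; rfl
  unfold ft
  have hpi : (Real.pi : ℂ) ≠ 0 := by exact_mod_cast Real.pi_ne_zero
  rw [e, h, div_self hpi, Complex.one_cpow, one_mul]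
  push_cast
  congr 1
  field_simp

lemma integrable_dil {k : EuclideanSpace ℝ (Fin d) → ℝ} (hk : Integrable k) {t : ℝ} (ht : 0 < t) :
    Integrable (dil t k) :=
  (hk.comp_smul (inv_ne_zero ht.ne')).const_mul _

lemma integrable_rpow_mul_fracLaplacian (hd : 0 < d) (hs : 0 < s) (hsd : s < (d : ℝ) / 2)
    (hφ : IsTest φ) (x : EuclideanSpace ℝ (Fin d)) :
    Integrable fun y => ‖y - x‖ ^ (-((d : ℝ) - 2 * s)) * fracLaplacian s φ y := by
  obtain ⟨C, hC, hdec⟩ := exists_decay_fracLaplacian hd hs hφ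
  obtain ⟨D, hD, hK⟩ := exists_lintegral_weight_le (a := (d : ℝ) - 2 * s) (b := (d : ℝ) + 2 * s) hd
    (by linarith) (by linarith) (by linarith)
  have hm : Measurable fun y : EuclideanSpace ℝ (Fin d) => ‖y - x‖ ^ (-((d : ℝ) - 2 * s)) := by
    fun_prop
  have hi : Integrable fun y : EuclideanSpace ℝ (Fin d) =>
      ‖y - x‖ ^ (-((d : ℝ) - 2 * s)) * (1 + ‖y‖) ^ (-((d : ℝ) + 2 * s)) := by
    refine ⟨(hm.mul (by fun_prop)).aestronglyMeasurable, ?_⟩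
    rw [hasFiniteIntegral_iff_ofReal (ae_of_all _ fun y => by positivity)]
    exact (hK x).trans_lt ENNReal.ofReal_lt_top
  refine (hi.const_mul C).mono'
    (hm.aestronglyMeasurable.mul (continuous_fracLaplacian hφ hs).aestronglyMeasurable)
    (ae_of_all _ fun y => ?_)
  rw [norm_mul, Real.norm_of_nonneg (by positivity)]
  calc _ ≤ ‖y - x‖ ^ (-((d : ℝ) - 2 * s)) * (C * (1 + ‖y‖) ^ (-((d : ℝ) + 2 * s))) := by
        gcongr; exact hdec y
    _ = _ := by ring

/-- Dividing the multiplier of `(-Δ)^s φ` by `|ξ|^{2s}` gives back `φ`, up to the factors `2π` of the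
frequency variable. -/
lemma integrable_norm_rpow_mul_fracSymbol_mul_ft (hd : 0 < d) (hφ : IsTest φ) :
    Integrable (fun ξ => ((‖ξ‖ ^ (-(2 * s)) : ℝ) : ℂ) * ((fracSymbol s ξ : ℂ) * ft φ ξ)) ∧
    ∀ x, (𝓕⁻ (fun ξ => ((‖ξ‖ ^ (-(2 * s)) : ℝ) : ℂ) * ((fracSymbol s ξ : ℂ) * ft φ ξ)) x).re
      = (2 * Real.pi) ^ (2 * s) * φ x := by
  have hae : (fun ξ => ((‖ξ‖ ^ (-(2 * s)) : ℝ) : ℂ) * ((fracSymbol s ξ : ℂ) * ft φ ξ))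
      =ᵐ[volume] fun ξ => (((2 * Real.pi) ^ (2 * s) : ℝ) : ℂ) * ft φ ξ := by
    filter_upwards [ae_norm_pos hd] with ξ hξ
    rw [fracSymbol_eq, ← mul_assoc, ← Complex.ofReal_mul, Real.rpow_neg hξ.le]
    congr 2
    field_simp
  refine ⟨(hφ.integrable_ft.const_mul _).congr hae.symm, fun x => ?_⟩
  rw [Real.fourierInv_congr_ae hae, ← Complex.ofReal_re (φ x), ← hφ.fourierInv_ft x,
    ← Complex.re_ofReal_mul]
  congr 1
  simp only [Real.fourierInv_eq, ← integral_const_mul, Circle.smul_def, smul_eq_mul]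
  congr 1; ext ξ; ring

/-- The Riesz potential of order `2s` inverts the fractional Laplacian on test functions. The Mellin
identity for the multiplier `exp (-π t² |ξ|²)` has `φ` on one side; on the other, the Gaussian
kernels integrate over `t` to a multiple of the Riesz kernel. -/
lemma rieszConst_mul_integral_fracLaplacian (hd : 0 < d) (hs : 0 < s) (hsd : s < (d : ℝ) / 2)
    (hφ : IsTest φ) (x : EuclideanSpace ℝ (Fin d)) :
    rieszConst d (2 * s) * ∫ y, ‖y - x‖ ^ (-((d : ℝ) - 2 * s)) * fracLaplacian s φ y = φ x := by
  set a : ℝ := (d : ℝ) - 2 * s with ha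
  have ha0 : 0 < a := by rw [ha]; linarith
  set F : EuclideanSpace ℝ (Fin d) → ℂ := fun ξ => (fracSymbol s ξ : ℂ) * ft φ ξ with hFdef
  have hF : Integrable F := integrable_fracSymbol_mul_ft hφ hs
  obtain ⟨hF', hinv⟩ := integrable_norm_rpow_mul_fracSymbol_mul_ft (s := s) hd hφ
  have hm := integral_rpow_mul_re_fourierInv (h := fun u => Real.exp (-Real.pi * u ^ 2))
    (by fun_prop) (p := 2 * s) (by
      have := integrableOn_rpow_mul_exp_neg_mul_rpow (s := 2 * s - 1) (p := 2) (b := Real.pi)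
        (by linarith) two_pos Real.pi_pos
      simpa using this) hd hF hF' x
  have hconst : ∫ u in Set.Ioi (0 : ℝ), u ^ (2 * s - 1) * Real.exp (-Real.pi * u ^ 2)
      = Real.pi ^ (-s) * (1 / 2) * Real.Gamma s := by
    have := integral_rpow_mul_exp_neg_mul_rpow (q := 2 * s - 1) (p := 2) (b := Real.pi)
      two_pos (by linarith) Real.pi_pos
    simp only [Real.rpow_two] at this
    rw [this, show -(2 * s - 1 + 1) / 2 = -s by ring, show (2 * s - 1 + 1) / 2 = s by ring]
  rw [hinv x, hconst] at hm
  have hker : ∀ t : ℝ, 0 < t → ∀ y : EuclideanSpace ℝ (Fin d),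
      t ^ (2 * s - 1) * dil t gauss y = t ^ (-a - 1) * Real.exp (-Real.pi * (t⁻¹ * ‖y‖) ^ 2) :=
      fun t ht y => by
    unfold dil gauss
    rw [norm_smul, norm_inv, Real.norm_of_nonneg ht.le, ← mul_assoc, ← Real.rpow_natCast,
      ← Real.rpow_neg ht.le, ← Real.rpow_add ht]
    congr 2; rw [ha]; ring
  have hleft : ∀ t ∈ Set.Ioi (0 : ℝ), t ^ (2 * s - 1) *
      (𝓕⁻ (fun ξ => ((Real.exp (-Real.pi * (t * ‖ξ‖) ^ 2) : ℝ) : ℂ) * F ξ) x).re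
      = ∫ y, (t ^ (-a - 1) * Real.exp (-Real.pi * (t⁻¹ * ‖y‖) ^ 2)) * fracLaplacian s φ (x - y) :=
      fun t ht => by
    have ht0 : 0 < t := ht
    have e : (fun ξ => ((Real.exp (-Real.pi * (t * ‖ξ‖) ^ 2) : ℝ) : ℂ) * F ξ)
        = fun ξ => F ξ * ft (dil t gauss) ξ := by
      ext ξ
      rw [ft_dil ht0, ft_gauss, norm_smul, Real.norm_of_nonneg ht0.le, mul_comm]
    rw [e, fourierInv_mul_ft hF (integrable_dil integrable_gauss ht0),
      re_integral_mul_fourierInv hF (integrable_dil integrable_gauss ht0), ← integral_const_mul]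
    congr 1; ext y
    rw [← hker t ht0 y, mul_assoc]
    rfl
  rw [setIntegral_congr_fun measurableSet_Ioi hleft] at hm
  set c := Real.pi ^ (-(a / 2)) * (1 / 2) * Real.Gamma (a / 2) with hc
  have hψ := (continuous_fracLaplacian hφ hs)
  have hpot : Integrable fun y => ‖y‖ ^ (-a) * fracLaplacian s φ (x - y) := by
    have := (integrable_rpow_mul_fracLaplacian hd hs hsd hφ x).comp_sub_left x
    simpa [ha] using this
  have hswap : Integrable (Function.uncurry fun (t : ℝ) (y : EuclideanSpace ℝ (Fin d)) =>
      (t ^ (-a - 1) * Real.exp (-Real.pi * (t⁻¹ * ‖y‖) ^ 2)) * fracLaplacian s φ (x - y))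
      ((volume.restrict (Set.Ioi 0)).prod volume) := by
    have hmeas : AEStronglyMeasurable (Function.uncurry fun (t : ℝ) (y : EuclideanSpace ℝ (Fin d)) =>
        (t ^ (-a - 1) * Real.exp (-Real.pi * (t⁻¹ * ‖y‖) ^ 2)) * fracLaplacian s φ (x - y))
        ((volume.restrict (Set.Ioi 0)).prod volume) := by
      refine Measurable.aestronglyMeasurable (Measurable.mul (Measurable.mul ?_ ?_) ?_)
      · exact measurable_fst.pow_const _
      · fun_prop
      · exact hψ.measurable.comp (measurable_const.sub measurable_snd)
    rw [integrable_prod_iff' hmeas]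
    constructor
    · filter_upwards [ae_norm_pos hd] with y hy
      exact (integrableOn_and_integral_gaussian_scales ha0 hy).1.mul_const (fracLaplacian s φ (x - y))
    · refine (hpot.norm.const_mul c).congr ?_
      filter_upwards [ae_norm_pos hd] with y hy
      have e : ∀ t ∈ Set.Ioi (0 : ℝ), ‖Function.uncurry (fun (t : ℝ) (y : EuclideanSpace ℝ (Fin d)) =>
          (t ^ (-a - 1) * Real.exp (-Real.pi * (t⁻¹ * ‖y‖) ^ 2)) * fracLaplacian s φ (x - y)) (t, y)‖
          = (t ^ (-a - 1) * Real.exp (-Real.pi * (t⁻¹ * ‖y‖) ^ 2)) * ‖fracLaplacian s φ (x - y)‖ :=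
          fun t ht => by
        have ht0 : 0 < t := ht
        rw [Function.uncurry_apply_pair, norm_mul, Real.norm_of_nonneg (by positivity)]
      rw [setIntegral_congr_fun measurableSet_Ioi e, integral_mul_const,
        (integrableOn_and_integral_gaussian_scales ha0 hy).2, norm_mul,
        Real.norm_of_nonneg (by positivity)]
      ring
  rw [integral_integral_swap hswap] at hm
  have hfin : ∫ y, ∫ t in Set.Ioi (0 : ℝ),
      (t ^ (-a - 1) * Real.exp (-Real.pi * (t⁻¹ * ‖y‖) ^ 2)) * fracLaplacian s φ (x - y)
      = c * ∫ y, ‖y - x‖ ^ (-a) * fracLaplacian s φ y := by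
    rw [← integral_sub_left_eq_self (fun y => ‖y - x‖ ^ (-a) * fracLaplacian s φ y) volume x,
      ← integral_const_mul]
    refine integral_congr_ae ?_
    filter_upwards [ae_norm_pos hd] with y hy
    rw [integral_mul_const, (integrableOn_and_integral_gaussian_scales ha0 hy).2]
    simp only [sub_sub_cancel_left, norm_neg]
    ring
  rw [hfin] at hm
  set I := ∫ y, ‖y - x‖ ^ (-a) * fracLaplacian s φ y with hI
  have hG : 0 < Real.Gamma s := Real.Gamma_pos_of_pos hs
  have e1 : Real.Gamma (a / 2) * I
      = Real.pi ^ (a / 2) * (Real.pi ^ (-s) * Real.Gamma s * ((2 * Real.pi) ^ (2 * s) * φ x)) := by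
    have h2 : Real.pi ^ (a / 2) * Real.pi ^ (-(a / 2)) = 1 := by
      rw [← Real.rpow_add Real.pi_pos]; simp
    calc Real.Gamma (a / 2) * I = 2 * Real.pi ^ (a / 2) * (c * I) := by
          rw [hc]; linear_combination (-Real.Gamma (a / 2) * I) * h2
      _ = _ := by rw [hm]; ring
  have e2 : Real.pi ^ (a / 2) * Real.pi ^ (-s) * (2 * Real.pi) ^ (2 * s)
      = Real.pi ^ ((d : ℝ) / 2) * 2 ^ (2 * s) := by
    rw [Real.mul_rpow (by norm_num) Real.pi_pos.le, mul_comm ((2 : ℝ) ^ (2 * s)), ← mul_assoc,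
      ← Real.rpow_add Real.pi_pos, ← Real.rpow_add Real.pi_pos]
    congr 2; rw [ha]; ring
  unfold rieszConst
  rw [show 2 * s / 2 = s by ring, div_mul_eq_mul_div, ← ha, e1, div_eq_iff (by positivity)]
  linear_combination (Real.Gamma s * φ x) * e2

end RieszInversion

/-! ### Mass bounds for nonnegative elements of the dual Sobolev space -/

section DualSobolevMass

variable {d : ℕ} {s : ℝ} {T : EuclideanSpace ℝ (Fin d) → ℝ}

lemma homSobolevNorm_comp_smul (s : ℝ) {r : ℝ} (hr : 0 < r)
    (φ : EuclideanSpace ℝ (Fin d) → ℝ) :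
    homSobolevNorm s (fun x => φ (r⁻¹ • x)) = r ^ (((d : ℝ) - 2 * s) / 2) * homSobolevNorm s φ := by
  have h1 : ∀ ξ, (2 * Real.pi * ‖ξ‖) ^ (2 * s) * ‖𝓕 (fun y => ((φ (r⁻¹ • y) : ℝ) : ℂ)) ξ‖ ^ 2
      = ((r ^ d) ^ 2 * r ^ (-(2 * s))) *
        (fun η => (2 * Real.pi * ‖η‖) ^ (2 * s) * ‖𝓕 (fun y => (φ y : ℂ)) η‖ ^ 2) (r • ξ) :=
      fun ξ => by
    have h2 := fourier_smul_comp (F := fun y => (φ y : ℂ)) hr ξ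
    have h3 := fracSymbol_smul (s := s) hr.le ξ
    unfold fracSymbol at h3
    simp only
    rw [h2, h3, norm_mul, Complex.norm_real, Real.norm_of_nonneg (by positivity), Real.rpow_neg hr.le]
    field_simp
  unfold homSobolevNorm
  simp only [h1]
  rw [integral_const_mul, Measure.integral_comp_smul volume (fun η : EuclideanSpace ℝ (Fin d) =>
      (2 * Real.pi * ‖η‖) ^ (2 * s) * ‖𝓕 (fun y => (φ y : ℂ)) η‖ ^ 2), finrank_euclideanSpace_fin,
    abs_of_nonneg (by positivity), smul_eq_mul, ← mul_assoc, Real.sqrt_mul (by positivity)]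
  congr 1
  rw [Real.sqrt_eq_iff_eq_sq (by positivity) (by positivity),
    ← Real.rpow_natCast (r ^ (((d : ℝ) - 2 * s) / 2)) 2, ← Real.rpow_mul hr.le]
  have h4 : ((d : ℝ) - 2 * s) / 2 * ((2 : ℕ) : ℝ) = (d : ℝ) + -(2 * s) := by push_cast; ring
  rw [h4, Real.rpow_add hr, Real.rpow_natCast]
  field_simp

/-- A nonnegative element of the dual space gives mass `O(r^{(d-2s)/2})` to balls of radius `r`:
test it against a dilated bump. -/
lemma exists_mass_ball_le (hT : MemDualHomSobolevL1Loc s T) (hT0 : ∀ᵐ x, 0 ≤ T x) :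
    ∃ C, 0 ≤ C ∧ ∀ r, 0 < r → ∫⁻ x in Metric.ball 0 r, ENNReal.ofReal (T x)
      ≤ ENNReal.ofReal (C * r ^ (((d : ℝ) - 2 * s) / 2)) := by
  obtain ⟨hTloc, C, hC⟩ := hT
  let χ : ContDiffBump (0 : EuclideanSpace ℝ (Fin d)) := ⟨1, 2, one_pos, one_lt_two⟩
  have hχ : IsTest χ := ⟨χ.contDiff, χ.hasCompactSupport⟩
  refine ⟨|C| * homSobolevNorm s χ, mul_nonneg (abs_nonneg _) (Real.sqrt_nonneg _), fun r hr => ?_⟩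
  have hχr := hχ.comp_smul (c := r⁻¹) (by positivity)
  have hb := hC _ hχr.contDiff hχr.hasCompactSupport
  rw [homSobolevNorm_comp_smul s hr] at hb
  have hint : Integrable fun x => T x * χ (r⁻¹ • x) := by
    have := hTloc.integrable_smul_left_of_hasCompactSupport hχr.continuous hχr.hasCompactSupport
    simpa only [smul_eq_mul, mul_comm] using this
  calc ∫⁻ x in Metric.ball 0 r, ENNReal.ofReal (T x)
      ≤ ∫⁻ x, ENNReal.ofReal (T x * χ (r⁻¹ • x)) := by
        rw [← lintegral_indicator measurableSet_ball]
        refine lintegral_mono fun x => ?_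
        by_cases hx : x ∈ Metric.ball (0 : EuclideanSpace ℝ (Fin d)) r
        · rw [Set.indicator_of_mem hx, χ.one_of_mem_closedBall, mul_one]
          rw [mem_ball_zero_iff] at hx
          rw [mem_closedBall_zero_iff, norm_smul, norm_inv, Real.norm_of_nonneg hr.le,
            inv_mul_le_iff₀ hr]
          simpa [χ] using hx.le
        · rw [Set.indicator_of_notMem hx]; exact zero_le
    _ = ENNReal.ofReal (∫ x, T x * χ (r⁻¹ • x)) := by
        rw [ofReal_integral_eq_lintegral_ofReal hint]
        filter_upwards [hT0] with x hx using mul_nonneg hx χ.nonneg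
    _ ≤ _ := by
        refine ENNReal.ofReal_le_ofReal ((le_abs_self _).trans (hb.trans ?_))
        have h1 : 0 ≤ r ^ (((d : ℝ) - 2 * s) / 2) * homSobolevNorm s χ :=
          mul_nonneg (by positivity) (Real.sqrt_nonneg _)
        calc _ ≤ |C| * (r ^ (((d : ℝ) - 2 * s) / 2) * homSobolevNorm s χ) :=
              mul_le_mul_of_nonneg_right (le_abs_self C) h1
          _ = _ := by ring

/-- A dyadic majorant of the weight, used to sum the mass bounds on balls. -/
lemma one_add_norm_rpow_le_tsum {a : ℝ} (ha : 0 < a) (x : EuclideanSpace ℝ (Fin d)) :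
    ENNReal.ofReal ((1 + ‖x‖) ^ (-a)) ≤ ∑' k : ℕ, (Metric.ball (0 : EuclideanSpace ℝ (Fin d)) (2 ^ k)).indicator
      (fun _ => ENNReal.ofReal (2 ^ a * (2 ^ k) ^ (-a))) x := by
  have hex : ∃ k : ℕ, ‖x‖ < 2 ^ k := pow_unbounded_of_one_lt _ one_lt_two
  classical
  set k := Nat.find hex with hk
  have hk1 : ‖x‖ < 2 ^ k := Nat.find_spec hex
  refine le_trans ?_ (ENNReal.le_tsum k)
  rw [Set.indicator_of_mem (by simpa using hk1)]
  refine ENNReal.ofReal_le_ofReal ?_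
  have h2 : (2 : ℝ) ^ k ≤ 2 * (1 + ‖x‖) := by
    rcases Nat.eq_zero_or_pos k with h0 | h0
    · rw [h0]; have := norm_nonneg x; norm_num; linarith
    · have h3 := Nat.find_min hex (m := k - 1) (by omega)
      rw [not_lt] at h3
      have h4 : (2 : ℝ) ^ k = 2 * 2 ^ (k - 1) := by
        rw [← pow_succ']; congr 1; omega
      linarith
  have h5 := Real.rpow_le_rpow_of_nonpos (by positivity) h2 (by linarith : -a ≤ 0)
  rw [Real.mul_rpow (by norm_num) (by positivity), Real.rpow_neg (by norm_num)] at h5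
  rwa [← inv_mul_le_iff₀ (by positivity)]

/-- The Riesz potential of order `2s` of a nonnegative element of the dual space converges at
infinity. -/
lemma integrable_mul_one_add_norm_rpow (hsd : s < (d : ℝ) / 2)
    (hT : MemDualHomSobolevL1Loc s T) (hT0 : ∀ᵐ x, 0 ≤ T x) :
    Integrable fun x => T x * (1 + ‖x‖) ^ (-((d : ℝ) - 2 * s)) := by
  obtain ⟨C, hC, hm⟩ := exists_mass_ball_le hT hT0
  set a : ℝ := (d : ℝ) - 2 * s with ha
  have ha0 : 0 < a := by rw [ha]; linarith
  have hTm : AEStronglyMeasurable T volume := hT.1.aestronglyMeasurable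
  have hw : Measurable fun x : EuclideanSpace ℝ (Fin d) => (1 + ‖x‖) ^ (-a) := by fun_prop
  refine ⟨hTm.mul hw.aestronglyMeasurable, ?_⟩
  rw [hasFiniteIntegral_iff_ofReal (by
    filter_upwards [hT0] with x hx using mul_nonneg hx (by positivity))]
  calc ∫⁻ x, ENNReal.ofReal (T x * (1 + ‖x‖) ^ (-a))
      ≤ ∫⁻ x, ∑' k : ℕ, (Metric.ball (0 : EuclideanSpace ℝ (Fin d)) (2 ^ k)).indicator
          (fun x => ENNReal.ofReal (T x) * ENNReal.ofReal (2 ^ a * (2 ^ k) ^ (-a))) x := by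
        refine lintegral_mono fun x => ?_
        rw [ENNReal.ofReal_mul' (by positivity)]
        refine (mul_le_mul_right (one_add_norm_rpow_le_tsum ha0 x) _).trans (le_of_eq ?_)
        rw [← ENNReal.tsum_mul_left]
        congr 1; ext k
        by_cases hx : x ∈ Metric.ball (0 : EuclideanSpace ℝ (Fin d)) (2 ^ k)
        · rw [Set.indicator_of_mem hx, Set.indicator_of_mem hx]
        · rw [Set.indicator_of_notMem hx, Set.indicator_of_notMem hx, mul_zero]
    _ = ∑' k : ℕ, (∫⁻ x in Metric.ball (0 : EuclideanSpace ℝ (Fin d)) (2 ^ k), ENNReal.ofReal (T x)) *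
          ENNReal.ofReal (2 ^ a * (2 ^ k) ^ (-a)) := by
        rw [lintegral_tsum fun k =>
          (hTm.aemeasurable.ennreal_ofReal.mul_const _).indicator measurableSet_ball]
        congr 1; ext k
        rw [lintegral_indicator measurableSet_ball, lintegral_mul_const' _ _ ENNReal.ofReal_ne_top]
    _ ≤ ∑' k : ℕ, ENNReal.ofReal ((C * 2 ^ a) * ((2 : ℝ) ^ (-(a / 2))) ^ k) := by
        refine ENNReal.tsum_le_tsum fun k => ?_
        refine (mul_le_mul_left (hm (2 ^ k) (by positivity)) _).trans (le_of_eq ?_)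
        rw [← ENNReal.ofReal_mul (by positivity)]
        congr 1
        rw [← Real.rpow_natCast 2 k, ← Real.rpow_mul (by norm_num), ← Real.rpow_mul (by norm_num),
          ← Real.rpow_natCast _ k, ← Real.rpow_mul (by norm_num)]
        have : (2 : ℝ) ^ (-(a / 2) * k) = 2 ^ (k * (a / 2)) * 2 ^ (k * -a) := by
          rw [← Real.rpow_add (by norm_num)]; congr 1; ring
        rw [this]; ring
    _ < ⊤ := by
        have hlt : (2 : ℝ) ^ (-(a / 2)) < 1 := Real.rpow_lt_one_of_one_lt_of_neg one_lt_two (by linarith)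
        rw [← ENNReal.ofReal_tsum_of_nonneg (fun k => by positivity)
          ((summable_geometric_of_lt_one (by positivity) hlt).mul_left _)]
        exact ENNReal.ofReal_lt_top

end DualSobolevMass

/-! ### The integral of a fractional Laplacian -/

section FracLaplacianMeanZero

variable {d : ℕ} {s : ℝ} {φ : EuclideanSpace ℝ (Fin d) → ℝ}

/-- The real part in the definition of the fractional Laplacian loses nothing. -/
lemma fracLaplacian_ofReal (s : ℝ) (φ : EuclideanSpace ℝ (Fin d) → ℝ)
    (x : EuclideanSpace ℝ (Fin d)) :
    (fracLaplacian s φ x : ℂ) = 𝓕⁻ (fun ξ => (fracSymbol s ξ : ℂ) * ft φ ξ) x := by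
  rw [fracLaplacian_eq]
  refine Complex.conj_eq_iff_re.1 ?_
  rw [Real.fourierInv_eq, ← integral_conj,
    ← integral_neg_eq_self (fun ξ => Real.fourierChar (inner ℝ ξ x) • ((fracSymbol s ξ : ℂ) * ft φ ξ))]
  congr 1; ext v
  simp only [Circle.smul_def, smul_eq_mul, map_mul, Complex.conj_ofReal, inner_neg_left, conj_ft]
  rw [← Circle.coe_inv_eq_conj, ← AddChar.map_neg_eq_inv]
  simp [fracSymbol]

lemma integrable_fracLaplacian (hd : 0 < d) (hs : 0 < s) (hφ : IsTest φ) :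
    Integrable (fracLaplacian s φ) := by
  obtain ⟨C, hC, hdec⟩ := exists_decay_fracLaplacian hd hs hφ
  have hI : Integrable fun y : EuclideanSpace ℝ (Fin d) => (1 + ‖y‖) ^ (-((d : ℝ) + 2 * s)) :=
    integrable_one_add_norm (by simp; linarith)
  exact (hI.const_mul C).mono' (continuous_fracLaplacian hφ hs).aestronglyMeasurable
    (ae_of_all _ hdec)

/-- The integral is the value at `0` of the Fourier transform `|ξ|^{2s} φ̂(ξ)`. -/
lemma integral_fracLaplacian (hd : 0 < d) (hs : 0 < s) (hφ : IsTest φ) :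
    ∫ x, fracLaplacian s φ x = 0 := by
  set F : EuclideanSpace ℝ (Fin d) → ℂ := fun ξ => (fracSymbol s ξ : ℂ) * ft φ ξ with hF
  have hFi : Integrable F := integrable_fracSymbol_mul_ft hφ hs
  have hFc : Continuous F :=
    (Complex.continuous_ofReal.comp (continuous_fracSymbol hs)).mul hφ.ft_continuous
  have hreal : 𝓕⁻ F = fun x => (fracLaplacian s φ x : ℂ) :=
    funext fun x => (fracLaplacian_ofReal s φ x).symm
  have hi : Integrable (𝓕⁻ F) := by
    rw [hreal]; exact (integrable_fracLaplacian hd hs hφ).ofReal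
  have hi' : Integrable (𝓕 F) := by
    have := hi.comp_neg
    refine this.congr (ae_of_all _ fun x => ?_)
    simp [Real.fourierInv_eq_fourier_neg]
  have h1 := congrFun (hFc.fourier_fourierInv_eq hFi hi') 0
  rw [hreal, Real.fourier_eq] at h1
  simp only [inner_zero_right, neg_zero, AddChar.map_zero_eq_one, one_smul] at h1
  rw [integral_complex_ofReal] at h1
  have h2 : F 0 = 0 := by
    simp [hF, fracSymbol, Real.zero_rpow (by positivity : (2 : ℝ) * s ≠ 0)]
  rw [h2] at h1
  exact_mod_cast h1

end FracLaplacianMeanZero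

/-! ### Riesz potentials -/

section Potential

variable {d : ℕ} {s : ℝ} {T : EuclideanSpace ℝ (Fin d) → ℝ}

/-- The (unnormalized) Riesz potential of order `2s` of `T`. -/
noncomputable def rieszPot (s : ℝ) (T : EuclideanSpace ℝ (Fin d) → ℝ)
    (x : EuclideanSpace ℝ (Fin d)) : ℝ :=
  ∫ y, T y / ‖x - y‖ ^ ((d : ℝ) - 2 * s)

lemma measurable_rieszKernel (a : ℝ) :
    Measurable fun p : EuclideanSpace ℝ (Fin d) × EuclideanSpace ℝ (Fin d) => ‖p.1 - p.2‖ ^ (-a) := by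
  fun_prop

lemma div_kernel_eq (a c : ℝ) (x y : EuclideanSpace ℝ (Fin d)) :
    c / ‖x - y‖ ^ a = ‖x - y‖ ^ (-a) * c := by
  rw [Real.rpow_neg (norm_nonneg _)]; field_simp

/-- Fubini's theorem applies to a Riesz potential integrated against a function with the decay of a
fractional Laplacian. -/
lemma integrable_prod_kernel (hs : 0 < s) (hsd : s < (d : ℝ) / 2) (hTm : AEStronglyMeasurable T volume)
    (hTw : Integrable fun x => T x * (1 + ‖x‖) ^ (-((d : ℝ) - 2 * s)))
    {ψ : EuclideanSpace ℝ (Fin d) → ℝ} (hψ : Continuous ψ) {C : ℝ}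
    (hdec : ∀ x, |ψ x| ≤ C * (1 + ‖x‖) ^ (-((d : ℝ) + 2 * s))) :
    Integrable (Function.uncurry fun x y : EuclideanSpace ℝ (Fin d) =>
      ψ x * (T y / ‖x - y‖ ^ ((d : ℝ) - 2 * s))) (volume.prod volume) := by
  have hd : 0 < d := dim_pos_of_lt_half hs hsd
  set a : ℝ := (d : ℝ) - 2 * s with ha
  set b : ℝ := (d : ℝ) + 2 * s with hb
  obtain ⟨D, hD, hK⟩ := exists_lintegral_weight_le (d := d) (a := a) (b := b) hd
    (by linarith) (by linarith) (by linarith)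
  have hC : 0 ≤ C := by
    have h0 := (abs_nonneg _).trans (hdec 0)
    simpa using h0
  have hki : ∀ y : EuclideanSpace ℝ (Fin d),
      Integrable fun x : EuclideanSpace ℝ (Fin d) => ‖x - y‖ ^ (-a) * (1 + ‖x‖) ^ (-b) := fun y => by
    refine ⟨Measurable.aestronglyMeasurable (by fun_prop), ?_⟩
    rw [hasFiniteIntegral_iff_ofReal (ae_of_all _ fun y => by positivity)]
    exact (hK y).trans_lt ENNReal.ofReal_lt_top
  have hkb : ∀ y : EuclideanSpace ℝ (Fin d),
      ∫ x, ‖x - y‖ ^ (-a) * (1 + ‖x‖) ^ (-b) ≤ D * (1 + ‖y‖) ^ (-a) := fun y => by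
    rw [integral_eq_lintegral_of_nonneg_ae (ae_of_all _ fun y => by positivity)
      (hki y).aestronglyMeasurable]
    exact ENNReal.toReal_le_of_le_ofReal (by positivity) (hK y)
  have hmain : Integrable (fun p : EuclideanSpace ℝ (Fin d) × EuclideanSpace ℝ (Fin d) =>
      (‖p.1 - p.2‖ ^ (-a) * (1 + ‖p.1‖) ^ (-b)) * T p.2) (volume.prod volume) := by
    have hm : AEStronglyMeasurable (fun p : EuclideanSpace ℝ (Fin d) × EuclideanSpace ℝ (Fin d) =>
        (‖p.1 - p.2‖ ^ (-a) * (1 + ‖p.1‖) ^ (-b)) * T p.2) (volume.prod volume) :=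
      (Measurable.aestronglyMeasurable (by fun_prop)).mul hTm.comp_snd
    rw [integrable_prod_iff' hm]
    refine ⟨ae_of_all _ fun y => (hki y).mul_const (T y), ?_⟩
    refine (hTw.norm.const_mul D).mono' hm.norm.prod_swap.integral_prod_right' (ae_of_all _ fun y => ?_)
    rw [Real.norm_of_nonneg (integral_nonneg fun _ => norm_nonneg _)]
    have : ∀ x : EuclideanSpace ℝ (Fin d), ‖(‖x - y‖ ^ (-a) * (1 + ‖x‖) ^ (-b)) * T y‖
        = (‖x - y‖ ^ (-a) * (1 + ‖x‖) ^ (-b)) * ‖T y‖ := fun x => by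
      rw [norm_mul, Real.norm_of_nonneg (by positivity)]
    simp only [this]
    rw [integral_mul_const, norm_mul, Real.norm_of_nonneg (by positivity : 0 ≤ (1 + ‖y‖) ^ (-a))]
    calc _ ≤ (D * (1 + ‖y‖) ^ (-a)) * ‖T y‖ := by gcongr; exact hkb y
      _ = _ := by ring
  refine (hmain.const_mul C).mono ?_ (ae_of_all _ fun p => ?_)
  · refine (hψ.aestronglyMeasurable.comp_fst).mul ?_
    have : AEStronglyMeasurable (fun p : EuclideanSpace ℝ (Fin d) × EuclideanSpace ℝ (Fin d) =>
        ‖p.1 - p.2‖ ^ (-a) * T p.2) (volume.prod volume) :=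
      (measurable_rieszKernel a).aestronglyMeasurable.mul hTm.comp_snd
    refine this.congr (ae_of_all _ fun p => (div_kernel_eq a _ _ _).symm)
  · simp only [Function.uncurry, div_kernel_eq]
    rw [norm_mul, norm_mul, norm_mul, norm_mul, norm_mul, Real.norm_of_nonneg hC,
      Real.norm_of_nonneg (by positivity : 0 ≤ ‖p.1 - p.2‖ ^ (-a)),
      Real.norm_of_nonneg (by positivity : 0 ≤ (1 + ‖p.1‖) ^ (-b))]
    calc ‖ψ p.1‖ * (‖p.1 - p.2‖ ^ (-a) * ‖T p.2‖)
        ≤ (C * (1 + ‖p.1‖) ^ (-b)) * (‖p.1 - p.2‖ ^ (-a) * ‖T p.2‖) := by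
          gcongr; exact hdec p.1
      _ = _ := by ring

lemma integrable_prod_weight_kernel (hs : 0 < s) (hsd : s < (d : ℝ) / 2)
    (hTm : AEStronglyMeasurable T volume)
    (hTw : Integrable fun x => T x * (1 + ‖x‖) ^ (-((d : ℝ) - 2 * s))) :
    Integrable (Function.uncurry fun x y : EuclideanSpace ℝ (Fin d) =>
      (1 + ‖x‖) ^ (-((d : ℝ) + 2 * s)) * (T y / ‖x - y‖ ^ ((d : ℝ) - 2 * s)))
      (volume.prod volume) :=
  integrable_prod_kernel (C := 1) hs hsd hTm hTw
    ((continuous_const.add continuous_norm).rpow_const fun x =>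
      Or.inl (add_pos_of_pos_of_nonneg one_pos (norm_nonneg x)).ne')
    fun x => by rw [one_mul, abs_of_nonneg (by positivity)]

lemma ae_integrable_kernel (hs : 0 < s) (hsd : s < (d : ℝ) / 2) (hTm : AEStronglyMeasurable T volume)
    (hTw : Integrable fun x => T x * (1 + ‖x‖) ^ (-((d : ℝ) - 2 * s))) :
    ∀ᵐ x, Integrable fun y => T y / ‖x - y‖ ^ ((d : ℝ) - 2 * s) := by
  filter_upwards [(integrable_prod_weight_kernel hs hsd hTm hTw).prod_right_ae] with x hx
  have h1 : (1 + ‖x‖) ^ (-((d : ℝ) + 2 * s)) ≠ 0 := by positivity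
  exact (integrable_const_mul_iff (isUnit_iff_ne_zero.2 h1) _).1 hx

lemma integrable_weight_mul_rieszPot (hs : 0 < s) (hsd : s < (d : ℝ) / 2)
    (hTm : AEStronglyMeasurable T volume)
    (hTw : Integrable fun x => T x * (1 + ‖x‖) ^ (-((d : ℝ) - 2 * s))) :
    Integrable fun x => (1 + ‖x‖) ^ (-((d : ℝ) + 2 * s)) * rieszPot s T x := by
  refine (integrable_prod_weight_kernel hs hsd hTm hTw).integral_prod_left.congr
    (ae_of_all _ fun x => ?_)
  simp only [Function.uncurry, rieszPot]
  rw [integral_const_mul]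

/-- Local integrability of `u` is implied by the weighted integrability, the weight being continuous
and positive. -/
lemma memWeightedL1_iff {u : EuclideanSpace ℝ (Fin d) → ℝ} :
    MemWeightedL1 s u ↔ Integrable fun x => (1 + ‖x‖) ^ (-((d : ℝ) + 2 * s)) * u x := by
  have hc : ∀ q : ℝ, Continuous fun x : EuclideanSpace ℝ (Fin d) => (1 + ‖x‖) ^ q := fun q =>
    (continuous_const.add continuous_norm).rpow_const fun x =>
      Or.inl (add_pos_of_pos_of_nonneg one_pos (norm_nonneg x)).ne'
  have he : ∀ x, ‖(1 + ‖x‖) ^ (-((d : ℝ) + 2 * s)) * u x‖ = |u x| / (1 + ‖x‖) ^ ((d : ℝ) + 2 * s) :=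
      fun x => by
    rw [norm_mul, Real.norm_of_nonneg (by positivity), Real.rpow_neg (by positivity), mul_comm]
    rfl
  constructor
  · rintro ⟨h1, h2⟩
    refine h2.mono' ((hc _).aestronglyMeasurable.mul h1.aestronglyMeasurable)
      (ae_of_all _ fun x => (he x).le)
  · intro h
    refine ⟨?_, ?_⟩
    · have h1 := h.locallyIntegrable.continuous_mul (hc ((d : ℝ) + 2 * s))
      have h2 : (fun x => (1 + ‖x‖) ^ ((d : ℝ) + 2 * s) *
          ((1 + ‖x‖) ^ (-((d : ℝ) + 2 * s)) * u x)) = u := by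
        ext x
        rw [← mul_assoc, ← Real.rpow_add (by positivity)]; simp
      rwa [h2] at h1
    · exact h.norm.congr (ae_of_all _ he)

/-- The normalized Riesz potential of `T` solves `(-Δ)^s u = T` in the sense of distributions. -/
lemma integral_rieszPot_mul_fracLaplacian (hs : 0 < s) (hsd : s < (d : ℝ) / 2) (hd : 0 < d)
    (hTm : AEStronglyMeasurable T volume)
    (hTw : Integrable fun x => T x * (1 + ‖x‖) ^ (-((d : ℝ) - 2 * s)))
    {φ : EuclideanSpace ℝ (Fin d) → ℝ} (hφ : IsTest φ) :
    ∫ x, rieszConst d (2 * s) * rieszPot s T x * fracLaplacian s φ x = ∫ x, T x * φ x := by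
  obtain ⟨C, hC, hdec⟩ := exists_decay_fracLaplacian hd hs hφ
  have hint := integrable_prod_kernel hs hsd hTm hTw (continuous_fracLaplacian hφ hs) hdec
  calc ∫ x, rieszConst d (2 * s) * rieszPot s T x * fracLaplacian s φ x
      = rieszConst d (2 * s) * ∫ x, ∫ y, fracLaplacian s φ x * (T y / ‖x - y‖ ^ ((d : ℝ) - 2 * s)) := by
        rw [← integral_const_mul]
        congr 1; ext x
        rw [integral_const_mul, rieszPot]; ring
    _ = rieszConst d (2 * s) * ∫ y, ∫ x, fracLaplacian s φ x * (T y / ‖x - y‖ ^ ((d : ℝ) - 2 * s)) := by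
        rw [integral_integral_swap hint]
    _ = _ := by
        rw [← integral_const_mul]
        congr 1; ext y
        have e : ∫ x, fracLaplacian s φ x * (T y / ‖x - y‖ ^ ((d : ℝ) - 2 * s))
            = T y * ∫ x, ‖x - y‖ ^ (-((d : ℝ) - 2 * s)) * fracLaplacian s φ x := by
          rw [← integral_const_mul]
          congr 1; ext x
          rw [div_kernel_eq]; ring
        rw [e, ← rieszConst_mul_integral_fracLaplacian hd hs hsd hφ y]
        ring

/-- The average of `|u|` over the ring `R < |x - y| < 2R`, up to a dimensional constant, with values
in `[0, ∞]`. -/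
noncomputable def ringMean (u : EuclideanSpace ℝ (Fin d) → ℝ) (x : EuclideanSpace ℝ (Fin d))
    (R : ℝ) : ℝ≥0∞ :=
  (ENNReal.ofReal (R ^ d))⁻¹ *
    ∫⁻ y in {y | R < ‖x - y‖ ∧ ‖x - y‖ < 2 * R}, ENNReal.ofReal |u y|

lemma ring_subset_ball (x : EuclideanSpace ℝ (Fin d)) (R : ℝ) :
    {y | R < ‖x - y‖ ∧ ‖x - y‖ < 2 * R} ⊆ Metric.ball x (2 * R) := fun y hy => by
  rw [mem_ball_iff_norm, norm_sub_rev]; exact hy.2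

lemma measurableSet_ring (x : EuclideanSpace ℝ (Fin d)) (R : ℝ) :
    MeasurableSet {y | R < ‖x - y‖ ∧ ‖x - y‖ < 2 * R} := by
  have h : Measurable fun y => ‖x - y‖ := by fun_prop
  exact (measurableSet_lt measurable_const h).inter (measurableSet_lt h measurable_const)

/-- Ring means of the Riesz potential vanish at infinity. -/
lemma tendsto_ringMean_rieszPot (hs : 0 < s) (hsd : s < (d : ℝ) / 2) (hd : 0 < d)
    (hTm : AEStronglyMeasurable T volume)
    (hTw : Integrable fun x => T x * (1 + ‖x‖) ^ (-((d : ℝ) - 2 * s)))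
    (x : EuclideanSpace ℝ (Fin d)) :
    Tendsto (ringMean (rieszPot s T) x) atTop (nhds 0) := by
  set a : ℝ := (d : ℝ) - 2 * s with ha
  have ha0 : 0 < a := by linarith
  obtain ⟨C, hC, hK⟩ := exists_lintegral_mean_le (d := d) (a := a) hd ha0 (by linarith)
  have hTe : AEMeasurable (fun z => ENNReal.ofReal |T z|) := hTm.norm.aemeasurable.ennreal_ofReal
  have hbound : ∀ R, 0 < R → ringMean (rieszPot s T) x R
      ≤ ∫⁻ z, ENNReal.ofReal |T z| * ENNReal.ofReal (C * (max R ‖z - x‖) ^ (-a)) := fun R hR => by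
    unfold ringMean
    have hRd : ENNReal.ofReal (R ^ d) ≠ 0 := by
      rw [Ne, ENNReal.ofReal_eq_zero, not_le]; positivity
    rw [← ENNReal.div_eq_inv_mul]
    refine ENNReal.div_le_of_le_mul ?_
    calc ∫⁻ y in {y | R < ‖x - y‖ ∧ ‖x - y‖ < 2 * R}, ENNReal.ofReal |rieszPot s T y|
        ≤ ∫⁻ y in Metric.ball x (2 * R), ENNReal.ofReal |rieszPot s T y| :=
          lintegral_mono_set (ring_subset_ball x R)
      _ ≤ ∫⁻ y in Metric.ball x (2 * R), ∫⁻ z, ENNReal.ofReal |T z| * ENNReal.ofReal (‖y - z‖ ^ (-a)) := by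
          refine lintegral_mono fun y => ?_
          rw [← Real.norm_eq_abs, ofReal_norm]
          refine (enorm_integral_le_lintegral_enorm _).trans (le_of_eq (lintegral_congr fun z => ?_))
          rw [← ENNReal.ofReal_mul (abs_nonneg _), ← ofReal_norm, div_kernel_eq, norm_mul,
            Real.norm_of_nonneg (by positivity), mul_comm]
          rfl
      _ = ∫⁻ z, ∫⁻ y in Metric.ball x (2 * R), ENNReal.ofReal |T z| * ENNReal.ofReal (‖y - z‖ ^ (-a)) := by
          refine lintegral_lintegral_swap ?_
          exact hTe.comp_snd.mul (measurable_rieszKernel a).ennreal_ofReal.aemeasurable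
      _ ≤ ∫⁻ z, (ENNReal.ofReal |T z| * ENNReal.ofReal (C * (max R ‖z - x‖) ^ (-a))) *
            ENNReal.ofReal (R ^ d) := by
          refine lintegral_mono fun z => ?_
          rw [lintegral_const_mul' _ _ ENNReal.ofReal_ne_top, mul_assoc, mul_comm (ENNReal.ofReal (C * _))]
          exact mul_le_mul_right (hK x z R hR) _
      _ = _ := lintegral_mul_const' _ _ ENNReal.ofReal_ne_top
  have hlim : Tendsto (fun R : ℝ => ∫⁻ z, ENNReal.ofReal |T z| *
      ENNReal.ofReal (C * (max R ‖z - x‖) ^ (-a))) atTop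
      (nhds (∫⁻ _ : EuclideanSpace ℝ (Fin d), 0)) := by
    refine tendsto_lintegral_filter_of_dominated_convergence'
      (fun z => ENNReal.ofReal (C * (2 + ‖x‖) ^ a) * ENNReal.ofReal |T z * (1 + ‖z‖) ^ (-a)|)
      (Eventually.of_forall fun R => ?_) ?_ ?_ (ae_of_all _ fun z => ?_)
    · refine hTe.mul (Measurable.aemeasurable ?_)
      fun_prop
    · filter_upwards [eventually_ge_atTop (1 : ℝ)] with R hR
      refine ae_of_all _ fun z => ?_
      rw [← ENNReal.ofReal_mul (abs_nonneg _), ← ENNReal.ofReal_mul (by positivity)]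
      refine ENNReal.ofReal_le_ofReal ?_
      have h1 : 1 + ‖z‖ ≤ (2 + ‖x‖) * max R ‖z - x‖ := by
        have h2 := norm_add_le (z - x) x
        rw [sub_add_cancel] at h2
        have h3 := le_max_left R ‖z - x‖
        have h4 := le_max_right R ‖z - x‖
        have h5 := norm_nonneg x
        nlinarith
      have hmp : 0 < max R ‖z - x‖ := lt_max_of_lt_left (by linarith)
      have h6 := Real.rpow_le_rpow_of_nonpos (by positivity) h1 (by linarith : -a ≤ 0)
      rw [Real.mul_rpow (by positivity) hmp.le, Real.rpow_neg (by positivity : 0 ≤ 2 + ‖x‖),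
        inv_mul_le_iff₀ (by positivity)] at h6
      rw [abs_mul, abs_of_nonneg (by positivity : 0 ≤ (1 + ‖z‖) ^ (-a))]
      calc |T z| * (C * max R ‖z - x‖ ^ (-a)) ≤ |T z| * (C * ((2 + ‖x‖) ^ a * (1 + ‖z‖) ^ (-a))) := by
            gcongr
        _ = _ := by ring
    · rw [lintegral_const_mul' _ _ ENNReal.ofReal_ne_top]
      refine ENNReal.mul_ne_top ENNReal.ofReal_ne_top ?_
      have := hTw.2
      rw [hasFiniteIntegral_iff_norm] at this
      exact this.ne
    · have h1 : Tendsto (fun R : ℝ => C * (max R ‖z - x‖) ^ (-a)) atTop (nhds (C * 0)) := by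
        refine Tendsto.const_mul _ ((tendsto_rpow_neg_atTop ha0).comp ?_)
        exact tendsto_atTop_mono (fun R => le_max_left _ _) tendsto_id
      have h2 := ENNReal.Tendsto.const_mul (a := ENNReal.ofReal |T z|)
        (ENNReal.tendsto_ofReal h1) (Or.inr ENNReal.ofReal_ne_top)
      simpa using h2
  rw [lintegral_zero] at hlim
  refine tendsto_of_tendsto_of_tendsto_of_le_of_le' tendsto_const_nhds hlim
    (Eventually.of_forall fun _ => zero_le) ?_
  filter_upwards [eventually_gt_atTop (0 : ℝ)] with R hR using hbound R hR

end Potential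

/-! ### Solutions of the homogeneous equation are annihilated by high derivatives -/

section Liouville

variable {d : ℕ} {s t : ℝ} {φ ψ f : EuclideanSpace ℝ (Fin d) → ℝ}

lemma IsTest.ext_ft (hφ : IsTest φ) (hψ : IsTest ψ) (h : ∀ ξ, ft φ ξ = ft ψ ξ) : φ = ψ := by
  ext x
  have := hφ.fourierInv_ft x
  rw [funext h, hψ.fourierInv_ft x] at this
  exact_mod_cast this.symm

lemma ft_iterate_dirDeriv (h : IsTest φ) (v : EuclideanSpace ℝ (Fin d)) (n : ℕ)
    (ξ : EuclideanSpace ℝ (Fin d)) :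
    ft ((dirDeriv v)^[n] φ) ξ = (2 * Real.pi * Complex.I * (inner ℝ v ξ : ℝ)) ^ n * ft φ ξ := by
  induction n with
  | zero => simp
  | succ n ih =>
    rw [Function.iterate_succ_apply', ft_dirDeriv (h.iterate_dirDeriv v n), ih]
    ring

lemma ft_const_mul (c : ℝ) (φ : EuclideanSpace ℝ (Fin d) → ℝ) (ξ : EuclideanSpace ℝ (Fin d)) :
    ft (fun x => c * φ x) ξ = c * ft φ ξ := by
  unfold ft
  simp only [Real.fourier_eq, ← integral_const_mul]
  congr 1; ext v
  simp only [Circle.smul_def, smul_eq_mul]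
  push_cast; ring

lemma fracLaplacian_const_mul (s c : ℝ) (φ : EuclideanSpace ℝ (Fin d) → ℝ)
    (x : EuclideanSpace ℝ (Fin d)) :
    fracLaplacian s (fun x => c * φ x) x = c * fracLaplacian s φ x := by
  rw [fracLaplacian_eq, fracLaplacian_eq, ← Complex.re_ofReal_mul]
  congr 1
  simp only [ft_const_mul, Real.fourierInv_eq, ← integral_const_mul]
  congr 1; ext v
  simp only [Circle.smul_def, smul_eq_mul]
  ring

lemma fracLaplacian_dil (ht : 0 < t) (φ : EuclideanSpace ℝ (Fin d) → ℝ)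
    (x : EuclideanSpace ℝ (Fin d)) :
    fracLaplacian s (dil t φ) x = t ^ (-(2 * s)) * dil t (fracLaplacian s φ) x := by
  have h1 := fourierInv_comp_smul (F := fun ξ => (fracSymbol s ξ : ℂ) * ft φ ξ) ht x
  have e : (fun ξ => (fracSymbol s ξ : ℂ) * ft (dil t φ) ξ) = fun ξ =>
      ((t ^ (-(2 * s)) : ℝ) : ℂ) * ((fracSymbol s (t • ξ) : ℂ) * ft φ (t • ξ)) := by
    ext ξ
    rw [ft_dil ht, fracSymbol_smul ht.le, Real.rpow_neg ht.le]
    have : ((t ^ (2 * s) : ℝ) : ℂ) ≠ 0 := by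
      exact_mod_cast (Real.rpow_pos_of_pos ht _).ne'
    push_cast
    field_simp
  have h2 : 𝓕⁻ (fun ξ => (fracSymbol s ξ : ℂ) * ft (dil t φ) ξ) x = ((t ^ (-(2 * s)) : ℝ) : ℂ) *
      𝓕⁻ (fun ξ => (fracSymbol s (t • ξ) : ℂ) * ft φ (t • ξ)) x := by
    rw [e]
    simp only [Real.fourierInv_eq, ← integral_const_mul]
    congr 1; ext v
    simp only [Circle.smul_def, smul_eq_mul]
    ring
  rw [fracLaplacian_eq, h2, h1, Complex.re_ofReal_mul, Complex.re_ofReal_mul]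
  rfl

/-- Averaging a derivative at scale `t` gains a factor `t^{-1}` for each derivative. -/
lemma avg_iterate_dirDeriv (hf : IsTest f) (ht : 0 < t) (v : EuclideanSpace ℝ (Fin d)) (n : ℕ) :
    avg t ((dirDeriv v)^[n] f)
      = fun x => (t ^ n)⁻¹ * conv f (dil t ((dirDeriv v)^[n] (radialBump d))) x := by
  have hG := (isTest_radialBump (d := d)).iterate_dirDeriv v n
  refine ((hf.iterate_dirDeriv v n).avg ht).ext_ft ((hf.conv (hG.dil ht)).const_mul _) fun ξ => ?_
  unfold avg
  rw [ft_conv (isTest_radialBump.dil ht).integrable (hf.iterate_dirDeriv v n).integrable, ft_dil ht,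
    ft_iterate_dirDeriv hf, ft_const_mul, ft_conv hf.integrable (hG.dil ht).integrable, ft_dil ht,
    ft_iterate_dirDeriv isTest_radialBump, inner_smul_right]
  have : (t : ℂ) ≠ 0 := by exact_mod_cast ht.ne'
  push_cast
  field_simp
  simp only [mul_pow]
  ring

lemma rpow_neg_le_of_le_mul {b C u r : ℝ} (hb : 0 < b) (hC : 0 < C) (hr : 0 < r) (h : r ≤ C * u) :
    u ^ (-b) ≤ C ^ b * r ^ (-b) := by
  have hu : 0 < u := pos_of_mul_pos_right (hr.trans_le h) hC.le
  have h1 := Real.rpow_le_rpow_of_nonpos hr h (by linarith : -b ≤ 0)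
  rwa [Real.mul_rpow hC.le hu.le, Real.rpow_neg hC.le, inv_mul_le_iff₀ (by positivity)] at h1

/-- Averages at scales `t ≤ 1` preserve the decay of a fractional Laplacian. -/
lemma exists_bound_small_scale (hd : 0 < d) (hs : 0 < s) (hf : IsTest f) :
    ∃ C, 0 ≤ C ∧ ∀ t, 0 < t → t ≤ 1 → ∀ x,
      |fracLaplacian s (avg t (avg t f)) x| ≤ C * (1 + ‖x‖) ^ (-((d : ℝ) + 2 * s)) := by
  obtain ⟨C, hC, hdec⟩ := exists_decay_fracLaplacian hd hs hf
  set b : ℝ := (d : ℝ) + 2 * s with hb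
  have hb0 : 0 < b := by positivity
  have key : ∀ (D : ℝ) (g : EuclideanSpace ℝ (Fin d) → ℝ), 0 ≤ D →
      (∀ x, |g x| ≤ D * (1 + ‖x‖) ^ (-b)) → ∀ t, 0 < t → t ≤ 1 → ∀ x,
      |avg t g x| ≤ (D * 2 ^ b) * (1 + ‖x‖) ^ (-b) := fun D g hD hg t ht ht1 x => by
    refine abs_avg_le ht fun y hy => (hg _).trans ?_
    rw [mul_assoc]
    refine mul_le_mul_of_nonneg_left (rpow_neg_le_of_le_mul hb0 two_pos (by positivity) ?_) hD
    have := norm_sub_norm_le x y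
    have := norm_nonneg (x - y)
    linarith
  refine ⟨C * 2 ^ b * 2 ^ b, by positivity, fun t ht ht1 x => ?_⟩
  have hk := (isTest_radialBump (d := d)).dil ht
  have e : fracLaplacian s (avg t (avg t f)) = avg t (avg t (fracLaplacian s f)) := by
    unfold avg
    rw [fracLaplacian_conv hs hk.integrable (hk.conv hf), fracLaplacian_conv hs hk.integrable hf]
  rw [e]
  exact key _ _ (by positivity) (key _ _ hC hdec t ht ht1) t ht ht1 x

/-- At scales `t ≥ 1` the derivatives fall on the averaging density. The fractional Laplacian then
has the size `t^{-n-d-2s} (1 + |x|/t)^{-d-2s}`, in which the powers of `t` other than `t^{-n}`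
cancel. -/
lemma exists_bound_large_scale (hd : 0 < d) (hs : 0 < s) (hf : IsTest f)
    (v : EuclideanSpace ℝ (Fin d)) (n : ℕ) :
    ∃ C, 0 ≤ C ∧ ∀ t, 1 ≤ t → ∀ x,
      |fracLaplacian s (avg t (avg t ((dirDeriv v)^[n] f))) x|
        ≤ C * (t ^ n)⁻¹ * (1 + ‖x‖) ^ (-((d : ℝ) + 2 * s)) := by
  have hG := (isTest_radialBump (d := d)).iterate_dirDeriv v n
  obtain ⟨C, hC, hdec⟩ := exists_decay_fracLaplacian hd hs hG
  obtain ⟨ρ, hρ1, hρ⟩ := hf.exists_support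
  set b : ℝ := (d : ℝ) + 2 * s with hb
  have hb0 : 0 < b := by positivity
  set I := ∫ y, |f y| with hI
  have hI0 : 0 ≤ I := integral_nonneg fun _ => abs_nonneg _
  refine ⟨I * C * (1 + ρ) ^ b * 2 ^ b, by positivity, fun t ht1 x => ?_⟩
  have ht : 0 < t := by linarith
  have hk := (isTest_radialBump (d := d)).dil ht
  have hfn := hf.iterate_dirDeriv v n
  have e1 : fracLaplacian s (avg t (avg t ((dirDeriv v)^[n] f)))
      = avg t (fracLaplacian s (avg t ((dirDeriv v)^[n] f))) := by
    conv_lhs => unfold avg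
    rw [fracLaplacian_conv hs hk.integrable (hk.conv hfn)]
    rfl
  have e2 : fracLaplacian s (avg t ((dirDeriv v)^[n] f)) = fun x => (t ^ n)⁻¹ *
      conv f (fun y => t ^ (-(2 * s)) * dil t (fracLaplacian s ((dirDeriv v)^[n] (radialBump d))) y) x := by
    rw [avg_iterate_dirDeriv hf ht]
    ext y
    rw [fracLaplacian_const_mul, fracLaplacian_conv hs hf.integrable (hG.dil ht),
      funext (fracLaplacian_dil ht _)]
  have hpow : t ^ (-(2 * s)) * (t ^ d)⁻¹ = t ^ (-b) := by
    rw [← Real.rpow_natCast, ← Real.rpow_neg ht.le, ← Real.rpow_add ht]; congr 1; rw [hb]; ring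
  have h1 : ∀ z, |fracLaplacian s (avg t ((dirDeriv v)^[n] f)) z|
      ≤ (t ^ n)⁻¹ * (t ^ (-b) * (I * C * (1 + ρ) ^ b)) * (1 + t⁻¹ * ‖z‖) ^ (-b) := fun z => by
    rw [e2]
    simp only
    rw [abs_mul, abs_of_nonneg (by positivity : 0 ≤ (t ^ n)⁻¹), mul_assoc]
    refine mul_le_mul_of_nonneg_left ?_ (by positivity)
    have hb' : ∀ y, ‖f y * (t ^ (-(2 * s)) *
        dil t (fracLaplacian s ((dirDeriv v)^[n] (radialBump d))) (z - y))‖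
        ≤ |f y| * (t ^ (-b) * (C * ((1 + ρ) ^ b * (1 + t⁻¹ * ‖z‖) ^ (-b)))) := fun y => by
      by_cases hy : ρ ≤ ‖y‖
      · simp [hρ y hy]
      · rw [not_le] at hy
        rw [norm_mul]
        refine mul_le_mul_of_nonneg_left ?_ (abs_nonneg _)
        unfold dil
        rw [← mul_assoc, hpow, norm_mul, Real.norm_of_nonneg (by positivity)]
        refine mul_le_mul_of_nonneg_left ((hdec _).trans ?_) (by positivity)
        refine mul_le_mul_of_nonneg_left (rpow_neg_le_of_le_mul hb0 (by positivity) (by positivity) ?_) hC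
        rw [norm_smul, norm_inv, Real.norm_of_nonneg ht.le]
        have h2 := norm_sub_norm_le z y
        have h3 : t⁻¹ * ‖z‖ ≤ t⁻¹ * (‖z - y‖ + ρ) := by gcongr; linarith
        have h4 : t⁻¹ * ρ ≤ ρ := by
          have : t⁻¹ ≤ 1 := inv_le_one_of_one_le₀ ht1
          nlinarith
        have h5 : 0 ≤ t⁻¹ * ‖z - y‖ := by positivity
        nlinarith
    have := norm_integral_le_of_norm_le (hf.integrable.abs.mul_const _) (ae_of_all _ hb')
    rw [integral_mul_const] at this
    refine this.trans (le_of_eq ?_)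
    rw [← hI]; ring
  rw [e1]
  have h2 : |avg t (fracLaplacian s (avg t ((dirDeriv v)^[n] f))) x|
      ≤ (t ^ n)⁻¹ * (t ^ (-b) * (I * C * (1 + ρ) ^ b)) * (2 ^ b * (t ^ b * (1 + ‖x‖) ^ (-b))) := by
    refine abs_avg_le ht fun y hy => (h1 _).trans ?_
    refine mul_le_mul_of_nonneg_left ?_ (by positivity)
    have h3 : (t⁻¹ * (1 + ‖x‖)) ^ (-b) = t ^ b * (1 + ‖x‖) ^ (-b) := by
      rw [Real.mul_rpow (by positivity) (by positivity), Real.inv_rpow ht.le, Real.rpow_neg ht.le,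
        inv_inv]
    rw [← h3]
    refine rpow_neg_le_of_le_mul hb0 two_pos (by positivity) ?_
    have h4 := norm_sub_norm_le x y
    have h5 : t⁻¹ * ‖x‖ ≤ t⁻¹ * (‖x - y‖ + t) := by gcongr; linarith
    have h6 : t⁻¹ ≤ 1 := inv_le_one_of_one_le₀ ht1
    have h7 : t⁻¹ * t = 1 := inv_mul_cancel₀ ht.ne'
    have h8 : 0 ≤ t⁻¹ * ‖x - y‖ := by positivity
    nlinarith
  refine h2.trans (le_of_eq ?_)
  have h9 : t ^ (-b) * t ^ b = 1 := by rw [← Real.rpow_add ht]; simp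
  linear_combination ((t ^ n)⁻¹ * I * C * (1 + ρ) ^ b * 2 ^ b * (1 + ‖x‖) ^ (-b)) * h9

/-- A Calderón reproducing formula through fractional Laplacians of test functions. Averaging twice
makes the multiplier `g(t|ξ|)²` nonnegative, hence `c > 0`. -/
lemma exists_calderon (hd : 0 < d) (hs : 0 < s) :
    ∃ c : ℝ, 0 < c ∧ ∀ f : EuclideanSpace ℝ (Fin d) → ℝ, IsTest f → ∀ x,
      ∫ t in Set.Ioi (0 : ℝ), t ^ (2 * s - 1) * fracLaplacian s (avg t (avg t f)) x = c * f x := by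
  obtain ⟨g, hgc, hg, hg1, hgl, hgd⟩ := exists_radialBump_profile hd
  obtain ⟨N, hN⟩ := exists_nat_gt (2 * s)
  obtain ⟨B, hB, hgB⟩ := hgd N
  have hc : Continuous fun u => g u ^ 2 := by fun_prop
  have hcont := continuousOn_rpow_mul hc (2 * s - 1)
  have hi : IntegrableOn (fun u : ℝ => u ^ (2 * s - 1) * g u ^ 2) (Set.Ioi 0) := by
    refine integrableOn_Ioi_of_bounds hcont (a := 2 * s - 1) (b := 2 * s - 1 - N)
      (A := 1) (B := B) (by linarith) (by linarith) (fun u hu _ => ?_) (fun u hu => ?_)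
    · rw [abs_mul, abs_pow, abs_of_nonneg (by positivity), one_mul]
      exact mul_le_of_le_one_right (by positivity) (pow_le_one₀ (abs_nonneg _) (hg1 u))
    · have hu0 : 0 < u := by linarith
      rw [abs_mul, abs_pow, abs_of_nonneg (by positivity), Real.rpow_sub hu0 (2 * s - 1),
        Real.rpow_natCast]
      have h1 : u ^ N * |g u| ≤ B := le_trans (by gcongr; linarith) (hgB u hu0.le)
      have h2 : |g u| ^ 2 ≤ |g u| := by nlinarith [abs_nonneg (g u), hg1 u]
      rw [mul_div_assoc', le_div_iff₀ (by positivity)]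
      calc u ^ (2 * s - 1) * |g u| ^ 2 * u ^ N ≤ u ^ (2 * s - 1) * |g u| * u ^ N := by gcongr
        _ = u ^ (2 * s - 1) * (u ^ N * |g u|) := by ring
        _ ≤ u ^ (2 * s - 1) * B := by gcongr
        _ = _ := by ring
  have hpos : 0 < ∫ u in Set.Ioi (0 : ℝ), u ^ (2 * s - 1) * g u ^ 2 := by
    refine setIntegral_Ioi_pos hcont hi (fun u hu => by positivity) (u₀ := 1 / 8) (by norm_num) ?_
    have h1 := hgl (1 / 8)
    rw [abs_of_pos (by norm_num : (0 : ℝ) < 1 / 8)] at h1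
    have h2 : g (1 / 8) ≠ 0 := fun h0 => by
      rw [h0, sub_zero, abs_one] at h1
      linarith [Real.pi_lt_four]
    positivity
  refine ⟨(∫ u in Set.Ioi (0 : ℝ), u ^ (2 * s - 1) * g u ^ 2) * (2 * Real.pi) ^ (2 * s),
    by positivity, fun f hf x => ?_⟩
  obtain ⟨hF', hinv⟩ := integrable_norm_rpow_mul_fracSymbol_mul_ft (s := s) hd hf
  have hm := integral_rpow_mul_re_fourierInv hc hi hd (integrable_fracSymbol_mul_ft hf hs) hF' x
  rw [hinv x, ← mul_assoc] at hm
  rw [← hm]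
  refine setIntegral_congr_fun measurableSet_Ioi fun t ht => ?_
  have e : (fun ξ => (fracSymbol s ξ : ℂ) * ft (avg t (avg t f)) ξ)
      = fun ξ => ((g (t * ‖ξ‖) ^ 2 : ℝ) : ℂ) * ((fracSymbol s ξ : ℂ) * ft f ξ) := by
    ext ξ
    rw [ft_avg hg (hf.avg ht) ht, ft_avg hg hf ht]
    push_cast; ring
  rw [fracLaplacian_eq, e]

lemma aestronglyMeasurable_fracLaplacian_avg (hd : 0 < d) (hs : 0 < s) (hf : IsTest f) :
    AEStronglyMeasurable (fun p : ℝ × EuclideanSpace ℝ (Fin d) =>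
      fracLaplacian s (avg p.1 (avg p.1 f)) p.2) ((volume.restrict (Set.Ioi 0)).prod volume) := by
  obtain ⟨g, hgc, hg, -⟩ := exists_radialBump_profile hd
  have hc : Continuous fun q : (ℝ × EuclideanSpace ℝ (Fin d)) × EuclideanSpace ℝ (Fin d) =>
      ((Real.fourierChar (inner ℝ q.2 q.1.2) : Circle) : ℂ) *
        (((g (q.1.1 * ‖q.2‖) ^ 2 : ℝ) : ℂ) * ((fracSymbol s q.2 : ℂ) * ft f q.2)) := by
    refine (continuous_subtype_val.comp (Real.continuous_fourierChar.comp (by fun_prop))).mul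
      (Continuous.mul (by fun_prop) (Continuous.mul ?_ ?_))
    · exact Complex.continuous_ofReal.comp ((continuous_fracSymbol hs).comp continuous_snd)
    · exact hf.ft_continuous.comp continuous_snd
  have h1 := hc.stronglyMeasurable.integral_prod_right'
    (ν := (volume : Measure (EuclideanSpace ℝ (Fin d))))
  have h2 := (Complex.measurable_re.comp h1.measurable).aestronglyMeasurable
    (μ := (volume.restrict (Set.Ioi 0)).prod volume)
  refine h2.congr ?_
  have h3 : ∀ᵐ p : ℝ × EuclideanSpace ℝ (Fin d)
      ∂((volume.restrict (Set.Ioi 0)).prod volume), 0 < p.1 :=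
    Measure.quasiMeasurePreserving_fst.ae (ae_restrict_mem measurableSet_Ioi)
  filter_upwards [h3] with p hp
  rw [Function.comp_apply, fracLaplacian_eq, Real.fourierInv_eq]
  congr 2
  ext ξ
  rw [ft_avg hg (hf.avg hp) hp, ft_avg hg hf hp, Circle.smul_def, smul_eq_mul]
  push_cast; ring

/-- A solution of `(-Δ)^s w = 0` in the weighted space is annihilated by all directional derivatives
of order larger than `2s`. -/
lemma integral_mul_iterate_dirDeriv_eq_zero (hd : 0 < d) (hs : 0 < s)
    {w : EuclideanSpace ℝ (Fin d) → ℝ}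
    (hw : Integrable fun x => (1 + ‖x‖) ^ (-((d : ℝ) + 2 * s)) * w x)
    (hsol : ∀ φ, IsTest φ → ∫ x, w x * fracLaplacian s φ x = 0)
    {n : ℕ} (hn : 2 * s < n) (v : EuclideanSpace ℝ (Fin d)) (hf : IsTest f) :
    ∫ x, w x * (dirDeriv v)^[n] f x = 0 := by
  obtain ⟨c, hc, hcal⟩ := exists_calderon (d := d) hd hs
  have hfn := hf.iterate_dirDeriv v n
  obtain ⟨C₁, hC₁, hb₁⟩ := exists_bound_small_scale hd hs hfn
  obtain ⟨C₂, hC₂, hb₂⟩ := exists_bound_large_scale hd hs hf v n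
  set F := (dirDeriv v)^[n] f with hF
  set b : ℝ := (d : ℝ) + 2 * s with hb
  have hwm : AEStronglyMeasurable w volume :=
    (memWeightedL1_iff.2 hw).1.aestronglyMeasurable
  -- an integrable majorant in the scale variable
  set η : ℝ → ℝ := fun t => t ^ (2 * s - 1) * (max 1 t ^ n)⁻¹ with hη
  have hηc : ContinuousOn η (Set.Ioi 0) := by
    refine continuousOn_rpow_mul (h := fun t => (max 1 t ^ n)⁻¹) ?_ _
    refine Continuous.inv₀ (by fun_prop) fun t => ?_
    have : (0 : ℝ) < max 1 t := lt_max_of_lt_left one_pos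
    positivity
  have hηi : IntegrableOn η (Set.Ioi 0) := by
    refine integrableOn_Ioi_of_bounds hηc (a := 2 * s - 1) (b := 2 * s - 1 - n) (A := 1) (B := 1)
      (by linarith) (by linarith) (fun u hu hu1 => ?_) (fun u hu => ?_)
    · simp only [hη, max_eq_left hu1, one_pow, inv_one, mul_one, one_mul]
      rw [abs_of_nonneg (by positivity)]
    · have hu0 : 0 < u := by linarith
      simp only [hη, max_eq_right hu.le, one_mul]
      rw [abs_of_nonneg (by positivity), Real.rpow_sub hu0 (2 * s - 1), Real.rpow_natCast]
      rfl
  have hint : Integrable (Function.uncurry fun (t : ℝ) (x : EuclideanSpace ℝ (Fin d)) =>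
      w x * (t ^ (2 * s - 1) * fracLaplacian s (avg t (avg t F)) x))
      ((volume.restrict (Set.Ioi 0)).prod volume) := by
    have hdom := (Integrable.mul_prod hηi hw.norm).const_mul (C₁ + C₂)
    refine hdom.mono' ?_ ?_
    · refine hwm.comp_snd.mul (AEStronglyMeasurable.mul ?_
        (aestronglyMeasurable_fracLaplacian_avg hd hs hfn))
      exact (measurable_fst.pow_const _).aestronglyMeasurable
    · have h3 : ∀ᵐ p : ℝ × EuclideanSpace ℝ (Fin d)
          ∂((volume.restrict (Set.Ioi 0)).prod volume), 0 < p.1 :=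
        Measure.quasiMeasurePreserving_fst.ae (ae_restrict_mem measurableSet_Ioi)
      filter_upwards [h3] with ⟨t, x⟩ ht
      simp only at ht
      have hL : |fracLaplacian s (avg t (avg t F)) x|
          ≤ (C₁ + C₂) * (max 1 t ^ n)⁻¹ * (1 + ‖x‖) ^ (-b) := by
        rcases le_total t 1 with h1 | h1
        · rw [max_eq_left h1, one_pow, inv_one, mul_one]
          refine (hb₁ t ht h1 x).trans ?_
          gcongr; linarith
        · rw [max_eq_right h1]
          refine (hb₂ t h1 x).trans ?_
          gcongr; linarith
      simp only [Function.uncurry, hη]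
      rw [norm_mul, norm_mul, norm_mul, Real.norm_of_nonneg (by positivity : 0 ≤ t ^ (2 * s - 1)),
        Real.norm_of_nonneg (by positivity : 0 ≤ (1 + ‖x‖) ^ (-b))]
      calc ‖w x‖ * (t ^ (2 * s - 1) * ‖fracLaplacian s (avg t (avg t F)) x‖)
          ≤ ‖w x‖ * (t ^ (2 * s - 1) * ((C₁ + C₂) * (max 1 t ^ n)⁻¹ * (1 + ‖x‖) ^ (-b))) := by
            gcongr; exact hL
        _ = _ := by ring
  have h1 := integral_integral_swap hint
  have h2 : ∀ t ∈ Set.Ioi (0 : ℝ),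
      ∫ x, w x * (t ^ (2 * s - 1) * fracLaplacian s (avg t (avg t F)) x) = 0 := fun t ht => by
    have h3 := hsol _ ((hfn.avg ht).avg ht)
    have h4 : ∀ x, w x * (t ^ (2 * s - 1) * fracLaplacian s (avg t (avg t F)) x)
        = t ^ (2 * s - 1) * (w x * fracLaplacian s (avg t (avg t F)) x) := fun x => by ring
    simp only [h4]
    rw [integral_const_mul, h3, mul_zero]
  rw [setIntegral_congr_fun measurableSet_Ioi h2, integral_zero] at h1
  have h5 : ∀ x, ∫ t in Set.Ioi (0 : ℝ), w x * (t ^ (2 * s - 1) * fracLaplacian s (avg t (avg t F)) x)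
      = c * (w x * F x) := fun x => by
    rw [integral_const_mul, hcal F hfn x]; ring
  simp only [h5] at h1
  rw [integral_const_mul] at h1
  exact (mul_eq_zero.1 h1.symm).resolve_left hc.ne'

end Liouville

/-! ### Polynomials in one variable -/

section PolynomialGrowth

lemma Polynomial.eq_zero_of_frequently_le {Q : Polynomial ℝ} {A : ℝ}
    (h : ∃ᶠ R : ℝ in atTop, |Q.eval R| * R ≤ A) : Q = 0 := by
  by_contra hQ
  have hdeg : 0 < (Q * Polynomial.X).degree := by
    rw [Polynomial.degree_mul_X, Polynomial.degree_eq_natDegree hQ]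
    exact_mod_cast Nat.succ_pos _
  have h1 := Polynomial.abs_tendsto_atTop (Q * Polynomial.X) hdeg
  obtain ⟨R, hR1, hR2, hR3⟩ := (h.and_eventually ((h1.eventually_gt_atTop A).and
    (eventually_ge_atTop (0 : ℝ)))).exists
  rw [Polynomial.eval_mul, Polynomial.eval_X, abs_mul, abs_of_nonneg hR3] at hR2
  linarith

/-- A function whose derivative is a polynomial of degree `< n` is a polynomial of degree
`< n + 1`. -/
lemma exists_polynomial_of_hasDerivAt {F : ℝ → ℝ} {p : Polynomial ℝ} {n : ℕ} (hp : p.degree < n)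
    (hF : ∀ τ, HasDerivAt F (p.eval τ) τ) :
    ∃ q : Polynomial ℝ, q.degree < (n + 1 : ℕ) ∧ ∀ τ, F τ = q.eval τ := by
  let q₀ : Polynomial ℝ := ∑ i ∈ Finset.range n,
    Polynomial.C (p.coeff i / (i + 1)) * Polynomial.X ^ (i + 1)
  have hq₀ : q₀.degree < (n + 1 : ℕ) := by
    refine (Polynomial.degree_sum_le _ _).trans_lt ?_
    rw [Finset.sup_lt_iff (by exact WithBot.bot_lt_coe _)]
    intro i hi
    refine (Polynomial.degree_C_mul_X_pow_le _ _).trans_lt ?_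
    have := Finset.mem_range.1 hi
    exact_mod_cast Nat.succ_lt_succ this
  have hder : q₀.derivative = p := by
    have h1 : ∀ i : ℕ, p.coeff i / ((i : ℝ) + 1) * ((i + 1 : ℕ) : ℝ) = p.coeff i := fun i => by
      push_cast; exact div_mul_cancel₀ _ (by positivity)
    ext k
    simp only [q₀, Polynomial.derivative_sum, Polynomial.derivative_C_mul_X_pow, h1,
      Nat.add_sub_cancel, Polynomial.finsetSum_coeff, Polynomial.coeff_C_mul_X_pow,
      Finset.sum_ite_eq, Finset.mem_range]
    split_ifs with hk
    · rfl
    · refine (Polynomial.coeff_eq_zero_of_degree_lt (hp.trans_le ?_)).symm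
      exact_mod_cast not_lt.1 hk
  have hconst : ∀ τ, F τ - q₀.eval τ = F 0 - q₀.eval 0 := by
    have hd : ∀ τ, HasDerivAt (fun τ => F τ - q₀.eval τ) 0 τ := fun τ => by
      have := (hF τ).sub (q₀.hasDerivAt τ)
      rwa [hder, sub_self] at this
    exact fun τ => is_const_of_deriv_eq_zero (fun τ => (hd τ).differentiableAt)
      (fun τ => (hd τ).deriv) τ 0
  refine ⟨q₀ + Polynomial.C (F 0 - q₀.eval 0), ?_, fun τ => ?_⟩
  · refine (Polynomial.degree_add_le _ _).trans_lt (max_lt hq₀ ?_)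
    exact Polynomial.degree_C_le.trans_lt (by exact_mod_cast Nat.succ_pos n)
  · rw [Polynomial.eval_add, Polynomial.eval_C, ← hconst τ]; ring

end PolynomialGrowth

/-! ### Constancy from the ring condition -/

section RingCondition

variable {d : ℕ} {w f g : EuclideanSpace ℝ (Fin d) → ℝ}

lemma hasDerivAt_conv_line (hw : LocallyIntegrable w volume) (hg : IsTest g)
    (x v : EuclideanSpace ℝ (Fin d)) (τ : ℝ) :
    HasDerivAt (fun τ : ℝ => conv w g (x + τ • v)) (conv w (dirDeriv v g) (x + τ • v)) τ := by
  have h1 := hg.hasCompactSupport.hasFDerivAt_convolution_right (ContinuousLinearMap.mul ℝ ℝ) hw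
    (hg.contDiff.of_le (by simp)) (x + τ • v)
  have h2 : HasDerivAt (fun τ : ℝ => x + τ • v) v τ := by
    simpa using ((hasDerivAt_id τ).smul_const v).const_add x
  have h3 := h1.comp_hasDerivAt τ h2
  rw [convolution_precompR_apply _ hw (hg.hasCompactSupport.fderiv ℝ)
    (hg.contDiff.continuous_fderiv (by simp))] at h3
  exact h3

lemma continuous_conv (hw : LocallyIntegrable w volume) (hg : IsTest g) : Continuous (conv w g) :=
  hg.hasCompactSupport.continuous_convolution_right (ContinuousLinearMap.mul ℝ ℝ) hw hg.continuous

lemma exists_polynomial_conv_line (hw : LocallyIntegrable w volume) (x v : EuclideanSpace ℝ (Fin d))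
    (n : ℕ) (hg : IsTest g) (hzero : ∀ y, conv w ((dirDeriv v)^[n] g) y = 0) :
    ∃ p : Polynomial ℝ, p.degree < n ∧ ∀ τ : ℝ, conv w g (x + τ • v) = p.eval τ := by
  induction n generalizing g with
  | zero => exact ⟨0, by simp, fun τ => by simpa using hzero (x + τ • v)⟩
  | succ n ih =>
    obtain ⟨p, hp, hpe⟩ := ih (hg.dirDeriv v) fun y => by
      rw [← Function.iterate_succ_apply]; exact hzero y
    refine exists_polynomial_of_hasDerivAt hp fun τ => ?_
    rw [← hpe τ]
    exact hasDerivAt_conv_line hw hg x v τ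

lemma iterate_dirDeriv_comp_sub (hg : IsTest g) (x v : EuclideanSpace ℝ (Fin d)) (n : ℕ) :
    (dirDeriv (-v))^[n] (fun y => g (x - y)) = fun y => (dirDeriv v)^[n] g (x - y) := by
  induction n with
  | zero => rfl
  | succ n ih =>
    rw [Function.iterate_succ_apply', ih]
    ext y
    rw [Function.iterate_succ_apply']
    have h1 : HasFDerivAt (fun y => x - y) (-ContinuousLinearMap.id ℝ (EuclideanSpace ℝ (Fin d))) y :=
      (hasFDerivAt_id y).const_sub x
    have h2 := (((hg.iterate_dirDeriv v n).contDiff.differentiable (by simp)) (x - y)).hasFDerivAt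
    have h3 := h2.comp y h1
    have h4 : dirDeriv (-v) (fun y => (dirDeriv v)^[n] g (x - y)) y = _ :=
      congrArg (fun L : _ →L[ℝ] ℝ => L (-v)) h3.fderiv
    rw [h4]
    simp [dirDeriv]

/-- Annihilated directional derivatives make the mollifications of `w` polynomial on lines. -/
lemma exists_polynomial_of_annihilates (hw : LocallyIntegrable w volume) {n : ℕ}
    (hann : ∀ v f, IsTest f → ∫ x, w x * (dirDeriv v)^[n] f x = 0) (hg : IsTest g)
    (v : EuclideanSpace ℝ (Fin d)) :
    ∃ p : Polynomial ℝ, p.degree < n ∧ ∀ τ : ℝ, conv w g (τ • v) = p.eval τ := by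
  obtain ⟨p, hp, h⟩ := exists_polynomial_conv_line hw 0 v n hg fun y => by
    have h1 := hann (-v) (fun z => g (y - z)) (by
      have := (hg.comp_neg).comp_sub y
      simpa using this)
    rw [iterate_dirDeriv_comp_sub hg] at h1
    exact h1
  exact ⟨p, hp, fun τ => by simpa using h τ⟩

/-- The mollification of `w` averaged over the points `R v`, with `v` distributed by `κ`. -/
noncomputable def dilMean (κ w g : EuclideanSpace ℝ (Fin d) → ℝ) (R : ℝ) : ℝ :=
  ∫ v, κ v * conv w g (R • v)

/-- As a function of `R`, `dilMean κ w g R` is a superposition of polynomials of degree `< n`, and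
Lagrange interpolation at `n` nodes shows that it is a polynomial itself, without any measurable
choice of the coefficients. -/
lemma exists_polynomial_dilMean {κ : EuclideanSpace ℝ (Fin d) → ℝ} (hκ : IsTest κ)
    (hw : LocallyIntegrable w volume) {n : ℕ}
    (hann : ∀ v f, IsTest f → ∫ x, w x * (dirDeriv v)^[n] f x = 0) (hg : IsTest g) :
    ∃ Q : Polynomial ℝ, ∀ R, dilMean κ w g R = Q.eval R := by
  let nodes : ℕ → ℝ := fun i => i
  have hnodes : Set.InjOn nodes (Finset.range n) := fun i _ j _ h =>
    Nat.cast_injective (R := ℝ) h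
  refine ⟨∑ i ∈ Finset.range n,
    Polynomial.C (dilMean κ w g i) * Lagrange.basis (Finset.range n) nodes i, fun R => ?_⟩
  have hi : ∀ i : ℕ, Integrable fun v => κ v * conv w g ((i : ℝ) • v) := fun i =>
    (hκ.continuous.mul ((continuous_conv hw hg).comp
      (continuous_const_smul _))).integrable_of_hasCompactSupport hκ.hasCompactSupport.mul_right
  have h1 : ∀ v, conv w g (R • v) = ∑ i ∈ Finset.range n,
      conv w g ((i : ℝ) • v) * (Lagrange.basis (Finset.range n) nodes i).eval R := fun v => by
    obtain ⟨p, hp, hpe⟩ := exists_polynomial_of_annihilates hw hann hg v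
    have h2 := Lagrange.eq_interpolate hnodes (f := p) (by simpa using hp)
    rw [hpe R]
    conv_lhs => rw [h2]
    rw [Lagrange.interpolate_apply, Polynomial.eval_finsetSum]
    refine Finset.sum_congr rfl fun i _ => ?_
    rw [Polynomial.eval_mul, Polynomial.eval_C, hpe i]
  rw [Polynomial.eval_finsetSum]
  simp only [Polynomial.eval_mul, Polynomial.eval_C, dilMean, h1, Finset.mul_sum]
  rw [integral_finsetSum _ fun i _ => by
    simpa only [mul_assoc] using
      (hi i).mul_const ((Lagrange.basis (Finset.range n) nodes i).eval R)]
  refine Finset.sum_congr rfl fun i _ => ?_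
  rw [← integral_mul_const]
  congr 1; ext v; ring

lemma dilMean_eq_integral {κ : EuclideanSpace ℝ (Fin d) → ℝ} (hκ : IsTest κ)
    (hw : LocallyIntegrable w volume) (hg : IsTest g) (R : ℝ) :
    dilMean κ w g R = ∫ y, w y * ∫ v, κ v * g (R • v - y) := by
  obtain ⟨B, hB, hgB⟩ := hg.exists_bound
  obtain ⟨ρ, hρ1, hρ⟩ := hg.exists_support
  obtain ⟨σ, hσ1, hσ⟩ := hκ.exists_support
  set r : ℝ := |R| * σ + ρ with hr
  have hwi : Integrable ((Metric.closedBall (0 : EuclideanSpace ℝ (Fin d)) r).indicator w) :=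
    (integrable_indicator_iff measurableSet_closedBall).2
      (hw.integrableOn_isCompact (isCompact_closedBall _ _))
  have hint : Integrable (Function.uncurry fun v y : EuclideanSpace ℝ (Fin d) =>
      κ v * (w y * g (R • v - y))) (volume.prod volume) := by
    refine ((hκ.integrable.norm.mul_prod hwi.norm).const_mul B).mono' ?_ (ae_of_all _ fun p => ?_)
    · refine hκ.continuous.aestronglyMeasurable.comp_fst.mul
        (hw.aestronglyMeasurable.comp_snd.mul ?_)
      exact (hg.continuous.comp (by fun_prop)).aestronglyMeasurable
    · obtain ⟨v, y⟩ := p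
      simp only [Function.uncurry]
      rw [norm_mul, norm_mul]
      by_cases hv : σ ≤ ‖v‖
      · simp [hσ v hv]
      by_cases hy : y ∈ Metric.closedBall (0 : EuclideanSpace ℝ (Fin d)) r
      · rw [Set.indicator_of_mem hy]
        calc ‖κ v‖ * (‖w y‖ * ‖g (R • v - y)‖) ≤ ‖κ v‖ * (‖w y‖ * B) := by
              gcongr; exact hgB _
          _ = _ := by ring
      · rw [mem_closedBall_zero_iff, not_le] at hy
        have h1 : g (R • v - y) = 0 := by
          refine hρ _ ?_
          have h2 := norm_sub_norm_le y (R • v)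
          rw [norm_sub_rev, norm_smul, Real.norm_eq_abs] at h2
          have h3 : |R| * ‖v‖ ≤ |R| * σ := by gcongr; exact (not_le.1 hv).le
          linarith
        rw [h1, norm_zero, mul_zero, mul_zero]; positivity
  have h1 := integral_integral_swap hint
  simp only [integral_const_mul] at h1
  unfold dilMean conv
  rw [h1]
  congr 1; ext y
  rw [← integral_const_mul]
  congr 1; ext v; ring

/-- Since `g` has integral `0`, only the variation of `κ` contributes, which gains a factor `1/R`
over the trivial bound. -/
lemma abs_integral_kernel_le {κ : EuclideanSpace ℝ (Fin d) → ℝ} {L : ℝ}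
    (hL : ∀ x y, |κ x - κ y| ≤ L * ‖x - y‖) (hκ : IsTest κ) (hg : IsTest g) (hg0 : ∫ x, g x = 0)
    {ρ : ℝ} (hρ : ∀ x, ρ ≤ ‖x‖ → g x = 0) (hL0 : 0 ≤ L) {R : ℝ} (hR : 0 < R)
    (y : EuclideanSpace ℝ (Fin d)) :
    |∫ v, κ v * g (R • v - y)| ≤ (R ^ d)⁻¹ * (L * ρ * (∫ x, |g x|) / R) := by
  have h1 := Measure.integral_comp_smul (volume : Measure (EuclideanSpace ℝ (Fin d)))
    (fun z => κ (R⁻¹ • z) * g (z - y)) R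
  rw [finrank_euclideanSpace_fin, abs_of_nonneg (by positivity), smul_eq_mul] at h1
  simp only [inv_smul_smul₀ hR.ne'] at h1
  rw [h1, abs_mul, abs_of_nonneg (by positivity)]
  refine mul_le_mul_of_nonneg_left ?_ (by positivity)
  rw [← integral_add_right_eq_self _ y]
  simp only [add_sub_cancel_right]
  have h2 : ∫ z, κ (R⁻¹ • (z + y)) * g z = ∫ z, (κ (R⁻¹ • (z + y)) - κ (R⁻¹ • y)) * g z := by
    have hi : Integrable fun z => κ (R⁻¹ • (z + y)) * g z :=
      ((hκ.continuous.comp (by fun_prop)).mul hg.continuous).integrable_of_hasCompactSupport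
        hg.hasCompactSupport.mul_left
    simp only [sub_mul]
    rw [integral_sub hi (hg.integrable.const_mul _), integral_const_mul, hg0, mul_zero, sub_zero]
  rw [h2]
  have hb : ∀ z, ‖(κ (R⁻¹ • (z + y)) - κ (R⁻¹ • y)) * g z‖ ≤ (L * ρ / R) * |g z| := fun z => by
    by_cases hz : ρ ≤ ‖z‖
    · simp [hρ z hz]
    · rw [norm_mul]
      refine mul_le_mul_of_nonneg_right ((hL _ _).trans ?_) (abs_nonneg _)
      rw [← smul_sub, add_sub_cancel_right, norm_smul, norm_inv, Real.norm_of_nonneg hR.le,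
        mul_div_assoc, inv_mul_eq_div]
      have := (not_le.1 hz).le
      gcongr
  refine (norm_integral_le_of_norm_le (hg.integrable.abs.const_mul _) (ae_of_all _ hb)).trans
    (le_of_eq ?_)
  rw [integral_const_mul]; ring

/-- If the ring means of `w - l` stay bounded along a sequence of radii and `w` is annihilated by
all directional derivatives of some order, then `w` is orthogonal to the test functions with
integral `0`. -/
lemma integral_mul_eq_zero_of_ringMean (hd : 0 < d) (hw : LocallyIntegrable w volume) {n : ℕ}
    (hann : ∀ v f, IsTest f → ∫ x, w x * (dirDeriv v)^[n] f x = 0) {l : ℝ}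
    {x₀ : EuclideanSpace ℝ (Fin d)}
    (hring : liminf (ringMean (fun y => w y - l) x₀) atTop < ⊤)
    (hf : IsTest f) (hf0 : ∫ x, f x = 0) : ∫ x, w x * f x = 0 := by
  set g : EuclideanSpace ℝ (Fin d) → ℝ := fun x => f (-x) with hgdef
  have hg : IsTest g := hf.comp_neg
  have hg0 : ∫ x, g x = 0 := by rw [hgdef, integral_neg_eq_self]; exact hf0
  obtain ⟨ρ, hρ1, hρ⟩ := hg.exists_support
  -- a bump near the middle sphere of the ring
  let e : EuclideanSpace ℝ (Fin d) := EuclideanSpace.single ⟨0, hd⟩ (3 / 2)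
  have he : ‖e‖ = 3 / 2 := by simp [e]
  let χ : ContDiffBump e := ⟨1 / 20, 1 / 10, by norm_num, by norm_num⟩
  set κ : EuclideanSpace ℝ (Fin d) → ℝ := χ.normed volume with hκdef
  have hκ : IsTest κ := ⟨χ.contDiff_normed, χ.hasCompactSupport_normed⟩
  have hκ1 : ∫ x, κ x = 1 := χ.integral_normed
  have hκs : ∀ v, κ v ≠ 0 → 7 / 5 < ‖v‖ ∧ ‖v‖ < 8 / 5 := fun v hv => by
    have h1 : v ∈ Function.support (χ.normed volume) := hv
    rw [χ.support_normed_eq, mem_ball_iff_norm] at h1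
    have h1' : ‖v - e‖ < 1 / 10 := h1
    have h2 := norm_sub_norm_le v e
    have h3 := norm_sub_norm_le e v
    rw [norm_sub_rev] at h3
    constructor <;> linarith
  obtain ⟨L, hL⟩ := (hκ.contDiff.of_le (m := 1) (by simp)).lipschitzWith_of_hasCompactSupport
    hκ.hasCompactSupport one_ne_zero
  have hL' : ∀ x y, |κ x - κ y| ≤ L * ‖x - y‖ := fun x y => by
    have := hL.dist_le_mul x y
    rwa [Real.dist_eq, dist_eq_norm] at this
  obtain ⟨Q, hQ⟩ := exists_polynomial_dilMean hκ hw hann hg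
  set w' : EuclideanSpace ℝ (Fin d) → ℝ := fun y => w y - l with hw'def
  have hw' : LocallyIntegrable w' volume := hw.sub (locallyIntegrable_const l)
  have hconv : conv w' g = conv w g := by
    ext x
    have h1 : ∫ y, g (x - y) = 0 := by rw [integral_sub_left_eq_self]; exact hg0
    have hgx : IsTest fun y => g (x - y) := by
      have := (hg.comp_neg).comp_sub x
      simpa using this
    have hi : Integrable fun y => w y * g (x - y) := by
      have := hw.integrable_smul_left_of_hasCompactSupport hgx.continuous hgx.hasCompactSupport
      simpa only [smul_eq_mul, mul_comm] using this
    unfold conv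
    simp only [hw'def, sub_mul]
    rw [integral_sub hi (hgx.integrable.const_mul _), integral_const_mul, h1, mul_zero, sub_zero]
  have hmean : ∀ R, dilMean κ w g R = dilMean κ w' g R := fun R => by unfold dilMean; rw [hconv]
  set I := ∫ x, |g x| with hI
  have hI0 : 0 ≤ I := integral_nonneg fun _ => abs_nonneg _
  set D : ℝ := L * ρ * I with hD
  have hD0 : 0 ≤ D := by positivity
  -- for these `R` the averaging kernel is supported in the ring, as `7/5 - 1/5 > 1` and
  -- `8/5 + 1/5 < 2`
  have hbound : ∀ R, 5 * (ρ + ‖x₀‖) ≤ R → ENNReal.ofReal (|Q.eval R| * R)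
      ≤ ENNReal.ofReal D * ringMean w' x₀ R := fun R hR => by
    have hR0 : 0 < R := by have := norm_nonneg x₀; linarith
    set Kf : EuclideanSpace ℝ (Fin d) → ℝ := fun y => ∫ v, κ v * g (R • v - y) with hKf
    have hKs : ∀ y, y ∉ {y | R < ‖x₀ - y‖ ∧ ‖x₀ - y‖ < 2 * R} → Kf y = 0 := fun y hy => by
      rw [hKf]
      refine integral_eq_zero_of_ae (ae_of_all _ fun v => ?_)
      by_contra hne
      have hv : κ v ≠ 0 := left_ne_zero_of_mul hne
      have hgv : g (R • v - y) ≠ 0 := right_ne_zero_of_mul hne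
      have h1 : ‖R • v - y‖ < ρ := by
        by_contra hge
        exact hgv (hρ _ (not_lt.1 hge))
      obtain ⟨h2, h3⟩ := hκs v hv
      have h4 : ‖R • v‖ = R * ‖v‖ := by rw [norm_smul, Real.norm_of_nonneg hR0.le]
      refine hy ⟨?_, ?_⟩
      · have h5 : ‖R • v‖ ≤ ‖R • v - y‖ + ‖x₀ - y‖ + ‖x₀‖ := by
          have := norm_add₃_le (a := R • v - y) (b := -(x₀ - y)) (c := x₀)
          rwa [norm_neg, show R • v - y + -(x₀ - y) + x₀ = R • v by abel] at this
        nlinarith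
      · have h5 : ‖x₀ - y‖ ≤ ‖R • v - y‖ + ‖R • v‖ + ‖x₀‖ := by
          have := norm_add₃_le (a := R • v - y) (b := -(R • v)) (c := x₀)
          rwa [norm_neg, show R • v - y + -(R • v) + x₀ = x₀ - y by abel] at this
        nlinarith
    have hKb : ∀ y, |Kf y| ≤ (R ^ d)⁻¹ * (D / R) := fun y =>
      abs_integral_kernel_le hL' hκ hg hg0 hρ L.coe_nonneg hR0 y
    have h6 : ENNReal.ofReal |Q.eval R| ≤ ENNReal.ofReal ((R ^ d)⁻¹ * (D / R)) *
        ∫⁻ y in {y | R < ‖x₀ - y‖ ∧ ‖x₀ - y‖ < 2 * R}, ENNReal.ofReal |w' y| := by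
      rw [← hQ R, hmean R, dilMean_eq_integral hκ hw' hg R, ← Real.norm_eq_abs, ofReal_norm]
      refine (enorm_integral_le_lintegral_enorm _).trans ?_
      rw [← lintegral_const_mul' _ _ ENNReal.ofReal_ne_top,
        ← lintegral_indicator (measurableSet_ring x₀ R)]
      refine lintegral_mono fun y => ?_
      by_cases hy : y ∈ {y | R < ‖x₀ - y‖ ∧ ‖x₀ - y‖ < 2 * R}
      · rw [Set.indicator_of_mem hy, ← ofReal_norm, norm_mul, mul_comm,
          ENNReal.ofReal_mul (norm_nonneg _)]
        exact mul_le_mul_left (ENNReal.ofReal_le_ofReal (hKb y)) _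
      · have := hKs y hy
        rw [hKf] at this
        simp only at this
        rw [Set.indicator_of_notMem hy, this, mul_zero, enorm_zero]
    rw [ENNReal.ofReal_mul (abs_nonneg _)]
    refine (mul_le_mul_left h6 _).trans (le_of_eq ?_)
    unfold ringMean
    rw [ENNReal.ofReal_mul (by positivity), ENNReal.ofReal_inv_of_pos (by positivity),
      ENNReal.ofReal_div_of_pos hR0]
    have hRne : ENNReal.ofReal R ≠ 0 := by
      rw [Ne, ENNReal.ofReal_eq_zero, not_le]; exact hR0
    calc (ENNReal.ofReal (R ^ d))⁻¹ * (ENNReal.ofReal D / ENNReal.ofReal R) *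
          (∫⁻ y in {y | R < ‖x₀ - y‖ ∧ ‖x₀ - y‖ < 2 * R}, ENNReal.ofReal |w' y|) * ENNReal.ofReal R
        = (ENNReal.ofReal D / ENNReal.ofReal R * ENNReal.ofReal R) * ((ENNReal.ofReal (R ^ d))⁻¹ *
          ∫⁻ y in {y | R < ‖x₀ - y‖ ∧ ‖x₀ - y‖ < 2 * R}, ENNReal.ofReal |w' y|) := by ring
      _ = _ := by rw [ENNReal.div_mul_cancel hRne ENNReal.ofReal_ne_top]
  have hQ0 : Q = 0 := by
    obtain ⟨A, hA1, hA2⟩ := exists_between hring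
    have hfr := frequently_lt_of_liminf_lt (by isBoundedDefault) hA1
    refine Polynomial.eq_zero_of_frequently_le (A := (ENNReal.ofReal D * A).toReal) ?_
    refine (hfr.and_eventually (eventually_ge_atTop (5 * (ρ + ‖x₀‖)))).mono fun R hR => ?_
    have h1 := (hbound R hR.2).trans (mul_le_mul_right hR.1.le _)
    exact (ENNReal.ofReal_le_iff_le_toReal (ENNReal.mul_ne_top ENNReal.ofReal_ne_top hA2.ne)).1 h1
  -- at `R = 0` the mean is the single value `conv w g 0`
  have h0 := hQ 0
  rw [hQ0, Polynomial.eval_zero] at h0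
  unfold dilMean at h0
  simp only [zero_smul] at h0
  rw [integral_mul_const, hκ1, one_mul] at h0
  unfold conv at h0
  simpa [hgdef] using h0

/-- A locally integrable function annihilated by all directional derivatives of some order is
constant if its ring means do not tend to infinity. -/
lemma ae_eq_const_of_ringMean (hd : 0 < d) (hw : LocallyIntegrable w volume) {n : ℕ}
    (hann : ∀ v f, IsTest f → ∫ x, w x * (dirDeriv v)^[n] f x = 0) {l : ℝ}
    {x₀ : EuclideanSpace ℝ (Fin d)}
    (hring : liminf (ringMean (fun y => w y - l) x₀) atTop < ⊤) :
    ∃ c : ℝ, ∀ᵐ x, w x = c := by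
  have hk := isTest_radialBump (d := d)
  set c := ∫ x, w x * radialBump d x with hc
  have hwi : ∀ {f : EuclideanSpace ℝ (Fin d) → ℝ}, IsTest f → Integrable fun x => w x * f x :=
      fun hf => by
    have := hw.integrable_smul_left_of_hasCompactSupport hf.continuous hf.hasCompactSupport
    simpa only [smul_eq_mul, mul_comm] using this
  -- `f` minus a multiple of the density `radialBump d` has integral `0`
  refine ⟨c, ?_⟩
  have h := ae_eq_zero_of_integral_contDiff_smul_eq_zero (hw.sub (locallyIntegrable_const c))
    fun f hf1 hf2 => ?_
  · filter_upwards [h] with x hx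
    simpa [sub_eq_zero] using hx
  · have hf : IsTest f := ⟨hf1, hf2⟩
    have h1 := integral_mul_eq_zero_of_ringMean hd hw hann hring
      (hf.sub (hk.const_mul (∫ x, f x))) (by
        rw [integral_sub hf.integrable (hk.const_mul _).integrable, integral_const_mul,
          integral_radialBump, mul_one, sub_self])
    have h2 : ∀ x, w x * (f x - (∫ x, f x) * radialBump d x)
        = w x * f x - (∫ x, f x) * (w x * radialBump d x) := fun x => by ring
    simp only [h2] at h1
    rw [integral_sub (hwi hf) ((hwi hk).const_mul _), integral_const_mul, ← hc] at h1
    have h3 : ∀ x, f x * (w x - c) = w x * f x - c * f x := fun x => by ring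
    change ∫ x, f x * (w x - c) = 0
    simp only [h3]
    rw [integral_sub (hwi hf) (hf.integrable.const_mul _), integral_const_mul, mul_comm c]
    exact h1

end RingCondition

/-! ### Ring means -/

section RingMeans

variable {d : ℕ} {f g : EuclideanSpace ℝ (Fin d) → ℝ}

lemma liminf_le_liminf_of_le_add {f g e : ℝ → ℝ≥0∞} (h : ∀ᶠ R in atTop, f R ≤ g R + e R)
    (he : Tendsto e atTop (nhds 0)) : liminf f atTop ≤ liminf g atTop := by
  refine ENNReal.le_of_forall_pos_le_add fun ε hε hfin => ?_
  have hε2 : (0 : ℝ≥0∞) < ε / 2 := ENNReal.div_pos (by exact_mod_cast hε.ne') (by norm_num)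
  have h1 := frequently_lt_of_liminf_lt (by isBoundedDefault)
    (ENNReal.lt_add_right hfin.ne hε2.ne')
  refine liminf_le_of_frequently_le' ((h1.and_eventually
    (h.and (he.eventually_lt_const hε2))).mono fun R hR => ?_)
  calc f R ≤ g R + e R := hR.2.1
    _ ≤ (liminf g atTop + ε / 2) + ε / 2 := add_le_add hR.1.le hR.2.2.le
    _ = _ := by rw [add_assoc, ENNReal.add_halves]

lemma ringMean_congr_ae (h : f =ᵐ[volume] g) (x : EuclideanSpace ℝ (Fin d)) (R : ℝ) :
    ringMean f x R = ringMean g x R := by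
  unfold ringMean
  congr 1
  exact lintegral_congr_ae ((ae_restrict_of_ae h).mono fun y hy => by simp only [hy])

lemma ringMean_add_le (hg : AEStronglyMeasurable g volume) (x : EuclideanSpace ℝ (Fin d)) (R : ℝ) :
    ringMean (fun y => f y + g y) x R ≤ ringMean f x R + ringMean g x R := by
  unfold ringMean
  have hgm : AEMeasurable (fun y => ENNReal.ofReal |g y|) := hg.norm.aemeasurable.ennreal_ofReal
  rw [← mul_add, ← lintegral_add_right' _ hgm.restrict]
  refine mul_le_mul_right (lintegral_mono fun y => ?_) _
  exact (ENNReal.ofReal_le_ofReal (abs_add_le _ _)).trans ENNReal.ofReal_add_le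

lemma ringMean_const_mul (c : ℝ) (x : EuclideanSpace ℝ (Fin d)) (R : ℝ) :
    ringMean (fun y => c * f y) x R = ENNReal.ofReal |c| * ringMean f x R := by
  unfold ringMean
  simp only [abs_mul, ENNReal.ofReal_mul (abs_nonneg c)]
  rw [lintegral_const_mul' _ _ ENNReal.ofReal_ne_top]
  ring

/-- By scaling, the ring means of a constant do not depend on the radius. -/
lemma ringMean_const (c : ℝ) (x : EuclideanSpace ℝ (Fin d)) {R : ℝ} (hR : 0 < R) :
    ringMean (fun _ => c) x R = ENNReal.ofReal |c| * (ENNReal.ofReal (2 ^ d - 1) *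
      volume (Metric.ball (0 : EuclideanSpace ℝ (Fin d)) 1)) := by
  have h1 : {y | R < ‖x - y‖ ∧ ‖x - y‖ < 2 * R} = Metric.ball x (2 * R) \ Metric.closedBall x R := by
    ext y
    rw [Set.mem_sdiff, mem_ball_iff_norm, mem_closedBall_iff_norm, norm_sub_rev, not_le]
    exact and_comm
  have h2 : Metric.closedBall x R ⊆ Metric.ball x (2 * R) :=
    Metric.closedBall_subset_ball (by linarith)
  have hRd : ENNReal.ofReal (R ^ d) ≠ 0 := by
    rw [Ne, ENNReal.ofReal_eq_zero, not_le]; positivity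
  have h3 : volume {y | R < ‖x - y‖ ∧ ‖x - y‖ < 2 * R} = ENNReal.ofReal (R ^ d) *
      (ENNReal.ofReal (2 ^ d - 1) * volume (Metric.ball (0 : EuclideanSpace ℝ (Fin d)) 1)) := by
    rw [h1, measure_sdiff h2 measurableSet_closedBall.nullMeasurableSet
      measure_closedBall_lt_top.ne, Measure.addHaar_ball_of_pos _ _ (by positivity),
      Measure.addHaar_closedBall _ _ hR.le, finrank_euclideanSpace_fin,
      ← ENNReal.sub_mul fun _ _ => measure_ball_lt_top.ne, ← ENNReal.ofReal_sub _ (by positivity),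
      ← mul_assoc, ← ENNReal.ofReal_mul (by positivity)]
    congr 2; ring
  unfold ringMean
  rw [setLIntegral_const, h3, mul_left_comm, ENNReal.inv_mul_cancel_left hRd ENNReal.ofReal_ne_top]

lemma liminf_ringMean_const (c : ℝ) (x : EuclideanSpace ℝ (Fin d)) :
    liminf (ringMean (fun _ => c) x) atTop = ENNReal.ofReal |c| * (ENNReal.ofReal (2 ^ d - 1) *
      volume (Metric.ball (0 : EuclideanSpace ℝ (Fin d)) 1)) := by
  rw [liminf_congr ((eventually_gt_atTop (0 : ℝ)).mono fun R hR => ringMean_const c x hR)]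
  exact liminf_const _

end RingMeans

/-! ### Representation by Riesz potentials -/

section Representation

variable {d : ℕ} {s : ℝ} {T u : EuclideanSpace ℝ (Fin d) → ℝ}

lemma isRieszPotentialAdd_iff (hs : 0 < s) (hsd : s < (d : ℝ) / 2)
    (hTm : AEStronglyMeasurable T volume)
    (hTw : Integrable fun x => T x * (1 + ‖x‖) ^ (-((d : ℝ) - 2 * s))) {c : ℝ} :
    IsRieszPotentialAdd s T u c ↔ ∀ᵐ x, u x = rieszConst d (2 * s) * rieszPot s T x + c :=
  ⟨fun h => h.mono fun _ hx => hx.2, fun h =>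
    ((ae_integrable_kernel hs hsd hTm hTw).and h).mono fun _ hx => hx⟩

lemma aestronglyMeasurable_rieszPot (hs : 0 < s) (hsd : s < (d : ℝ) / 2)
    (hTm : AEStronglyMeasurable T volume)
    (hTw : Integrable fun x => T x * (1 + ‖x‖) ^ (-((d : ℝ) - 2 * s))) :
    AEStronglyMeasurable (rieszPot s T) volume :=
  (memWeightedL1_iff.2 (integrable_weight_mul_rieszPot hs hsd hTm hTw)).1.aestronglyMeasurable

lemma tendsto_ringMean_const_mul_rieszPot (hs : 0 < s) (hsd : s < (d : ℝ) / 2) (hd : 0 < d)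
    (hTm : AEStronglyMeasurable T volume)
    (hTw : Integrable fun x => T x * (1 + ‖x‖) ^ (-((d : ℝ) - 2 * s))) (c : ℝ)
    (x : EuclideanSpace ℝ (Fin d)) :
    Tendsto (ringMean (fun y => c * rieszPot s T y) x) atTop (nhds 0) := by
  have h := ENNReal.Tendsto.const_mul (a := ENNReal.ofReal |c|)
    (tendsto_ringMean_rieszPot hs hsd hd hTm hTw x) (Or.inr ENNReal.ofReal_ne_top)
  rw [mul_zero] at h
  exact h.congr fun R => (ringMean_const_mul c x R).symm

/-- Adding a Riesz potential does not change the lower limit of the ring means. -/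
lemma ringLiminf_eq_of_ae_eq (hs : 0 < s) (hsd : s < (d : ℝ) / 2) (hd : 0 < d)
    (hTm : AEStronglyMeasurable T volume)
    (hTw : Integrable fun x => T x * (1 + ‖x‖) ^ (-((d : ℝ) - 2 * s))) (l c : ℝ)
    {w : EuclideanSpace ℝ (Fin d) → ℝ} (h : ∀ᵐ x, u x = c * rieszPot s T x + w x)
    (x : EuclideanSpace ℝ (Fin d)) :
    ringLiminf u l x = liminf (ringMean (fun y => w y - l) x) atTop := by
  have hP := aestronglyMeasurable_rieszPot hs hsd hTm hTw
  refine le_antisymm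
    (liminf_le_liminf_of_le_add (f := ringMean (fun y => u y - l) x) (Eventually.of_forall fun R => ?_)
      (tendsto_ringMean_const_mul_rieszPot hs hsd hd hTm hTw c x))
    (liminf_le_liminf_of_le_add (g := ringMean (fun y => u y - l) x) (Eventually.of_forall fun R => ?_)
      (tendsto_ringMean_const_mul_rieszPot hs hsd hd hTm hTw (-c) x))
  · refine le_trans (le_of_eq (ringMean_congr_ae ?_ x R)) (ringMean_add_le (hP.const_mul c) x R)
    filter_upwards [h] with y hy
    rw [hy]; ring
  · refine le_trans (le_of_eq (ringMean_congr_ae ?_ x R)) (ringMean_add_le (hP.const_mul (-c)) x R)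
    filter_upwards [h] with y hy
    rw [hy]; ring

lemma integrable_mul_fracLaplacian (hd : 0 < d) (hs : 0 < s) (hu : MemWeightedL1 s u)
    {φ : EuclideanSpace ℝ (Fin d) → ℝ} (hφ : IsTest φ) :
    Integrable fun x => u x * fracLaplacian s φ x := by
  obtain ⟨C, hC, hdec⟩ := exists_decay_fracLaplacian hd hs hφ
  refine ((memWeightedL1_iff.1 hu).norm.const_mul C).mono'
    (hu.1.aestronglyMeasurable.mul (continuous_fracLaplacian hφ hs).aestronglyMeasurable)
    (ae_of_all _ fun x => ?_)
  rw [norm_mul, norm_mul, Real.norm_of_nonneg (by positivity : 0 ≤ (1 + ‖x‖) ^ (-((d : ℝ) + 2 * s)))]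
  calc ‖u x‖ * ‖fracLaplacian s φ x‖ ≤ ‖u x‖ * (C * (1 + ‖x‖) ^ (-((d : ℝ) + 2 * s))) := by
        gcongr; exact hdec x
    _ = _ := by ring

lemma memWeightedL1_rieszPot_add_const (hs : 0 < s) (hsd : s < (d : ℝ) / 2)
    (hTm : AEStronglyMeasurable T volume)
    (hTw : Integrable fun x => T x * (1 + ‖x‖) ^ (-((d : ℝ) - 2 * s))) {A c : ℝ}
    (h : ∀ᵐ x, u x = A * rieszPot s T x + c) : MemWeightedL1 s u := by
  have hI : Integrable fun y : EuclideanSpace ℝ (Fin d) => (1 + ‖y‖) ^ (-((d : ℝ) + 2 * s)) :=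
    integrable_one_add_norm (by simp; linarith)
  refine memWeightedL1_iff.2 ((((integrable_weight_mul_rieszPot hs hsd hTm hTw).const_mul A).add
    (hI.const_mul c)).congr ?_)
  filter_upwards [h] with x hx
  rw [hx, Pi.add_apply]; ring

lemma solvesFracPoisson_of_ae_eq (hs : 0 < s) (hsd : s < (d : ℝ) / 2) (hd : 0 < d)
    (hTm : AEStronglyMeasurable T volume)
    (hTw : Integrable fun x => T x * (1 + ‖x‖) ^ (-((d : ℝ) - 2 * s))) {c : ℝ}
    (h : ∀ᵐ x, u x = rieszConst d (2 * s) * rieszPot s T x + c) : SolvesFracPoisson s u T := by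
  intro φ hφ1 hφ2
  have hφ : IsTest φ := ⟨hφ1, hφ2⟩
  have hP : MemWeightedL1 s fun x => rieszConst d (2 * s) * rieszPot s T x :=
    memWeightedL1_rieszPot_add_const (c := 0) hs hsd hTm hTw (ae_of_all _ fun x => (add_zero _).symm)
  have h1 : ∫ x, u x * fracLaplacian s φ x = ∫ x, (rieszConst d (2 * s) * rieszPot s T x *
      fracLaplacian s φ x + c * fracLaplacian s φ x) := by
    refine integral_congr_ae ?_
    filter_upwards [h] with x hx
    rw [hx]; ring
  rw [h1, integral_add (integrable_mul_fracLaplacian hd hs hP hφ)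
    ((integrable_fracLaplacian hd hs hφ).const_mul c), integral_const_mul,
    integral_fracLaplacian hd hs hφ, mul_zero, add_zero,
    integral_rieszPot_mul_fracLaplacian hs hsd hd hTm hTw hφ]

/-- A weighted solution whose ring means do not tend to infinity differs from the Riesz potential by
a constant. -/
lemma exists_eq_rieszPot_add_const (hs : 0 < s) (hsd : s < (d : ℝ) / 2) (hd : 0 < d)
    (hTm : AEStronglyMeasurable T volume)
    (hTw : Integrable fun x => T x * (1 + ‖x‖) ^ (-((d : ℝ) - 2 * s)))
    (hu : MemWeightedL1 s u) (hsol : SolvesFracPoisson s u T) {l : ℝ}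
    {x₀ : EuclideanSpace ℝ (Fin d)} (hring : ringLiminf u l x₀ < ⊤) :
    ∃ c : ℝ, ∀ᵐ x, u x = rieszConst d (2 * s) * rieszPot s T x + c := by
  have hP : MemWeightedL1 s fun x => rieszConst d (2 * s) * rieszPot s T x :=
    memWeightedL1_rieszPot_add_const (c := 0) hs hsd hTm hTw (ae_of_all _ fun x => (add_zero _).symm)
  set w : EuclideanSpace ℝ (Fin d) → ℝ := fun x => u x - rieszConst d (2 * s) * rieszPot s T x with hw
  have hwi : Integrable fun x => (1 + ‖x‖) ^ (-((d : ℝ) + 2 * s)) * w x :=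
    ((memWeightedL1_iff.1 hu).sub (memWeightedL1_iff.1 hP)).congr
      (ae_of_all _ fun x => (mul_sub _ _ _).symm)
  have hwsol : ∀ φ, IsTest φ → ∫ x, w x * fracLaplacian s φ x = 0 := fun φ hφ => by
    simp only [hw, sub_mul]
    rw [integral_sub (integrable_mul_fracLaplacian hd hs hu hφ)
      (integrable_mul_fracLaplacian hd hs hP hφ),
      integral_rieszPot_mul_fracLaplacian hs hsd hd hTm hTw hφ,
      hsol φ hφ.contDiff hφ.hasCompactSupport, sub_self]
  obtain ⟨n, hn⟩ := exists_nat_gt (2 * s)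
  have hring' : liminf (ringMean (fun y => w y - l) x₀) atTop < ⊤ := by
    rwa [← ringLiminf_eq_of_ae_eq hs hsd hd hTm hTw l (rieszConst d (2 * s))
      (ae_of_all _ fun x => (add_sub_cancel _ _).symm) x₀]
  obtain ⟨c, hc⟩ := ae_eq_const_of_ringMean hd (memWeightedL1_iff.2 hwi).1
    (fun v f hf => integral_mul_iterate_dirDeriv_eq_zero hd hs hwi hwsol hn v hf) hring'
  refine ⟨c, hc.mono fun x hx => ?_⟩
  rw [← hx]; simp only [hw]; ring

end Representation

theorem theorem1p2 {d : ℕ} {s : ℝ} (hs : 0 < s) (hsd : s < (d : ℝ) / 2)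
    (T : EuclideanSpace ℝ (Fin d) → ℝ) (hT : MemDualHomSobolevL1Loc s T)
    (hT0 : ∀ᵐ x, 0 ≤ T x) (l : ℝ) (u : EuclideanSpace ℝ (Fin d) → ℝ) :
    ((MemWeightedL1 s u ∧ SolvesFracPoisson s u T ∧ ∀ᵐ x, ringLiminf u l x = 0) ↔
      IsRieszPotentialAdd s T u l) ∧
    ((MemWeightedL1 s u ∧ SolvesFracPoisson s u T ∧ ∀ᵐ x, ringLiminf u l x < ⊤) ↔
      ∃ c : ℝ, IsRieszPotentialAdd s T u c) := by
  have hd : 0 < d := dim_pos_of_lt_half hs hsd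
  have hTm : AEStronglyMeasurable T volume := hT.1.aestronglyMeasurable
  have hTw := integrable_mul_one_add_norm_rpow hsd hT hT0
  simp only [isRieszPotentialAdd_iff hs hsd hTm hTw]
  -- the ring means of a representable function detect the additive constant
  have hlim : ∀ c : ℝ, (∀ᵐ x, u x = rieszConst d (2 * s) * rieszPot s T x + c) →
      ∀ x, ringLiminf u l x = ENNReal.ofReal |c - l| * (ENNReal.ofReal (2 ^ d - 1) *
        volume (Metric.ball (0 : EuclideanSpace ℝ (Fin d)) 1)) := fun c h x => by
    rw [ringLiminf_eq_of_ae_eq (w := fun _ => c) hs hsd hd hTm hTw l _ h x, liminf_ringMean_const]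
  have hback : ∀ c : ℝ, (∀ᵐ x, u x = rieszConst d (2 * s) * rieszPot s T x + c) →
      MemWeightedL1 s u ∧ SolvesFracPoisson s u T := fun c h =>
    ⟨memWeightedL1_rieszPot_add_const hs hsd hTm hTw h,
      solvesFracPoisson_of_ae_eq hs hsd hd hTm hTw h⟩
  refine ⟨⟨fun ⟨hu, hsol, hring⟩ => ?_, fun h => ?_⟩, ⟨fun ⟨hu, hsol, hring⟩ => ?_, fun ⟨c, h⟩ => ?_⟩⟩
  · obtain ⟨x₀, hx₀⟩ := hring.exists
    obtain ⟨c, hc⟩ := exists_eq_rieszPot_add_const hs hsd hd hTm hTw hu hsol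
      (hx₀.trans_lt ENNReal.zero_lt_top)
    have h0 := hlim c hc x₀
    have h2 : (1 : ℝ) < 2 ^ d := one_lt_pow₀ one_lt_two hd.ne'
    have h3 : ENNReal.ofReal (2 ^ d - 1) ≠ 0 := by
      rw [Ne, ENNReal.ofReal_eq_zero, not_le]; linarith
    have h4 := (Metric.measure_ball_pos volume (0 : EuclideanSpace ℝ (Fin d)) one_pos).ne'
    rw [hx₀, zero_eq_mul, or_iff_left (mul_ne_zero h3 h4), ENNReal.ofReal_eq_zero,
      abs_nonpos_iff, sub_eq_zero] at h0
    rwa [h0] at hc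
  · exact ⟨(hback l h).1, (hback l h).2, ae_of_all _ fun x => by rw [hlim l h x]; simp⟩
  · obtain ⟨x₀, hx₀⟩ := hring.exists
    exact exists_eq_rieszPot_add_const hs hsd hd hTm hTw hu hsol hx₀
  · refine ⟨(hback c h).1, (hback c h).2, ae_of_all _ fun x => ?_⟩
    rw [hlim c h x]
    exact ENNReal.mul_lt_top ENNReal.ofReal_lt_top
      (ENNReal.mul_lt_top ENNReal.ofReal_lt_top measure_ball_lt_top)
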